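/- Let $\mathfrak A$ be an additive category with finite limits and finite colimits, and let $\mathfrak I$ be a class of objects of $\mathfrak A$ (the basic objects). A map $i:X\to Y$ is a *cofibration* if $\hom(i,I)$ is surjective for all $I\in\mathfrak I$. An object $F$ is *relatively injective* if $\hom(-,F)$ maps cofibrations to surjections. A chain map $f$ of complexes in $\mathfrak A$ is a *weak equivalence* if $\operatorname{Hom}(f,I)$ is a quasi-isomorphism of complexes of abelian groups for every relatively injective object $I$ (placed in degree $0$). A complex $Q$ is *weakly contractible* if $0\to Q$ is a weak equivalence. Let $\otimes$ be a symmetric monoidal structure on $\mathfrak A$ with unit $k$ such that, for every object $A$, the functors $A\otimes-$ and $-\otimes A$ are additive, preserve cofibrations, preserve pushouts along cofibrations, and preserve all cokernels. An *algebra* is an object $A$ with an associative multiplication $\mu:A\otimes A\to A$; no unit is required. Let $\operatorname{alg}\mathfrak A$ denote the category of algebras. For an algebra $A$ put $C_nA=A^{\otimes n+1}$ $(n\ge 0)$. In element notation: $$b'(a_0\otimes\cdots\otimes a_n)=\sum_{i=0}^{n-1}(-1)^i a_0\otimes\cdots\otimes a_ia_{i+1}\otimes\cdots\otimes a_n,$$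 $$b(a_0\otimes\cdots\otimes a_n)=b'(a_0\otimes\cdots\otimes a_n)+(-1)^n a_na_0\otimes a_1\otimes\cdots\otimes a_{n-1}\quad(n\ge 1),$$ $$t(a_0\otimes\cdots\otimes a_n)=(-1)^n a_n\otimes a_0\otimes\cdots\otimes a_{n-1},\qquad N=\sum_{i=0}^n t^i,$$ with $b=b'=0$ on $C_0A$. * $C(A)=(C_*A,b)$ and $C^{bar}(A)=(C_*A,b')$. * $\Omega A$ is the mixed complex with $\Omega^0A=A$ and $\Omega^nA=(A\oplus k)\otimes A^{\otimes n}=C_nA\oplus C_{n-1}A$ for $n\ge1$. Its operators are $b(x,y)=(bx+(1-t)y,\,-b'y)$ and $B(x,y)=(0,Nx)$. * $\mathfrak B\Omega A$ is the complex with $(\mathfrak B\Omega A)_n=\bigoplus_{p\ge 0}\Omega^{n-2p}A$ and differential $b+B$. Here $B$ lowers the index $p$ by one and is zero on the summand $p=0$. Let $K,A$ be algebras. We say that $K$ is a *cof-ideal* of $A$ if we are given a map of algebras $K\rightarrowtail A$ which is a monomorphism and a cofibration, and through which the multiplications $A\otimes K\to A$ and $K\otimes A\to A$ factor. Put $Y_0=K$,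 $Y_1=A$, and let $$C_n(K:A)=\operatorname{colim}_{f}\;Y_{f(0)}\otimes\cdots\otimes Y_{f(n)},$$ where $f$ runs over the partially ordered set of all maps $\{0,\dots,n\}\to\{0<1\}$ other than the constant map $1$. The formulas above define operators $b,b',t,N$ on $C_*(K:A)$, and hence relative complexes $C(K:A)$, $C^{bar}(K:A)$, $\Omega(K:A)$ and $\mathfrak B\Omega(K:A)$. The inclusion of the term $f=0$ gives natural maps $D(K)\to D(K:A)$ for $D\in\{C,C^{bar},\Omega,\mathfrak B\Omega\}$. The algebra $K$ is *$D$-excisive* if $D(K)\to D(K:A)$ is a weak equivalence (for $D=\Omega$, of the underlying complexes with differential $b$) for every algebra $A$ in which $K$ is a cof-ideal. **Theorem.** For every $K\in\operatorname{alg}\mathfrak A$ the following are equivalent: 1. $V\otimes C^{bar}K$ is weakly contractible for every object $V$ of $\mathfrak A$; 2. $K$ is $C$-excisive; 3. $K$ is $C^{bar}$-excisive; 4. $K$ is $\Omega$-excisive; 5. $K$ is $\mathfrak B\Omega$-excisive. -/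

import Mathlib

set_option linter.unusedSectionVars false

open CategoryTheory CategoryTheory.Limits MonoidalCategory

universe v u

namespace Wodzicki

/-! ## Precyclic objects -/

section Precyclic

variable {C : Type u} [Category.{v} C]

/-- The iterates of an endomorphism. -/
def iter {X : C} (f : X ⟶ X) : ℕ → (X ⟶ X)
  | 0 => 𝟙 X
  | k + 1 => iter f k ≫ f

@[simp] lemma iter_zero {X : C} (f : X ⟶ X) : iter f 0 = 𝟙 X := rfl
lemma iter_succ {X : C} (f : X ⟶ X) (k : ℕ) : iter f (k + 1) = iter f k ≫ f := rfl
lemma iter_succ' {X : C} (f : X ⟶ X) (k : ℕ) : iter f (k + 1) = f ≫ iter f k := by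
  induction k with
  | zero => simp [iter]
  | succ k ih => rw [iter_succ, ih, Category.assoc, ← iter_succ, ih]
lemma iter_add {X : C} (f : X ⟶ X) (k l : ℕ) : iter f (k + l) = iter f k ≫ iter f l := by
  induction l with
  | zero => simp
  | succ l ih => rw [← add_assoc, iter_succ, ih, iter_succ, Category.assoc]

/-- A cyclic object without degeneracies. `obj n` has to be thought of as `A ⊗ ⋯ ⊗ A` with `n + 1`
factors; `face n i` multiplies the factors number `i` and `i + 1` (the last, cyclic, face is
`rot (n + 1) ≫ face n 0`) and `rot n` moves the last factor to the front (without sign). It is an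
auxiliary notion: the precyclic objects of an algebra and of a cof-ideal are constructed below. -/
structure Precyclic (C : Type u) [Category.{v} C] where
  obj : ℕ → C
  face (n : ℕ) (i : Fin (n + 1)) : obj (n + 1) ⟶ obj n
  rot (n : ℕ) : obj n ⟶ obj n
  face_face (n : ℕ) (i j : Fin (n + 1)) (h : i ≤ j) :
    face (n + 1) j.succ ≫ face n i = face (n + 1) i.castSucc ≫ face n j
  rot_face (n : ℕ) (i : Fin n) :
    rot (n + 1) ≫ face n i.succ = face n i.castSucc ≫ rot n
  iter_rot (n : ℕ) : iter (rot n) (n + 1) = 𝟙 (obj n)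

namespace Precyclic

/-- Morphisms of precyclic objects. -/
@[ext]
structure Hom (X Y : Precyclic C) where
  app (n : ℕ) : X.obj n ⟶ Y.obj n
  face_app (n : ℕ) (i : Fin (n + 1)) : X.face n i ≫ app n = app (n + 1) ≫ Y.face n i
  rot_app (n : ℕ) : X.rot n ≫ app n = app n ≫ Y.rot n

instance : Category (Precyclic C) where
  Hom := Hom
  id X := { app := fun _ => 𝟙 _, face_app := by simp, rot_app := by simp }
  comp f g :=
    { app := fun n => f.app n ≫ g.app n
      face_app := fun n i => by
        rw [← Category.assoc, Hom.face_app, Category.assoc, Hom.face_app, Category.assoc]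
      rot_app := fun n => by
        rw [← Category.assoc, Hom.rot_app, Category.assoc, Hom.rot_app, Category.assoc] }

/-- The components of a morphism. -/
abbrev app {X Y : Precyclic C} (f : X ⟶ Y) (n : ℕ) : X.obj n ⟶ Y.obj n := Hom.app f n

@[ext]
lemma hom_ext {X Y : Precyclic C} {f g : X ⟶ Y} (h : ∀ n, app f n = app g n) : f = g :=
  Hom.ext (funext h)

@[simp] lemma id_app (X : Precyclic C) (n : ℕ) : app (𝟙 X) n = 𝟙 _ := rfl
@[simp] lemma comp_app {X Y Z : Precyclic C} (f : X ⟶ Y) (g : Y ⟶ Z) (n : ℕ) :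
    app (f ≫ g) n = app f n ≫ app g n := rfl

variable [Preadditive C]

lemma sum_faces_comp {P Q R : C} (k : ℕ) (d₂ : Fin (k + 2) → (P ⟶ Q)) (d₁ : Fin (k + 1) → (Q ⟶ R))
    (h : ∀ i j : Fin (k + 1), i ≤ j → d₂ j.succ ≫ d₁ i = d₂ i.castSucc ≫ d₁ j) :
    (∑ i : Fin (k + 2), (-1 : ℤ) ^ (i : ℕ) • d₂ i) ≫
      (∑ i : Fin (k + 1), (-1 : ℤ) ^ (i : ℕ) • d₁ i) = 0 := by
  simp only [Preadditive.comp_sum, Preadditive.sum_comp, ← Finset.sum_product']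
  let P := Fin (k + 1) × Fin (k + 2)
  let S : Finset P := {ij : P | (ij.2 : ℕ) ≤ (ij.1 : ℕ)}
  rw [Finset.univ_product_univ, ← Finset.sum_add_sum_compl S, ← eq_neg_iff_add_eq_zero,
    ← Finset.sum_neg_distrib]
  let φ : ∀ ij : P, ij ∈ S → P := fun ij hij =>
    (Fin.castLT ij.2 (lt_of_le_of_lt (Finset.mem_filter.mp hij).right (Fin.is_lt ij.1)), ij.1.succ)
  apply Finset.sum_bij φ
  · intro ij hij
    simp_rw [S, φ, Finset.compl_filter, Finset.mem_filter_univ, Fin.val_succ,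
      Fin.val_castLT] at hij ⊢
    lia
  · rintro ⟨i, j⟩ hij ⟨i', j'⟩ hij' h
    rw [Prod.mk_inj]
    exact ⟨by simpa [φ] using! congr_arg Prod.snd h,
      by simpa [φ, Fin.castSucc_castLT] using! congr_arg Fin.castSucc (congr_arg Prod.fst h)⟩
  · rintro ⟨i', j'⟩ hij'
    simp_rw [S, Finset.compl_filter, Finset.mem_filter_univ, not_le] at hij'
    refine ⟨(j'.pred <| ?_, Fin.castSucc i'), ?_, ?_⟩
    · rintro rfl
      simp only [Fin.val_zero, not_lt_zero] at hij'
    · simpa [S] using! Nat.le_sub_one_of_lt hij'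
    · simp only [φ, Fin.castLT_castSucc, Fin.succ_pred]
  · rintro ⟨i, j⟩ hij
    dsimp
    simp only [Preadditive.zsmul_comp, Preadditive.comp_zsmul, smul_smul, ← neg_smul]
    congr 1
    · simp only [φ, Fin.val_succ, pow_add, pow_one, mul_neg, neg_neg, mul_one]
      apply mul_comm
    · have hij' : (j : ℕ) ≤ (i : ℕ) := by simpa [S] using! hij
      have := h (Fin.castLT j (lt_of_le_of_lt hij' i.2)) i hij'
      simpa [φ] using this.symm

variable (X : Precyclic C)

/-- The signed cyclic operator `(-1)ⁿ rot`. -/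
def t (n : ℕ) : X.obj n ⟶ X.obj n := (-1 : ℤ) ^ n • X.rot n

/-- The norm operator `1 + t + ⋯ + tⁿ`. -/
def N (n : ℕ) : X.obj n ⟶ X.obj n := ∑ i ∈ Finset.range (n + 1), iter (X.t n) i

/-- The boundary `∑_{i = 0}^{n} (-1)ⁱ μᵢ` of the bar complex, on `n + 2` factors. -/
def b' (n : ℕ) : X.obj (n + 1) ⟶ X.obj n :=
  ∑ i : Fin (n + 1), (-1 : ℤ) ^ (i : ℕ) • X.face n i

/-- The Hochschild boundary `∑_{i = 0}^{n + 1} (-1)ⁱ μᵢ`, on `n + 2` factors, where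
`μ_{n + 1} = μ₀ ∘ rot`. -/
def b (n : ℕ) : X.obj (n + 1) ⟶ X.obj n :=
  X.b' n + (-1 : ℤ) ^ (n + 1) • (X.rot (n + 1) ≫ X.face n 0)

lemma b'_b' (n : ℕ) : X.b' (n + 1) ≫ X.b' n = 0 :=
  sum_faces_comp n _ _ (X.face_face n)

/-- The faces with their signs. -/
def sf (n : ℕ) (i : Fin (n + 1)) : X.obj (n + 1) ⟶ X.obj n :=
  (-1 : ℤ) ^ (i : ℕ) • X.face n i

lemma b'_eq (n : ℕ) : X.b' n = ∑ i, X.sf n i := rfl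

lemma b_eq (n : ℕ) : X.b n = X.b' n + X.t (n + 1) ≫ X.sf n 0 := by
  simp [b, t, sf]

lemma iter_t (n : ℕ) : iter (X.t n) (n + 1) = 𝟙 _ := by
  have h (k : ℕ) : iter (X.t n) k = (-1 : ℤ) ^ (n * k) • iter (X.rot n) k := by
    induction k with
    | zero => simp
    | succ k ih =>
      rw [iter_succ, ih, t, iter_succ, Preadditive.zsmul_comp, Preadditive.comp_zsmul, smul_smul,
        mul_add, pow_add, mul_one]
  rw [h, X.iter_rot, (Nat.even_mul_succ_self n).neg_one_pow, one_smul]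

lemma t_sf (n : ℕ) (i : Fin n) :
    X.t (n + 1) ≫ X.sf n i.succ = X.sf n i.castSucc ≫ X.t n := by
  simp only [t, sf, Preadditive.zsmul_comp, Preadditive.comp_zsmul, X.rot_face, smul_smul,
    Fin.val_succ, Fin.val_castSucc]
  congr 1
  ring

lemma iter_t_sf (n : ℕ) (k : ℕ) (h : k < n + 1) :
    iter (X.t (n + 1)) k ≫ X.sf n ⟨k, h⟩ = X.sf n 0 ≫ iter (X.t n) k := by
  induction k with
  | zero => simp
  | succ k ih =>
    have h1 := ih (by lia)
    have h2 := X.t_sf n ⟨k, by lia⟩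
    simp only [Fin.succ_mk, Fin.castSucc_mk] at h2
    rw [iter_succ, Category.assoc, h2, reassoc_of% h1, iter_succ]

lemma t_N (n : ℕ) : X.t n ≫ X.N n = X.N n := by
  have h : X.t n ≫ X.N n + 𝟙 _ = X.N n + iter (X.t n) (n + 1) := by
    rw [N, Preadditive.comp_sum]
    simp only [← iter_succ']
    rw [← Finset.sum_range_succ, Finset.sum_range_succ' _ (n + 1), iter_zero]
  rwa [iter_t, add_left_inj] at h

lemma N_t (n : ℕ) : X.N n ≫ X.t n = X.N n := by
  conv_rhs => rw [← X.t_N]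
  simp only [N, Preadditive.sum_comp, Preadditive.comp_sum]
  exact Finset.sum_congr rfl fun i _ => by rw [← iter_succ, ← iter_succ']

lemma iter_t_N (n k : ℕ) : iter (X.t n) k ≫ X.N n = X.N n := by
  induction k with
  | zero => simp
  | succ k ih => rw [iter_succ, Category.assoc, t_N, ih]

lemma N_iter_t (n k : ℕ) : X.N n ≫ iter (X.t n) k = X.N n := by
  induction k with
  | zero => simp
  | succ k ih => rw [iter_succ, ← Category.assoc, ih, N_t]

lemma sf_eq (n : ℕ) (k : ℕ) (h : k < n + 1) :
    X.sf n ⟨k, h⟩ = iter (X.t (n + 1)) (n + 2 - k) ≫ X.sf n 0 ≫ iter (X.t n) k := by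
  rw [← X.iter_t_sf n k h, ← Category.assoc, ← iter_add, Nat.sub_add_cancel (by lia), iter_t,
    Category.id_comp]

lemma N_b' (n : ℕ) : X.N (n + 1) ≫ X.b' n = X.b n ≫ X.N n := by
  trans X.N (n + 1) ≫ X.sf n 0 ≫ X.N n
  · have h (i : Fin (n + 1)) : X.N (n + 1) ≫ X.sf n i =
        X.N (n + 1) ≫ X.sf n 0 ≫ iter (X.t n) i := by
      rw [← X.iter_t_sf n i i.2, ← Category.assoc, N_iter_t]
    rw [b'_eq, Preadditive.comp_sum, Finset.sum_congr rfl fun i _ => h i,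
      ← Preadditive.comp_sum, ← Preadditive.comp_sum, N, N, Finset.sum_range (n := n + 1)]
  · have h (i : Fin (n + 1)) : X.sf n i ≫ X.N n =
        iter (X.t (n + 1)) (n + 2 - i) ≫ X.sf n 0 ≫ X.N n := by
      rw [X.sf_eq n i i.2, Category.assoc, Category.assoc, iter_t_N]
    have h2 : X.N (n + 1) = ∑ i : Fin (n + 1), iter (X.t (n + 1)) (n + 2 - i) + X.t (n + 1) := by
      have h3 := Finset.sum_range_reflect (fun i => iter (X.t (n + 1)) (i + 2)) (n + 1)
      rw [N, Finset.sum_range_succ', Finset.sum_range_succ', iter_zero, ← X.iter_t (n + 1),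
        add_right_comm, iter_succ' _ 0, iter_zero, Category.comp_id, add_left_inj]
      have h4 : ∑ i : Fin (n + 1), iter (X.t (n + 1)) (n + 2 - i) =
          ∑ i ∈ Finset.range n, iter (X.t (n + 1)) (i + 1 + 1) + iter (X.t (n + 1)) (n + 2) := by
        rw [← Finset.sum_range_succ (fun i => iter (X.t (n + 1)) (i + 1 + 1)) n, ← h3,
          Finset.sum_range]
        refine Finset.sum_congr rfl fun i _ => ?_
        congr 1
        lia
      rw [h4]
    rw [b_eq, b'_eq, Preadditive.add_comp, Preadditive.sum_comp, Category.assoc,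
      Finset.sum_congr rfl fun i _ => h i, ← Preadditive.sum_comp, ← Preadditive.add_comp, h2]

lemma t_b (n : ℕ) : X.t (n + 1) ≫ X.b n + X.b' n = X.b n + X.b' n ≫ X.t n := by
  have h1 : X.t (n + 1) ≫ X.b' n = X.t (n + 1) ≫ X.sf n 0 +
      ∑ i : Fin n, X.sf n i.castSucc ≫ X.t n := by
    rw [b'_eq, Preadditive.comp_sum, Fin.sum_univ_succ]
    simp only [t_sf]
  have h2 : X.b' n ≫ X.t n = ∑ i : Fin n, X.sf n i.castSucc ≫ X.t n +
      X.t (n + 1) ≫ X.t (n + 1) ≫ X.sf n 0 := by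
    rw [b'_eq, Preadditive.sum_comp, Fin.sum_univ_castSucc]
    congr 1
    rw [Fin.last, X.sf_eq n n (by lia), Nat.add_sub_cancel_left, Category.assoc, Category.assoc,
      ← iter_succ, iter_t, Category.comp_id, iter_succ, iter_succ, iter_zero, Category.id_comp,
      Category.assoc]
  rw [b_eq, Preadditive.comp_add, h1, h2]
  abel

lemma b_b (n : ℕ) : X.b (n + 1) ≫ X.b n = 0 := by
  have h0 : X.sf (n + 1) (0 : Fin (n + 1)).succ ≫ X.sf n 0 = - X.sf (n + 1) 0 ≫ X.sf n 0 := by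
    simp only [sf, Preadditive.zsmul_comp, Preadditive.comp_zsmul, X.face_face n 0 0 le_rfl]
    simp
  have h1 : X.b' (n + 1) ≫ X.sf n 0 + X.sf (n + 1) 0 ≫ X.b' n = X.sf (n + 1) 0 ≫ X.sf n 0 := by
    rw [b'_eq, b'_eq, Preadditive.sum_comp, Preadditive.comp_sum, Fin.sum_univ_succ,
      add_assoc (X.sf (n + 1) 0 ≫ X.sf n 0), ← Finset.sum_add_distrib]
    convert add_zero _
    refine Finset.sum_eq_zero fun i _ => ?_
    simp only [sf, Preadditive.zsmul_comp, Preadditive.comp_zsmul,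
      X.face_face n 0 i (Fin.zero_le i), smul_smul, ← add_smul, Fin.val_succ, Fin.castSucc_zero,
      Fin.val_zero]
    rw [pow_succ]
    simp
  have h2 : X.b' (n + 1) ≫ X.t (n + 1) = X.t (n + 2) ≫ X.b' (n + 1) +
      X.t (n + 2) ≫ X.t (n + 2) ≫ X.sf (n + 1) 0 - X.t (n + 2) ≫ X.sf (n + 1) 0 := by
    have := X.t_b (n + 1)
    rw [b_eq, Preadditive.comp_add] at this
    rw [eq_sub_iff_add_eq, ← add_left_inj (X.b' (n + 1)), this]
    abel
  have h3 : X.sf (n + 1) 0 ≫ X.t (n + 1) = X.t (n + 2) ≫ X.sf (n + 1) (0 : Fin (n + 1)).succ :=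
    (X.t_sf (n + 1) 0).symm
  rw [b_eq, b_eq, Preadditive.add_comp, Preadditive.comp_add, Preadditive.comp_add, b'_b',
    reassoc_of% h2, Category.assoc, Category.assoc, reassoc_of% h3, h0]
  simp only [Preadditive.add_comp, Preadditive.sub_comp, Category.assoc, eq_sub_iff_add_eq.mpr h1,
    Preadditive.comp_sub, Preadditive.comp_neg]
  abel

lemma t_zero : X.t 0 = 𝟙 _ := by
  have := X.iter_t 0
  rwa [iter_succ, iter_zero, Category.id_comp] at this

variable {X} {Y : Precyclic C} (f : X ⟶ Y)

lemma t_app (n : ℕ) : X.t n ≫ app f n = app f n ≫ Y.t n := by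
  simp [t, Hom.rot_app f n]

lemma N_app (n : ℕ) : X.N n ≫ app f n = app f n ≫ Y.N n := by
  have h (k : ℕ) : iter (X.t n) k ≫ app f n = app f n ≫ iter (Y.t n) k := by
    induction k with
    | zero => simp
    | succ k ih => rw [iter_succ, Category.assoc, t_app, reassoc_of% ih, iter_succ]
  simp [N, Preadditive.sum_comp, Preadditive.comp_sum, h]

lemma b'_app (n : ℕ) : X.b' n ≫ app f n = app f (n + 1) ≫ Y.b' n := by
  simp [b', Preadditive.sum_comp, Preadditive.comp_sum, Hom.face_app f n]

lemma b_app (n : ℕ) : X.b n ≫ app f n = app f (n + 1) ≫ Y.b n := by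
  have h := Hom.rot_app f (n + 1)
  simp only [b, Preadditive.add_comp, b'_app, Preadditive.comp_add, Preadditive.zsmul_comp,
    Preadditive.comp_zsmul, Category.assoc, Hom.face_app f n, reassoc_of% h]

end Precyclic
end Precyclic

/-! ## Triangular matrices -/

section Tri

variable {C : Type u} [Category.{v} C] [Preadditive C] [HasBinaryBiproducts C]

/-- The triangular matrix `(x, y) ↦ (f x + g y, h y)`. -/
noncomputable def tri {P Q R S : C} (f : P ⟶ R) (g : Q ⟶ R) (h : Q ⟶ S) : P ⊞ Q ⟶ R ⊞ S :=
  biprod.desc (f ≫ biprod.inl) (g ≫ biprod.inl + h ≫ biprod.inr)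

variable {P Q R S T U : C} (f : P ⟶ R) (g : Q ⟶ R) (h : Q ⟶ S)

lemma tri_comp_tri (f' : R ⟶ T) (g' : S ⟶ T) (h' : S ⟶ U) :
    tri f g h ≫ tri f' g' h' = tri (f ≫ f') (g ≫ f' + h ≫ g') (h ≫ h') := by
  apply biprod.hom_ext' <;> simp [tri, add_assoc]

lemma tri_comp_desc (f' : R ⟶ T) (g' : S ⟶ T) :
    tri f g h ≫ biprod.desc f' g' = biprod.desc (f ≫ f') (g ≫ f' + h ≫ g') := by
  apply biprod.hom_ext' <;> simp [tri]

lemma tri_comp_fst : tri f g h ≫ biprod.fst = biprod.desc f g := by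
  apply biprod.hom_ext' <;> simp [tri]

lemma tri_comp_map (f' : R ⟶ T) (h' : S ⟶ U) :
    tri f g h ≫ biprod.map f' h' = tri (f ≫ f') (g ≫ f') (h ≫ h') := by
  apply biprod.hom_ext' <;> simp [tri]

lemma map_comp_tri (f' : T ⟶ P) (h' : U ⟶ Q) :
    biprod.map f' h' ≫ tri f g h = tri (f' ≫ f) (h' ≫ g) (h' ≫ h) := by
  apply biprod.hom_ext' <;> simp [tri]

lemma map_comp_desc (f' : T ⟶ P) (h' : U ⟶ Q) :
    biprod.map f' h' ≫ biprod.desc f g = biprod.desc (f' ≫ f) (h' ≫ g) := by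
  apply biprod.hom_ext' <;> simp

lemma desc_comp (f' : R ⟶ T) : biprod.desc f g ≫ f' = biprod.desc (f ≫ f') (g ≫ f') := by
  apply biprod.hom_ext' <;> simp

lemma tri_zero : tri (0 : P ⟶ R) (0 : Q ⟶ R) (0 : Q ⟶ S) = 0 := by
  apply biprod.hom_ext' <;> simp [tri]

lemma desc_zero : biprod.desc (0 : P ⟶ R) (0 : Q ⟶ R) = 0 := by
  apply biprod.hom_ext' <;> simp

lemma tri_comp_tri_eq_zero {f : P ⟶ R} {g : Q ⟶ R} {h : Q ⟶ S}
    {f' : R ⟶ T} {g' : S ⟶ T} {h' : S ⟶ U}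
    (h₁ : f ≫ f' = 0) (h₂ : g ≫ f' + h ≫ g' = 0) (h₃ : h ≫ h' = 0) :
    tri f g h ≫ tri f' g' h' = 0 := by
  rw [tri_comp_tri, h₁, h₂, h₃, tri_zero]

lemma tri_comp_desc_eq_zero {f : P ⟶ R} {g : Q ⟶ R} {h : Q ⟶ S} {f' : R ⟶ T} {g' : S ⟶ T}
    (h₁ : f ≫ f' = 0) (h₂ : g ≫ f' + h ≫ g' = 0) : tri f g h ≫ biprod.desc f' g' = 0 := by
  rw [tri_comp_desc, h₁, h₂, desc_zero]

lemma desc_comp_eq_zero {f : P ⟶ R} {g : Q ⟶ R} {f' : R ⟶ T}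
    (h₁ : f ≫ f' = 0) (h₂ : g ≫ f' = 0) : biprod.desc f g ≫ f' = 0 := by
  rw [desc_comp, h₁, h₂, desc_zero]

lemma fst_add_desc_eq_zero {f : P ⟶ R} {g : Q ⟶ R} {k : R ⟶ T} {x : P ⟶ S} {y : S ⟶ T}
    (h₁ : x ≫ y + f ≫ k = 0) (h₂ : g ≫ k = 0) :
    (biprod.fst ≫ x) ≫ y + biprod.desc f g ≫ k = 0 := by
  apply biprod.hom_ext' <;> simp [h₁, h₂]

lemma fst_add_tri_eq_zero {f : P ⟶ R} {g : Q ⟶ R} {h : Q ⟶ U} {k : R ⟶ T} {x : P ⟶ S}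
    {y : S ⟶ T} (h₁ : x ≫ y + f ≫ k = 0) (h₂ : g ≫ k = 0) :
    (biprod.fst ≫ x) ≫ y + tri f g h ≫ biprod.fst ≫ k = 0 := by
  apply biprod.hom_ext' <;> simp [tri, h₁, h₂]

lemma inr_tri_add_desc_eq_zero {f : P ⟶ R} {g : Q ⟶ R} {k : R ⟶ T} {y : P ⟶ P}
    {p : S ⟶ U} {q : P ⟶ U} {r : P ⟶ T}
    (h₂ : y ≫ q = 0) (h₃ : y ≫ r + f ≫ k = 0) (h₄ : g ≫ k = 0) :
    (biprod.fst ≫ y ≫ biprod.inr) ≫ tri p q r + biprod.desc f g ≫ k ≫ biprod.inr = 0 := by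
  apply biprod.hom_ext'
  · simp only [tri, Preadditive.comp_add, biprod.inl_desc_assoc, Category.assoc, biprod.inr_desc,
      biprod.inl_fst_assoc, reassoc_of% h₂, zero_comp, zero_add, comp_zero]
    rw [← Category.assoc, ← Category.assoc, ← Preadditive.add_comp, h₃, zero_comp]
  · simp [reassoc_of% h₄]

lemma inr_tri_add_tri_eq_zero {A B D P Q R S T : C} {f : P ⟶ R} {g : Q ⟶ R} {h : Q ⟶ S} {k : R ⟶ T}
    {y : P ⟶ A} {p : B ⟶ D} {q : A ⟶ D} {r : A ⟶ T}
    (h₂ : y ≫ q = 0) (h₃ : y ≫ r + f ≫ k = 0) (h₄ : g ≫ k = 0) :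
    (biprod.fst ≫ y ≫ biprod.inr) ≫ tri p q r + tri f g h ≫ biprod.fst ≫ k ≫ biprod.inr = 0 := by
  apply biprod.hom_ext'
  · simp only [tri, Preadditive.comp_add, biprod.inl_desc_assoc, Category.assoc, biprod.inr_desc,
      biprod.inl_fst_assoc, reassoc_of% h₂, zero_comp, zero_add, comp_zero]
    rw [← Category.assoc, ← Category.assoc, ← Preadditive.add_comp, h₃, zero_comp]
  · simp [tri, reassoc_of% h₄]

lemma map_id_id : biprod.map (𝟙 P) (𝟙 Q) = 𝟙 (P ⊞ Q) := by
  apply biprod.hom_ext' <;> simp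

lemma map_comp_map (f : P ⟶ Q) (f' : Q ⟶ R) (g : S ⟶ T) (g' : T ⟶ U) :
    biprod.map (f ≫ f') (g ≫ g') = biprod.map f g ≫ biprod.map f' g' := by
  apply biprod.hom_ext' <;> simp

end Tri

/-! ## Mixed complexes -/

section Mixed

variable (C : Type u) [Category.{v} C] [Preadditive C]

/-- Mixed complexes `(M, b, B)`, concentrated in degrees `≥ 0`. -/
structure MixedComplex where
  X : ℕ → C
  b (n : ℕ) : X (n + 1) ⟶ X n
  B (n : ℕ) : X n ⟶ X (n + 1)
  b_b (n : ℕ) : b (n + 1) ≫ b n = 0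
  B_B (n : ℕ) : B n ≫ B (n + 1) = 0
  B_b_zero : B 0 ≫ b 0 = 0
  B_b_add_b_B (n : ℕ) : B (n + 1) ≫ b (n + 1) + b n ≫ B n = 0

variable {C}

namespace MixedComplex

/-- Morphisms of mixed complexes. -/
@[ext]
structure Hom (M N : MixedComplex C) where
  app (n : ℕ) : M.X n ⟶ N.X n
  b_app (n : ℕ) : M.b n ≫ app n = app (n + 1) ≫ N.b n
  B_app (n : ℕ) : M.B n ≫ app (n + 1) = app n ≫ N.B n

instance : Category (MixedComplex C) where
  Hom := Hom
  id M := { app := fun _ => 𝟙 _, b_app := by simp, B_app := by simp }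
  comp f g :=
    { app := fun n => f.app n ≫ g.app n
      b_app := fun n => by
        rw [← Category.assoc, Hom.b_app, Category.assoc, Hom.b_app, Category.assoc]
      B_app := fun n => by
        rw [← Category.assoc, Hom.B_app, Category.assoc, Hom.B_app, Category.assoc] }

/-- The components of a morphism. -/
abbrev app {M N : MixedComplex C} (f : M ⟶ N) (n : ℕ) : M.X n ⟶ N.X n := Hom.app f n

@[ext]
lemma hom_ext {M N : MixedComplex C} {f g : M ⟶ N} (h : ∀ n, app f n = app g n) : f = g :=
  Hom.ext (funext h)

@[simp] lemma id_app (M : MixedComplex C) (n : ℕ) : app (𝟙 M) n = 𝟙 _ := rfl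
@[simp] lemma comp_app {M N P : MixedComplex C} (f : M ⟶ N) (g : N ⟶ P) (n : ℕ) :
    app (f ≫ g) n = app f n ≫ app g n := rfl

/-- The forgetful functor `(M, b, B) ↦ (M, b)`. -/
def forget : MixedComplex C ⥤ ChainComplex C ℕ where
  obj M := ChainComplex.of M.X M.b M.b_b
  map {M N} f := ChainComplex.ofHom (app f) fun n => by
      simpa only [ChainComplex.of_d] using! (Hom.b_app f n).symm
  map_id M := by ext n; rfl
  map_comp f g := by ext n; rfl

variable [HasBinaryBiproducts C]

noncomputable section

/-- The object `⨁_{p ≥ 0} M_{n - 2p}` of degree `n` of the bar construction. -/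
def barX (M : MixedComplex C) : ℕ → C
  | 0 => M.X 0
  | 1 => M.X 1
  | n + 2 => M.X (n + 2) ⊞ barX M n

/-- The projection of `⨁_{p ≥ 0} M_{n - 2p}` to the summand `M_n`, `p = 0`. -/
def barTop (M : MixedComplex C) : ∀ n, M.barX n ⟶ M.X n
  | 0 => 𝟙 _
  | 1 => 𝟙 _
  | _ + 2 => biprod.fst

/-- The differential `b + B` of the bar construction: `B` maps the summand `M_{n - 2p}` with index
`p ≥ 1` to the summand with index `p - 1`. -/
def barD (M : MixedComplex C) : ∀ n, M.barX (n + 1) ⟶ M.barX n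
  | 0 => M.b 0
  | 1 => biprod.desc (M.b 1) (M.B 0)
  | n + 2 => tri (M.b (n + 2)) (M.barTop (n + 1) ≫ M.B (n + 1)) (barD M n)

lemma barTop_B_b (M : MixedComplex C) : ∀ n, (M.barTop (n + 1) ≫ M.B (n + 1)) ≫ M.b (n + 1) +
    M.barD n ≫ M.barTop n ≫ M.B n = 0
  | 0 => by
      have h (P Q R : C) (x : P ⟶ Q) (y : Q ⟶ P) (z : P ⟶ R) (w : R ⟶ P)
          (h : x ≫ y + z ≫ w = 0) : (𝟙 P ≫ x) ≫ y + z ≫ 𝟙 R ≫ w = 0 := by simpa using h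
      exact h _ _ _ _ _ _ _ (M.B_b_add_b_B 0)
  | 1 => fst_add_desc_eq_zero (by
      refine (congrArg (_ + M.b 1 ≫ ·) (Category.id_comp (M.B 1))).trans (M.B_b_add_b_B 1))
      ((congrArg (M.B 0 ≫ ·) (Category.id_comp (M.B 1))).trans (M.B_B 0))
  | n + 2 => fst_add_tri_eq_zero (M.B_b_add_b_B (n + 2)) (by rw [Category.assoc, M.B_B, comp_zero])

lemma barD_barD (M : MixedComplex C) : ∀ n, M.barD (n + 1) ≫ M.barD n = 0
  | 0 => desc_comp_eq_zero (M.b_b 0) M.B_b_zero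
  | 1 => tri_comp_desc_eq_zero (M.b_b 1) (by
      refine Eq.trans ?_ (M.barTop_B_b 0)
      exact congrArg (_ + M.b 0 ≫ ·) (Category.id_comp (M.B 0)).symm)
  | n + 2 => tri_comp_tri_eq_zero (M.b_b (n + 2)) (M.barTop_B_b (n + 1)) (barD_barD M n)

/-- The functoriality of the bar construction. -/
def barMap {M N : MixedComplex C} (f : M ⟶ N) : ∀ n, M.barX n ⟶ N.barX n
  | 0 => app f 0
  | 1 => app f 1
  | n + 2 => biprod.map (app f (n + 2)) (barMap f n)

lemma barTop_app {M N : MixedComplex C} (f : M ⟶ N) (n : ℕ) :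
    M.barTop n ≫ app f n = barMap f n ≫ N.barTop n :=
  match n with
  | 0 => (Category.id_comp (app f 0)).trans (Category.comp_id (app f 0)).symm
  | 1 => (Category.id_comp (app f 1)).trans (Category.comp_id (app f 1)).symm
  | n + 2 => (biprod.map_fst (app f (n + 2)) (barMap f n)).symm

lemma barD_barMap {M N : MixedComplex C} (f : M ⟶ N) :
    ∀ n, M.barD n ≫ barMap f n = barMap f (n + 1) ≫ N.barD n
  | 0 => Hom.b_app f 0
  | 1 => (desc_comp _ _ _).trans <| by
      refine Eq.trans ?_ (map_comp_desc _ _ _ _).symm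
      exact congrArg₂ biprod.desc (Hom.b_app f 1) (Hom.B_app f 0)
  | n + 2 => (tri_comp_map _ _ _ _ _).trans <| by
      refine Eq.trans ?_ (map_comp_tri _ _ _ _ _).symm
      have h1 : (M.barTop (n + 1) ≫ M.B (n + 1)) ≫ app f (n + 2) =
          barMap f (n + 1) ≫ N.barTop (n + 1) ≫ N.B (n + 1) := by
        rw [Category.assoc, Hom.B_app f (n + 1), ← Category.assoc, ← Category.assoc, barTop_app]
      rw [h1, barD_barMap f n, Hom.b_app f (n + 2)]

/-- The chain complex underlying the bar construction `𝔅M`, `(𝔅M)_n = ⨁_{p ≥ 0} M_{n - 2p}`, with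
differential `b + B`. -/
def bar : MixedComplex C ⥤ ChainComplex C ℕ where
  obj M := ChainComplex.of M.barX M.barD M.barD_barD
  map {M N} f := ChainComplex.ofHom (barMap f) fun n => by
      simpa only [ChainComplex.of_d] using! (barD_barMap f n).symm
  map_id M := by
    ext n
    change barMap (𝟙 M) n = 𝟙 (M.barX n)
    induction n using Nat.twoStepInduction with
    | zero => rfl
    | one => rfl
    | more n ih _ => exact (congrArg (biprod.map _) ih).trans map_id_id
  map_comp f g := by
    ext n
    change barMap (f ≫ g) n = barMap f n ≫ barMap g n
    induction n using Nat.twoStepInduction with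
    | zero => rfl
    | one => rfl
    | more n ih _ => exact (congrArg (biprod.map _) ih).trans (map_comp_map _ _ _ _)

end

end MixedComplex
end Mixed

namespace Precyclic

noncomputable section

variable {C : Type u} [Category.{v} C] [Preadditive C]

/-- The complex `C` with boundary `b`. -/
def hochschild : Precyclic C ⥤ ChainComplex C ℕ where
  obj X := ChainComplex.of X.obj X.b X.b_b
  map {X Y} f := ChainComplex.ofHom (app f) fun n => by
      simpa only [ChainComplex.of_d] using! (b_app f n).symm
  map_id X := by ext n; rfl
  map_comp f g := by ext n; rfl

/-- The bar complex `C^{bar}`, with boundary `b'`. -/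
def bar : Precyclic C ⥤ ChainComplex C ℕ where
  obj X := ChainComplex.of X.obj X.b' X.b'_b'
  map {X Y} f := ChainComplex.ofHom (app f) fun n => by
      simpa only [ChainComplex.of_d] using! (b'_app f n).symm
  map_id X := by ext n; rfl
  map_comp f g := by ext n; rfl

variable [HasBinaryBiproducts C] 

/-- `Ω⁰ = C₀` and `Ωⁿ = Cₙ ⊕ Cₙ₋₁`; for an algebra `A` this is `A^{⊗ n + 1} ⊕ A^{⊗ n}`, the second
summand being `k ⊗ A^{⊗ n}` inside `(A ⊕ k) ⊗ A^{⊗ n}`. -/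
def omegaX (X : Precyclic C) : ℕ → C
  | 0 => X.obj 0
  | n + 1 => X.obj (n + 1) ⊞ X.obj n

/-- The boundary `b (x, 1 ⊗ y) = (b x + (1 - t) y, - 1 ⊗ b' y)` of `Ω`, which is the usual
Hochschild boundary of `(A ⊕ k) ⊗ A^{⊗ n}`. -/
def omegab (X : Precyclic C) : ∀ n, X.omegaX (n + 1) ⟶ X.omegaX n
  | 0 => biprod.desc (X.b 0) (𝟙 _ - X.t 0)
  | n + 1 => tri (X.b (n + 1)) (𝟙 _ - X.t (n + 1)) (-X.b' n)

/-- The Connes operator `B (x, 1 ⊗ y) = (0, 1 ⊗ N x)`. -/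
def omegaB (X : Precyclic C) : ∀ n, X.omegaX n ⟶ X.omegaX (n + 1)
  | 0 => X.N 0 ≫ biprod.inr
  | n + 1 => biprod.fst ≫ X.N (n + 1) ≫ biprod.inr

/-- The functoriality of `Ω`. -/
def omegaMap {X Y : Precyclic C} (f : X ⟶ Y) : ∀ n, X.omegaX n ⟶ Y.omegaX n
  | 0 => app f 0
  | n + 1 => biprod.map (app f (n + 1)) (app f n)

lemma omegab_omegab (X : Precyclic C) (n : ℕ) : X.omegab (n + 1) ≫ X.omegab n = 0 := by
  have h (n : ℕ) : (𝟙 _ - X.t (n + 1)) ≫ X.b n + (-X.b' n) ≫ (𝟙 _ - X.t n) = 0 := by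
    have := X.t_b n
    simp only [Preadditive.sub_comp, Preadditive.comp_sub, Preadditive.neg_comp, Category.id_comp,
      Category.comp_id]
    rw [eq_sub_of_add_eq this]
    abel
  cases n with
  | zero => exact tri_comp_desc_eq_zero (X.b_b 0) (h 0)
  | succ n =>
    refine tri_comp_tri_eq_zero (X.b_b (n + 1)) (h (n + 1)) ?_
    rw [Preadditive.neg_comp, Preadditive.comp_neg, X.b'_b', neg_zero, neg_zero]

lemma omegaB_omegaB (X : Precyclic C) (n : ℕ) : X.omegaB n ≫ X.omegaB (n + 1) = 0 := by
  cases n with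
  | zero =>
    change (X.N 0 ≫ biprod.inr) ≫ biprod.fst ≫ X.N 1 ≫ biprod.inr = 0
    simp
  | succ n =>
    change (biprod.fst ≫ X.N (n + 1) ≫ biprod.inr) ≫ biprod.fst ≫ X.N (n + 2) ≫ biprod.inr = 0
    simp

lemma omegaB_omegab_zero (X : Precyclic C) : X.omegaB 0 ≫ X.omegab 0 = 0 := by
  change (X.N 0 ≫ biprod.inr) ≫ biprod.desc (X.b 0) (𝟙 _ - X.t 0) = 0
  simp [N_t]

lemma omegaB_omegab (X : Precyclic C) (n : ℕ) :
    X.omegaB (n + 1) ≫ X.omegab (n + 1) + X.omegab n ≫ X.omegaB n = 0 := by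
  have h (n : ℕ) : X.N n ≫ (𝟙 _ - X.t n) = 0 := by
    rw [Preadditive.comp_sub, N_t, Category.comp_id, sub_self]
  have h' (n : ℕ) : (𝟙 _ - X.t n) ≫ X.N n = 0 := by
    rw [Preadditive.sub_comp, t_N, Category.id_comp, sub_self]
  have h'' (n : ℕ) : X.N (n + 1) ≫ (-X.b' n) + X.b n ≫ X.N n = 0 := by
    rw [Preadditive.comp_neg, N_b', neg_add_cancel]
  cases n with
  | zero => exact inr_tri_add_desc_eq_zero (h 1) (h'' 0) (h' 0)
  | succ n => exact inr_tri_add_tri_eq_zero (h (n + 2)) (h'' (n + 1)) (h' (n + 1))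

/-- The mixed complex `(Ω, b, B)`. -/
def omega : Precyclic C ⥤ MixedComplex C where
  obj X :=
    { X := X.omegaX
      b := X.omegab
      B := X.omegaB
      b_b := X.omegab_omegab
      B_B := X.omegaB_omegaB
      B_b_zero := X.omegaB_omegab_zero
      B_b_add_b_B := X.omegaB_omegab }
  map {X Y} f :=
    { app := omegaMap f
      b_app := fun n => by
        cases n with
        | zero =>
          refine (desc_comp _ _ _).trans (Eq.trans ?_ (map_comp_desc _ _ _ _).symm)
          refine congrArg₂ biprod.desc (b_app f 0) ?_
          change (𝟙 _ - X.t 0) ≫ app f 0 = app f 0 ≫ (𝟙 _ - Y.t 0)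
          simp [t_app, Preadditive.comp_sub]
        | succ n =>
          refine (tri_comp_map _ _ _ _ _).trans (Eq.trans ?_ (map_comp_tri _ _ _ _ _).symm)
          rw [b_app f (n + 1)]
          simp [t_app, b'_app]
      B_app := fun n => by
        cases n with
        | zero =>
          change (X.N 0 ≫ biprod.inr) ≫ biprod.map (app f 1) (app f 0) =
            app f 0 ≫ Y.N 0 ≫ biprod.inr
          simp [reassoc_of% N_app f]
        | succ n =>
          change (biprod.fst ≫ X.N (n + 1) ≫ biprod.inr) ≫ biprod.map (app f (n + 2)) (app f (n + 1))
            = biprod.map (app f (n + 1)) (app f n) ≫ biprod.fst ≫ Y.N (n + 1) ≫ biprod.inr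
          simp [reassoc_of% N_app f] }
  map_id X := by
    ext n
    cases n with
    | zero => rfl
    | succ n => exact map_id_id
  map_comp f g := by
    ext n
    cases n with
    | zero => rfl
    | succ n => exact map_comp_map _ _ _ _

end
end Precyclic


/-! ## Tensor words -/

noncomputable section

variable {C : Type u} [Category.{v} C] [MonoidalCategory C]

/-- The tensor product `X 0 ⊗ (X 1 ⊗ (⋯ ⊗ (X (n - 1) ⊗ 𝟙_ C)))` of a finite family. -/
def tens : ∀ {n : ℕ}, (Fin n → C) → C
  | 0, _ => 𝟙_ C
  | _ + 1, X => X 0 ⊗ tens fun i => X i.succ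

/-- The functoriality of `tens`. -/
def tensMap : ∀ {n : ℕ} {X Y : Fin n → C}, (∀ i, X i ⟶ Y i) → (tens X ⟶ tens Y)
  | 0, _, _, _ => 𝟙 _
  | _ + 1, _, _, f => f 0 ⊗ₘ tensMap fun i => f i.succ

lemma tensMap_id : ∀ {n : ℕ} (X : Fin n → C), tensMap (fun i => 𝟙 (X i)) = 𝟙 (tens X)
  | 0, _ => rfl
  | n + 1, X => by
      change 𝟙 (X 0) ⊗ₘ tensMap (fun i : Fin n => 𝟙 (X i.succ)) = 𝟙 (X 0 ⊗ tens _)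
      rw [tensMap_id, id_tensorHom_id]

lemma tensMap_comp : ∀ {n : ℕ} {X Y Z : Fin n → C} (f : ∀ i, X i ⟶ Y i) (g : ∀ i, Y i ⟶ Z i),
    tensMap (fun i => f i ≫ g i) = tensMap f ≫ tensMap g
  | 0, _, _, _, _, _ => (Category.id_comp _).symm
  | n + 1, X, Y, Z, f, g => by
      change (f 0 ≫ g 0) ⊗ₘ tensMap (fun i : Fin n => f i.succ ≫ g i.succ) =
        (f 0 ⊗ₘ tensMap fun i : Fin n => f i.succ) ≫ (g 0 ⊗ₘ tensMap fun i : Fin n => g i.succ)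
      rw [tensMap_comp, tensorHom_comp_tensorHom]

section Rot

variable [SymmetricCategory C]

/-- Interchanging the first two factors. -/
def swap (X Y Z : C) : X ⊗ (Y ⊗ Z) ⟶ Y ⊗ (X ⊗ Z) :=
  (α_ X Y Z).inv ≫ (β_ X Y).hom ▷ Z ≫ (α_ Y X Z).hom

lemma swap_naturality {X Y Z X' Y' Z' : C} (f : X ⟶ X') (g : Y ⟶ Y') (h : Z ⟶ Z') :
    (f ⊗ₘ (g ⊗ₘ h)) ≫ swap X' Y' Z' = swap X Y Z ≫ (g ⊗ₘ (f ⊗ₘ h)) := by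
  simp only [swap, Category.assoc]
  rw [← associator_naturality, associator_inv_naturality_assoc]
  congr 1
  simp only [← Category.assoc]
  congr 1
  rw [← tensorHom_id, ← tensorHom_id, tensorHom_comp_tensorHom, tensorHom_comp_tensorHom,
    BraidedCategory.braiding_naturality]
  simp

lemma swap_swap (X Y Z : C) : swap X Y Z ≫ swap Y X Z = 𝟙 _ := by
  simp [swap, ← comp_whiskerRight_assoc]

lemma swap_yang_baxter (X Y Z W : C) :
    swap X Y (Z ⊗ W) ≫ (Y ◁ swap X Z W) ≫ swap Y Z (X ⊗ W) =
      (X ◁ swap Y Z W) ≫ swap X Z (Y ⊗ W) ≫ (Z ◁ swap X Y W) := by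
  have h := BraidedCategory.yang_baxter X Y Z
  calc
    _ = 𝟙 _ ⊗≫ ((α_ X Y Z).inv ≫ (β_ X Y).hom ▷ Z ≫ (α_ Y X Z).hom ≫ Y ◁ (β_ X Z).hom ≫
          (α_ Y Z X).inv ≫ (β_ Y Z).hom ▷ X ≫ (α_ Z Y X).hom) ▷ W ⊗≫ 𝟙 _ := by
      simp only [swap]
      monoidal
    _ = 𝟙 _ ⊗≫ (X ◁ (β_ Y Z).hom ≫ (α_ X Z Y).inv ≫ (β_ X Z).hom ▷ Y ≫
          (α_ Z X Y).hom ≫ Z ◁ (β_ X Y).hom) ▷ W ⊗≫ 𝟙 _ := by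
      rw [h]
    _ = _ := by
      simp only [swap]
      monoidal

lemma rot_step {X X' Y Y' Z Z' P P' : C} (f : X ⟶ X') {g : Y ⟶ Y'} {h : Z ⟶ Z'} {p : P ⟶ P'}
    {r : P ⟶ Y ⊗ Z} {r' : P' ⟶ Y' ⊗ Z'} (e : p ≫ r' = r ≫ (g ⊗ₘ h)) :
    (f ⊗ₘ p) ≫ (X' ◁ r') ≫ swap X' Y' Z' = ((X ◁ r) ≫ swap X Y Z) ≫ (g ⊗ₘ (f ⊗ₘ h)) := by
  rw [Category.assoc, ← swap_naturality, ← id_tensorHom, ← id_tensorHom, ← Category.assoc,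
    ← Category.assoc, tensorHom_comp_tensorHom, tensorHom_comp_tensorHom, e, Category.comp_id,
    Category.id_comp]

lemma swap_rot_zero {A P Q : C} (r : Q ⟶ A ⊗ P) :
    swap A A Q ≫ (A ◁ ((A ◁ r) ≫ swap A A P)) ≫ swap A A (A ⊗ P) =
      ((A ◁ ((A ◁ r) ≫ swap A A P)) ≫ swap A A (A ⊗ P)) ≫ A ◁ swap A A P := by
  have h := swap_naturality (𝟙 A) (𝟙 A) r
  simp only [id_tensorHom] at h
  simp only [whiskerLeft_comp, Category.assoc]
  rw [← reassoc_of% h, swap_yang_baxter]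

lemma swap_rot_succ {A T Q : C} {a : T ⟶ T} {r : T ⟶ A ⊗ Q} {a' : Q ⟶ Q}
    (ih : a ≫ r = r ≫ A ◁ a') :
    (A ◁ a) ≫ (A ◁ r) ≫ swap A A Q = ((A ◁ r) ≫ swap A A Q) ≫ A ◁ A ◁ a' := by
  have h := swap_naturality (𝟙 A) (𝟙 A) a'
  simp only [id_tensorHom] at h
  rw [← whiskerLeft_comp_assoc, ih, Category.assoc, ← h, whiskerLeft_comp_assoc]

lemma whiskerLeft_aux {A T Q R S : C} (a : T ⟶ Q) (p : Q ⟶ R) (s : A ⊗ R ⟶ S) :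
    (A ◁ a) ≫ (A ◁ p) ≫ s = (A ◁ (a ≫ p)) ≫ s := by simp

lemma swap_aux {A P Q : C} (r : Q ⟶ A ⊗ P) :
    A ◁ r = ((A ◁ r) ≫ swap A A P) ≫ swap A A P := by
  rw [Category.assoc, swap_swap, Category.comp_id]

lemma iter_aux {Z : C} {f c s₀ : Z ⟶ Z} {s p : ℕ → (Z ⟶ Z)} (m : ℕ) (h₁ : f = c ≫ s₀)
    (h₂ : ∀ k < m, s₀ ≫ iter c k = iter c k ≫ s k) (h₃ : p 0 = 𝟙 Z)
    (h₄ : ∀ k, p (k + 1) = s k ≫ p k) : ∀ k ≤ m, iter f k = iter c k ≫ p k := by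
  intro k
  induction k with
  | zero => simp [h₃]
  | succ k ih =>
    intro hk
    rw [iter_succ', ih (by lia), h₁, Category.assoc, reassoc_of% h₂ k (by lia), iter_succ', h₄,
      Category.assoc]

/-- The index map `0 ↦ n`, `i + 1 ↦ i`. -/
def rotIdx (n : ℕ) : Fin (n + 1) → Fin (n + 1) := Fin.cases (Fin.last n) Fin.castSucc

/-- The cyclic permutation `x₀ ⊗ ⋯ ⊗ xₙ ↦ xₙ ⊗ x₀ ⊗ ⋯ ⊗ xₙ₋₁`, moving the last factor to the
front by successive symmetries. -/
def rot : ∀ {n : ℕ} (X : Fin (n + 1) → C), tens X ⟶ tens fun i => X (rotIdx n i)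
  | 0, X => 𝟙 (X 0 ⊗ 𝟙_ C)
  | n + 1, X =>
      (X 0 ◁ rot fun i => X i.succ) ≫ swap (X 0) (X (Fin.last (n + 1)))
        (tens fun i : Fin n => X i.castSucc.succ)

lemma rot_naturality : ∀ {n : ℕ} {X Y : Fin (n + 1) → C} (f : ∀ i, X i ⟶ Y i),
    tensMap f ≫ rot Y = rot X ≫ tensMap fun i => f (rotIdx n i)
  | 0, _, _, f => (Category.comp_id (tensMap f)).trans (Category.id_comp (tensMap f)).symm
  | n + 1, _, _, f => rot_step (f 0) (rot_naturality fun i : Fin (n + 1) => f i.succ)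

/-- The tensor power. -/
abbrev tpow (A : C) (n : ℕ) : C := tens fun _ : Fin n => A

/-- the rotation of a tensor power-/
def rotPow (A : C) (n : ℕ) : tpow A (n + 1) ⟶ tpow A (n + 1) := rot fun _ : Fin (n + 1) => A

lemma rotPow_succ (A : C) (n : ℕ) :
    rotPow A (n + 1) = A ◁ rotPow A n ≫ swap A A (tpow A n) := rfl

/-- The interchange of the `i`-th and `(i + 1)`-st factors. -/
def adj (A : C) : ∀ n : ℕ, ℕ → (tpow A (n + 1) ⟶ tpow A (n + 1))
  | 0, _ => 𝟙 _
  | n + 1, 0 => swap A A (tpow A n)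
  | n + 1, i + 1 => A ◁ adj A n i

lemma adj_rotPow (A : C) : ∀ n i : ℕ, i < n →
    adj A (n + 1) i ≫ rotPow A (n + 1) = rotPow A (n + 1) ≫ adj A (n + 1) (i + 1)
  | 0, i, h => absurd h (by simp)
  | n + 1, 0, _ => swap_rot_zero (rotPow A n)
  | n + 1, i + 1, h => swap_rot_succ (adj_rotPow A n i (by lia))

/-- The product of the first `k` adjacent transpositions, the last one being applied first. -/
def adjProd (A : C) (n : ℕ) : ℕ → (tpow A (n + 1) ⟶ tpow A (n + 1))
  | 0 => 𝟙 _
  | k + 1 => adj A n k ≫ adjProd A n k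

lemma adjProd_succ (A : C) (n k : ℕ) :
    adjProd A (n + 1) (k + 1) = (A ◁ adjProd A n k) ≫ adj A (n + 1) 0 := by
  induction k with
  | zero =>
    change adj A (n + 1) 0 ≫ 𝟙 _ = (A ◁ 𝟙 (tpow A (n + 1))) ≫ adj A (n + 1) 0
    rw [Category.comp_id, whiskerLeft_id]
    exact (Category.id_comp _).symm
  | succ k ih =>
    exact (congrArg (adj A (n + 1) (k + 1) ≫ ·) ih).trans (whiskerLeft_aux _ _ _)

lemma adjProd_self (A : C) (n : ℕ) : adjProd A n n = rotPow A n := by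
  induction n with
  | zero => rfl
  | succ n ih => rw [adjProd_succ, ih]; rfl

lemma iter_whiskerLeft (A : C) {X : C} (f : X ⟶ X) (k : ℕ) : iter (A ◁ f) k = A ◁ iter f k := by
  induction k with
  | zero => simp
  | succ k ih => rw [iter_succ, ih, iter_succ, whiskerLeft_comp]

lemma iter_rotPow (A : C) (n : ℕ) : iter (rotPow A n) (n + 1) = 𝟙 _ := by
  induction n with
  | zero => exact Category.id_comp _
  | succ n ih =>
    have h0 : iter (A ◁ rotPow A n) (n + 1) = 𝟙 (tpow A (n + 2)) := by
      rw [iter_whiskerLeft, ih, whiskerLeft_id]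
      rfl
    have h2 : ∀ k, k < n + 1 → adj A (n + 1) 0 ≫ iter (rotPow A (n + 1)) k =
        iter (rotPow A (n + 1)) k ≫ adj A (n + 1) k := by
      intro k
      induction k with
      | zero => simp
      | succ k ih =>
        intro hk
        rw [iter_succ, reassoc_of% ih (by lia), adj_rotPow A n k (by lia), Category.assoc]
    have h3 := iter_aux (n + 1) (swap_aux (rotPow A n)) h2 rfl
      (fun k => (rfl : adjProd A (n + 1) (k + 1) = _)) (n + 1) le_rfl
    exact (iter_succ _ _).trans <|
      ((congrArg (iter (rotPow A (n + 1)) (n + 1) ≫ ·) (adjProd_self A (n + 1))).symm.trans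
        h3.symm).trans h0

end Rot
end

/-! ## Non-unital algebras -/

noncomputable section

variable (C : Type u) [Category.{v} C] [MonoidalCategory C]

/-- Algebras: not necessarily unital associative monoids. -/
structure Alg where
  X : C
  mul : X ⊗ X ⟶ X
  assoc : (mul ▷ X) ≫ mul = (α_ X X X).hom ≫ (X ◁ mul) ≫ mul

variable {C}

/-- `m` applied to the first two factors. -/
def mulHead {X Y Z : C} (m : X ⊗ Y ⟶ Z) (P : C) : X ⊗ (Y ⊗ P) ⟶ Z ⊗ P :=
  (α_ X Y P).inv ≫ m ▷ P

lemma mulHead_naturality {X Y Z X' Y' Z' P P' : C} {m : X ⊗ Y ⟶ Z} {m' : X' ⊗ Y' ⟶ Z'}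
    {x : X ⟶ X'} {y : Y ⟶ Y'} {z : Z ⟶ Z'} (e : m ≫ z = (x ⊗ₘ y) ≫ m') (p : P ⟶ P') :
    mulHead m P ≫ (z ⊗ₘ p) = (x ⊗ₘ (y ⊗ₘ p)) ≫ mulHead m' P' := by
  rw [mulHead, mulHead, Category.assoc, associator_inv_naturality_assoc]
  congr 1
  rw [← tensorHom_id, ← tensorHom_id, tensorHom_comp_tensorHom, tensorHom_comp_tensorHom, e,
    Category.id_comp, Category.comp_id]

lemma tensor_whisker {X X' P P' Q Q' : C} (x : X ⟶ X') {p : P ⟶ P'} {u : P' ⟶ Q'} {w : P ⟶ Q}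
    {q : Q ⟶ Q'} (e : p ≫ u = w ≫ q) : (x ⊗ₘ p) ≫ X' ◁ u = (X ◁ w) ≫ (x ⊗ₘ q) := by
  rw [← id_tensorHom, ← id_tensorHom, tensorHom_comp_tensorHom, tensorHom_comp_tensorHom, e,
    Category.id_comp, Category.comp_id]

lemma mulHead_whisker {X Y Z P P' : C} (m : X ⊗ Y ⟶ Z) (p : P ⟶ P') :
    mulHead m P ≫ Z ◁ p = (X ◁ Y ◁ p) ≫ mulHead m P' := by
  have := mulHead_naturality (m := m) (m' := m) (x := 𝟙 _) (y := 𝟙 _) (z := 𝟙 _) (by simp) p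
  simpa only [id_tensorHom] using this

lemma mulHead_assoc (A : Alg C) (P : C) :
    (A.X ◁ mulHead A.mul P) ≫ mulHead A.mul P =
      mulHead A.mul (A.X ⊗ P) ≫ mulHead A.mul P := by
  have h := congrArg (· ▷ P) A.assoc
  simp only [comp_whiskerRight] at h
  have h2 : (A.mul ▷ A.X) ▷ P ≫ A.mul ▷ P = (α_ A.X A.X A.X).hom ▷ P ≫ (A.X ◁ A.mul) ▷ P ≫
    A.mul ▷ P := by simpa using h
  calc
    _ = 𝟙 _ ⊗≫ ((α_ A.X A.X A.X).hom ▷ P ≫ (A.X ◁ A.mul) ▷ P ≫ A.mul ▷ P) := by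
      simp only [mulHead]
      monoidal
    _ = 𝟙 _ ⊗≫ ((A.mul ▷ A.X) ▷ P ≫ A.mul ▷ P) := by rw [h2]
    _ = _ := by
      simp only [mulHead]
      monoidal

lemma swap_mulHead [SymmetricCategory C] {X Y Z : C} (m : X ⊗ Y ⟶ Z) (W P : C) :
    (X ◁ swap Y W P) ≫ swap X W (Y ⊗ P) ≫ W ◁ mulHead m P = mulHead m (W ⊗ P) ≫ swap Z W P := by
  have h := BraidedCategory.braiding_naturality_left m W
  rw [BraidedCategory.braiding_tensor_left_hom] at h
  calc
    _ = 𝟙 _ ⊗≫ (((α_ X Y W).hom ≫ X ◁ (β_ Y W).hom ≫ (α_ X W Y).inv ≫ (β_ X W).hom ▷ Y ≫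
          (α_ W X Y).hom) ≫ W ◁ m) ▷ P ⊗≫ 𝟙 _ := by
      simp only [mulHead, swap]
      monoidal
    _ = 𝟙 _ ⊗≫ (m ▷ W ≫ (β_ Z W).hom) ▷ P ⊗≫ 𝟙 _ := by rw [h]
    _ = _ := by
      simp only [mulHead, swap]
      monoidal

namespace Alg

/-- The map `μᵢ : A^{⊗ n + 2} ⟶ A^{⊗ n + 1}` multiplying the factors number `i` and `i + 1`. -/
def mulAt (A : Alg C) : ∀ (n : ℕ) (_ : Fin (n + 1)), tpow A.X (n + 2) ⟶ tpow A.X (n + 1)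
  | 0, _ => mulHead A.mul (tpow A.X 0)
  | n + 1, i => Fin.cases (mulHead A.mul (tpow A.X (n + 1))) (fun j => A.X ◁ mulAt A n j) i

lemma mulAt_zero (A : Alg C) (n : ℕ) : A.mulAt n 0 = mulHead A.mul (tpow A.X n) := by
  cases n <;> rfl

lemma mulAt_mulAt (A : Alg C) : ∀ (n : ℕ) (i j : Fin (n + 1)), i ≤ j →
    A.mulAt (n + 1) j.succ ≫ A.mulAt n i = A.mulAt (n + 1) i.castSucc ≫ A.mulAt n j := by
  have h0 (n : ℕ) : A.mulAt (n + 1) (0 : Fin (n + 1)).succ ≫ A.mulAt n 0 =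
      A.mulAt (n + 1) (0 : Fin (n + 1)).castSucc ≫ A.mulAt n 0 := by
    rw [mulAt_zero]
    refine Eq.trans ?_ (mulHead_assoc A (tpow A.X n))
    exact congrArg (fun z => (A.X ◁ z) ≫ mulHead A.mul (tpow A.X n)) (A.mulAt_zero n)
  intro n
  induction n with
  | zero =>
    intro i j _
    obtain rfl : i = 0 := Fin.fin_one_eq_zero i
    obtain rfl : j = 0 := Fin.fin_one_eq_zero j
    exact h0 0
  | succ n ih =>
    intro i j hij
    cases i using Fin.cases with
    | zero =>
      cases j using Fin.cases with
      | zero => exact h0 (n + 1)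
      | succ j => exact (mulHead_whisker A.mul (A.mulAt n j)).symm
    | succ i =>
      cases j using Fin.cases with
      | zero => simp at hij
      | succ j =>
        refine (whiskerLeft_comp _ _ _).symm.trans (Eq.trans ?_ (whiskerLeft_comp _ _ _))
        exact congrArg (A.X ◁ ·) (ih i j (by simpa using hij))

lemma mulAt_hom (A B : Alg C) (φ : A.X ⟶ B.X) (hφ : (φ ⊗ₘ φ) ≫ B.mul = A.mul ≫ φ) :
    ∀ (n : ℕ) (i : Fin (n + 1)), tensMap (fun _ : Fin (n + 2) => φ) ≫ B.mulAt n i =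
      A.mulAt n i ≫ tensMap fun _ : Fin (n + 1) => φ
  | 0, _ => (mulHead_naturality hφ.symm _).symm
  | n + 1, i => by
      cases i using Fin.cases with
      | zero => exact (mulHead_naturality hφ.symm (tensMap fun _ : Fin (n + 1) => φ)).symm
      | succ i => exact tensor_whisker φ (mulAt_hom A B φ hφ n i)

variable [SymmetricCategory C]

lemma rot_mul_zero (A : Alg C) {P Q : C} (r : Q ⟶ A.X ⊗ P) :
    ((A.X ◁ ((A.X ◁ r) ≫ swap A.X A.X P)) ≫ swap A.X A.X (A.X ⊗ P)) ≫ A.X ◁ mulHead A.mul P =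
      mulHead A.mul Q ≫ (A.X ◁ r) ≫ swap A.X A.X P := by
  rw [whiskerLeft_comp, Category.assoc, Category.assoc, swap_mulHead, ← Category.assoc,
    ← Category.assoc, mulHead_whisker]

lemma rot_mul_succ {A Q R S T : C} {r : T ⟶ A ⊗ Q} {m : Q ⟶ R} {m' : T ⟶ S} {r' : S ⟶ A ⊗ R}
    (ih : r ≫ A ◁ m = m' ≫ r') :
    ((A ◁ r) ≫ swap A A Q) ≫ A ◁ A ◁ m = (A ◁ m') ≫ (A ◁ r') ≫ swap A A R := by
  have h := swap_naturality (𝟙 A) (𝟙 A) m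
  simp only [id_tensorHom] at h
  rw [Category.assoc, ← h, ← whiskerLeft_comp_assoc, ih, whiskerLeft_comp_assoc]

lemma rotPow_mulAt (A : Alg C) : ∀ (n : ℕ) (i : Fin n),
    rotPow A.X (n + 1) ≫ A.mulAt n i.succ = A.mulAt n i.castSucc ≫ rotPow A.X n
  | 0, i => i.elim0
  | n + 1, i => by
    cases i using Fin.cases with
    | zero =>
      refine Eq.trans ?_ (A.rot_mul_zero (rotPow A.X n))
      exact congrArg (fun z => rotPow A.X (n + 2) ≫ A.X ◁ z) (A.mulAt_zero n)
    | succ i =>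
      cases n with
      | zero => exact i.elim0
      | succ n => exact rot_mul_succ (rotPow_mulAt A (n + 1) i)

/-- The precyclic object `n ↦ A^{⊗ n + 1}` of an algebra. -/
def cyc (A : Alg C) : Precyclic C where
  obj n := tpow A.X (n + 1)
  face n i := A.mulAt n i
  rot n := rotPow A.X n
  face_face n i j h := A.mulAt_mulAt n i j h
  rot_face n i := A.rotPow_mulAt n i
  iter_rot n := iter_rotPow A.X n

end Alg

end


/-! ## Cofibrations, weak equivalences, tensor products -/

section Cofibrations

variable {C : Type u} [Category.{v} C]

/-- A map `i` is a cofibration with respect to the class `J` of basic objects if `hom(i, I)` is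
surjective for all basic `I`. -/
def IsCofibration (J : ObjectProperty C) {X Y : C} (i : X ⟶ Y) : Prop :=
  ∀ I, J I → Function.Surjective fun f : Y ⟶ I => i ≫ f

/-- An object `F` is relatively injective if `hom(-, F)` maps cofibrations to surjections. -/
def IsRelInjective (J : ObjectProperty C) (F : C) : Prop :=
  ∀ ⦃X Y : C⦄ (i : X ⟶ Y), IsCofibration J i → Function.Surjective fun f : Y ⟶ F => i ≫ f

open scoped ZeroObject

variable [Preadditive C]

/-- The (contravariant) functor sending a complex `A` to the complex `hom(A, I)` of abelian groups,
for an object `I` placed in degree `0`. -/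
noncomputable def homInto {ι : Type*} (c : ComplexShape ι) (I : C) :
    (HomologicalComplex C c)ᵒᵖ ⥤ HomologicalComplex AddCommGrpCat.{v} c.symm :=
  HomologicalComplex.opFunctor C c ⋙ (preadditiveYoneda.obj I).mapHomologicalComplex c.symm

/-- A chain map `f` is a weak equivalence if `hom(f, I)` is a quasi-isomorphism for every
relatively injective object `I`. -/
def IsWeakEquiv (J : ObjectProperty C) {ι : Type*} {c : ComplexShape ι}
    {A B : HomologicalComplex C c} (f : A ⟶ B) : Prop :=
  ∀ I, IsRelInjective J I → QuasiIso ((homInto c I).map f.op)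

/-- A complex `Q` is weakly contractible if `0 ⟶ Q` is a weak equivalence. -/
def IsWeaklyContractible [HasZeroObject C] (J : ObjectProperty C) {ι : Type*} {c : ComplexShape ι}
    (Q : HomologicalComplex C c) : Prop :=
  IsWeakEquiv J (0 : (0 : HomologicalComplex C c) ⟶ Q)

variable [MonoidalCategory C]

/-- For an additive functor `F`: `F` is an exact functor of Waldhausen categories (weak equivalences
being the isomorphisms), i.e. it preserves cofibrations and pushouts along cofibrations, and it
preserves all cokernels. -/
structure IsExactFunctor (J : ObjectProperty C) (F : C ⥤ C) : Prop where
  cof {X Y : C} (i : X ⟶ Y) : IsCofibration J i → IsCofibration J (F.map i)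
  pushout {X Y Z : C} (i : X ⟶ Y) (g : X ⟶ Z) : IsCofibration J i → PreservesColimit (span i g) F
  coker {X Y : C} (f : X ⟶ Y) : PreservesColimit (parallelPair f 0) F

/-- The condition that `A ⊗ -` and `- ⊗ A` are exact functors of Waldhausen categories preserving
cokernels. The additivity of these functors is the class `MonoidalPreadditive`. -/
structure IsTensorProduct (J : ObjectProperty C) : Prop where
  left (A : C) : IsExactFunctor J (tensorLeft A)
  right (A : C) : IsExactFunctor J (tensorRight A)

end Cofibrations

/-! ## Cof-ideals and relative objects -/

noncomputable section

variable {C : Type u} [Category.{v} C] [MonoidalCategory C]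

/-- The structure of a cof-ideal of `A` on the algebra `K`: a map of algebras `K ⟶ A` which is a
monomorphism and a cofibration, such that the multiplications `A ⊗ K ⟶ A` and `K ⊗ A ⟶ A` factor
through `K`. The factorizations `left` and `right` are unique. -/
structure CofIdeal (J : ObjectProperty C) (K A : Alg C) where
  incl : K.X ⟶ A.X
  mono : Mono incl
  cof : IsCofibration J incl
  mul_incl : K.mul ≫ incl = (incl ⊗ₘ incl) ≫ A.mul
  left : A.X ⊗ K.X ⟶ K.X
  left_incl : left ≫ incl = (A.X ◁ incl) ≫ A.mul
  right : K.X ⊗ A.X ⟶ K.X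
  right_incl : right ≫ incl = (incl ▷ A.X) ≫ A.mul

namespace CofIdeal

variable {J : ObjectProperty C} {K A : Alg C} (I : CofIdeal J K A)

/-- `Y₀ = K`, `Y₁ = A`. -/
def Y (_ : CofIdeal J K A) : Bool → C
  | false => K.X
  | true => A.X

/-- The maps `Y a ⟶ Y b` for `a ≤ b`. -/
def Ymap : ∀ {a b : Bool}, a ≤ b → (I.Y a ⟶ I.Y b)
  | false, false, _ => 𝟙 K.X
  | false, true, _ => I.incl
  | true, true, _ => 𝟙 A.X
  | true, false, h => absurd h (by decide)

/-- The multiplications `Y a ⊗ Y b ⟶ Y (a && b)` induced by that of `A`. -/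
def m : ∀ a b : Bool, I.Y a ⊗ I.Y b ⟶ I.Y (a && b)
  | false, false => K.mul
  | false, true => I.right
  | true, false => I.left
  | true, true => A.mul

/-- The map `Y a ⟶ A`. -/
def y (a : Bool) : I.Y a ⟶ A.X := I.Ymap (b := true) (by cases a <;> decide)

instance (a : Bool) : Mono (I.y a) :=
  match a with
  | false => I.mono
  | true => inferInstanceAs (Mono (𝟙 A.X))

lemma Ymap_y {a b : Bool} (h : a ≤ b) : I.Ymap h ≫ I.y b = I.y a :=
  match a, b, h with
  | false, false, _ => Category.id_comp I.incl
  | false, true, _ => Category.comp_id I.incl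
  | true, true, _ => Category.comp_id (𝟙 A.X)

lemma m_y (a b : Bool) : I.m a b ≫ I.y (a && b) = (I.y a ⊗ₘ I.y b) ≫ A.mul :=
  match a, b with
  | false, false => I.mul_incl
  | false, true => I.right_incl.trans (by rw [← tensorHom_id]; rfl)
  | true, false => I.left_incl.trans (by rw [← id_tensorHom]; rfl)
  | true, true => by
      change A.mul ≫ 𝟙 A.X = (𝟙 A.X ⊗ₘ 𝟙 A.X) ≫ A.mul
      simp

lemma Ymap_rfl (a : Bool) : I.Ymap (le_refl a) = 𝟙 (I.Y a) := by cases a <;> rfl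

lemma Ymap_comp {a b c : Bool} (h : a ≤ b) (h' : b ≤ c) :
    I.Ymap h ≫ I.Ymap h' = I.Ymap (h.trans h') := by
  rw [← cancel_mono (I.y c), Category.assoc, Ymap_y, Ymap_y, Ymap_y]

lemma and_mono {a b a' b' : Bool} (h : a ≤ a') (h' : b ≤ b') : (a && b) ≤ (a' && b') :=
  inf_le_inf h h'

lemma m_naturality {a b a' b' : Bool} (h : a ≤ a') (h' : b ≤ b') :
    I.m a b ≫ I.Ymap (and_mono h h') = (I.Ymap h ⊗ₘ I.Ymap h') ≫ I.m a' b' := by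
  rw [← cancel_mono (I.y (a' && b')), Category.assoc, Category.assoc, Ymap_y, m_y, m_y,
    tensorHom_comp_tensorHom_assoc, Ymap_y, Ymap_y]

lemma m_assoc_y (a b c : Bool) :
    ((I.m a b ▷ I.Y c) ≫ I.m (a && b) c) ≫ I.y ((a && b) && c) =
      ((α_ (I.Y a) (I.Y b) (I.Y c)).hom ≫ (I.Y a ◁ I.m b c) ≫ I.m a (b && c)) ≫
        I.y (a && (b && c)) := by
  simp only [Category.assoc, m_y]
  rw [← tensorHom_id, ← id_tensorHom, tensorHom_comp_tensorHom_assoc,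
    tensorHom_comp_tensorHom_assoc, m_y, m_y, Category.id_comp, Category.id_comp]
  have h1 : ((I.y a ⊗ₘ I.y b) ≫ A.mul) ⊗ₘ I.y c =
      ((I.y a ⊗ₘ I.y b) ⊗ₘ I.y c) ≫ A.mul ▷ A.X := by
    rw [← tensorHom_id, tensorHom_comp_tensorHom, Category.comp_id]
  have h2 : I.y a ⊗ₘ ((I.y b ⊗ₘ I.y c) ≫ A.mul) =
      (I.y a ⊗ₘ (I.y b ⊗ₘ I.y c)) ≫ A.X ◁ A.mul := by
    rw [← id_tensorHom, tensorHom_comp_tensorHom, Category.comp_id]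
  rw [h1, h2, Category.assoc, A.assoc, associator_naturality_assoc, Category.assoc]

/-- Replacing the letters number `i` and `i + 1` of a word by their minimum. -/
def merge : ∀ {n : ℕ} (_ : Fin (n + 1)) (_ : Fin (n + 2) → Bool), Fin (n + 1) → Bool
  | 0, _, f => Fin.cases (f 0 && f 1) fun j => f j.succ.succ
  | _ + 1, i, f => Fin.cases (Fin.cases (f 0 && f 1) fun j => f j.succ.succ)
      (fun i' => Fin.cases (f 0) (merge i' fun j => f j.succ)) i

/-- The map `Y_{f 0} ⊗ ⋯ ⊗ Y_{f (n + 1)} ⟶ Y_{g 0} ⊗ ⋯ ⊗ Y_{g n}`, `g = merge i f`, multiplying the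
factors number `i` and `i + 1`. -/
def mulAt : ∀ {n : ℕ} (i : Fin (n + 1)) (f : Fin (n + 2) → Bool),
    (tens fun j => I.Y (f j)) ⟶ tens fun j => I.Y (merge i f j)
  | 0, _, f => mulHead (I.m (f 0) (f 1)) (tens fun j : Fin 0 => I.Y (f j.succ.succ))
  | n + 1, i, f => Fin.cases
      (motive := fun i => (tens fun j => I.Y (f j)) ⟶ tens fun j => I.Y (merge i f j))
      (mulHead (I.m (f 0) (f 1)) (tens fun j : Fin (n + 1) => I.Y (f j.succ.succ)))
      (fun i' => I.Y (f 0) ◁ mulAt i' fun j => f j.succ) i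

lemma merge_mono : ∀ {n : ℕ} (i : Fin (n + 1)) {f g : Fin (n + 2) → Bool}, f ≤ g →
    merge i f ≤ merge i g
  | 0, i, f, g, h => by
      intro j
      cases j using Fin.cases with
      | zero => exact and_mono (h 0) (h 1)
      | succ j => exact j.elim0
  | n + 1, i, f, g, h => by
      intro j
      cases i using Fin.cases with
      | zero =>
        cases j using Fin.cases with
        | zero => exact and_mono (h 0) (h 1)
        | succ j => exact h _
      | succ i =>
        cases j using Fin.cases with
        | zero => exact h 0
        | succ j => exact merge_mono i (fun j => h j.succ) j

lemma merge_ne : ∀ {n : ℕ} (i : Fin (n + 1)) {f : Fin (n + 2) → Bool}, f ≠ (fun _ => true) →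
    merge i f ≠ fun _ => true := by
  have key : ∀ {n : ℕ} (i : Fin (n + 1)) {f : Fin (n + 2) → Bool},
      (∀ j, merge i f j = true) → ∀ j, f j = true := by
    have h0 {n : ℕ} {f : Fin (n + 2) → Bool} (h1 : (f 0 && f 1) = true)
        (h2 : ∀ j : Fin n, f j.succ.succ = true) (j) : f j = true := by
      rw [Bool.and_eq_true] at h1
      cases j using Fin.cases with
      | zero => exact h1.1
      | succ j =>
        cases j using Fin.cases with
        | zero => exact h1.2
        | succ j => exact h2 j
    intro n
    induction n with
    | zero => exact fun i f h => h0 (h 0) fun j => j.elim0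
    | succ n ih =>
      intro i f h
      cases i using Fin.cases with
      | zero => exact h0 (h 0) fun j => h j.succ
      | succ i =>
        intro j
        cases j using Fin.cases with
        | zero => exact h 0
        | succ j => exact ih i (f := fun j => f j.succ) (fun j => h j.succ) j
  exact fun {n} i {f} hf h => hf (funext (key i (congrFun h)))

lemma merge_const {n : ℕ} (i : Fin (n + 1)) (a : Bool) : merge i (fun _ => a) = fun _ => a := by
  induction n with
  | zero =>
    funext j
    cases j using Fin.cases with
    | zero => exact Bool.and_self a
    | succ j => exact j.elim0
  | succ n ih =>
    funext j
    cases i using Fin.cases with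
    | zero =>
      cases j using Fin.cases with
      | zero => exact Bool.and_self a
      | succ j => rfl
    | succ i =>
      cases j using Fin.cases with
      | zero => rfl
      | succ j => exact congrFun (ih i) j

lemma mulAt_naturality : ∀ {n : ℕ} (i : Fin (n + 1)) {f g : Fin (n + 2) → Bool} (h : f ≤ g),
    tensMap (fun j => I.Ymap (h j)) ≫ I.mulAt i g =
      I.mulAt i f ≫ tensMap fun j => I.Ymap (merge_mono i h j)
  | 0, i, f, g, h => (mulHead_naturality (I.m_naturality (h 0) (h 1)) _).symm
  | n + 1, i, f, g, h => by
      cases i using Fin.cases with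
      | zero => exact (mulHead_naturality (I.m_naturality (h 0) (h 1))
          (tensMap fun j : Fin (n + 1) => I.Ymap (h j.succ.succ))).symm
      | succ i =>
        have ih := mulAt_naturality i fun j => h j.succ
        exact tensor_whisker (I.Ymap (h 0)) ih

lemma mulAt_hom (E : Alg C) (φ : ∀ a, I.Y a ⟶ E.X)
    (hφ : ∀ a b, I.m a b ≫ φ (a && b) = (φ a ⊗ₘ φ b) ≫ E.mul) :
    ∀ {n : ℕ} (i : Fin (n + 1)) (f : Fin (n + 2) → Bool),
    tensMap (fun j => φ (f j)) ≫ E.mulAt n i = I.mulAt i f ≫ tensMap fun j => φ (merge i f j)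
  | 0, i, f => (mulHead_naturality (hφ (f 0) (f 1)) _).symm
  | n + 1, i, f => by
      cases i using Fin.cases with
      | zero => exact (mulHead_naturality (hφ (f 0) (f 1))
          (tensMap fun j : Fin (n + 1) => φ (f j.succ.succ))).symm
      | succ i =>
        have ih := mulAt_hom E φ hφ i fun j => f j.succ
        exact tensor_whisker (φ (f 0)) ih

/-- The partially ordered set of all maps `{0, …, n} → {0, 1}` except the constant map `1`. -/
abbrev Word (n : ℕ) : Type := {f : Fin (n + 1) → Bool // f ≠ fun _ => true}

/-- The functor `f ↦ Y_{f 0} ⊗ ⋯ ⊗ Y_{f n}`. -/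
def cube (n : ℕ) : Word n ⥤ C where
  obj f := tens fun j => I.Y (f.1 j)
  map {f g} h := tensMap fun j => I.Ymap (leOfHom h j)
  map_id f := by
    refine Eq.trans ?_ (tensMap_id _)
    congr 1
    funext j
    exact I.Ymap_rfl _
  map_comp {f g k} h h' := by
    refine Eq.trans ?_ (tensMap_comp _ _)
    congr 1
    funext j
    exact (I.Ymap_comp _ _).symm

lemma rotIdx_surjective (n : ℕ) : Function.Surjective (rotIdx n) := by
  intro j
  cases j using Fin.lastCases with
  | last => exact ⟨0, rfl⟩
  | cast j => exact ⟨j.succ, rfl⟩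

lemma rot_ne {n : ℕ} {f : Fin (n + 1) → Bool} (hf : f ≠ fun _ => true) :
    (fun j => f (rotIdx n j)) ≠ fun _ => true := fun h => hf (funext fun j => by
  obtain ⟨k, rfl⟩ := rotIdx_surjective n j
  exact congrFun h k)

lemma zero_ne (n : ℕ) : (fun _ : Fin (n + 1) => false) ≠ fun _ => true :=
  fun h => by simpa using congrFun h 0

variable [HasFiniteColimits C]

/-- `Cₙ(K : A)`, the colimit of `cube n`. -/
def relX (n : ℕ) : C := colimit (I.cube n)

/-- The canonical maps to the colimit. -/
def ι {n : ℕ} (f : Fin (n + 1) → Bool) (hf : f ≠ fun _ => true) :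
    (tens fun j => I.Y (f j)) ⟶ I.relX n := colimit.ι (I.cube n) ⟨f, hf⟩

lemma w {n : ℕ} {f g : Fin (n + 1) → Bool} (hf : f ≠ fun _ => true) (hg : g ≠ fun _ => true)
    (h : f ≤ g) : tensMap (fun j => I.Ymap (h j)) ≫ I.ι g hg = I.ι f hf :=
  colimit.w (I.cube n) (homOfLE (show (⟨f, hf⟩ : Word n) ≤ ⟨g, hg⟩ from h))

lemma relX_ext {n : ℕ} {Z : C} {u v : I.relX n ⟶ Z} (h : ∀ f hf, I.ι f hf ≫ u = I.ι f hf ≫ v) :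
    u = v :=
  colimit.hom_ext fun f => h f.1 f.2

/-- The map out of the colimit. -/
def desc {n : ℕ} {Z : C}
    (u : ∀ f : Fin (n + 1) → Bool, f ≠ (fun _ => true) → ((tens fun j => I.Y (f j)) ⟶ Z))
    (h : ∀ (f g : Fin (n + 1) → Bool) hf hg (h : f ≤ g), tensMap (fun j => I.Ymap (h j)) ≫ u g hg = u f hf) :
    I.relX n ⟶ Z :=
  colimit.desc (I.cube n) ⟨Z, fun f => u f.1 f.2,
    fun f g k => (h f.1 g.1 f.2 g.2 (leOfHom k)).trans (Category.comp_id _).symm⟩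

lemma ι_desc {n : ℕ} {Z : C}
    (u : ∀ f : Fin (n + 1) → Bool, f ≠ (fun _ => true) → ((tens fun j => I.Y (f j)) ⟶ Z))
    (h : ∀ (f g : Fin (n + 1) → Bool) hf hg (h : f ≤ g), tensMap (fun j => I.Ymap (h j)) ≫ u g hg = u f hf)
    (f : Fin (n + 1) → Bool) (hf : f ≠ fun _ => true) : I.ι f hf ≫ I.desc u h = u f hf :=
  colimit.ι_desc _ _

/-- The map `Cₙ₊₁(K : A) ⟶ Cₙ(K : A)` multiplying the factors number `i` and `i + 1`. -/
def relFace (n : ℕ) (i : Fin (n + 1)) : I.relX (n + 1) ⟶ I.relX n :=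
  I.desc (fun f hf => I.mulAt i f ≫ I.ι (merge i f) (merge_ne i hf)) fun f g hf hg h => by
    rw [← Category.assoc, I.mulAt_naturality i h, Category.assoc, I.w (merge_ne i hf)]

lemma ι_relFace {n : ℕ} (i : Fin (n + 1)) (f : Fin (n + 2) → Bool) (hf : f ≠ fun _ => true) :
    I.ι f hf ≫ I.relFace n i = I.mulAt i f ≫ I.ι (merge i f) (merge_ne i hf) := I.ι_desc _ _ f hf

variable [SymmetricCategory C]

/-- The map `Cₙ(K : A) ⟶ Cₙ(K : A)` moving the last factor to the front. -/
def relRot (n : ℕ) : I.relX n ⟶ I.relX n :=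
  I.desc (fun f hf => Wodzicki.rot (fun j => I.Y (f j)) ≫ I.ι (fun j => f (rotIdx n j)) (rot_ne hf))
    fun f g hf hg h => by
      rw [← Category.assoc, rot_naturality fun j => I.Ymap (h j), Category.assoc,
        I.w (rot_ne hf) (rot_ne hg) fun j => h (rotIdx n j)]

lemma ι_relRot {n : ℕ} (f : Fin (n + 1) → Bool) (hf : f ≠ fun _ => true) :
    I.ι f hf ≫ I.relRot n =
      Wodzicki.rot (fun j => I.Y (f j)) ≫ I.ι (fun j => f (rotIdx n j)) (rot_ne hf) :=
  I.ι_desc _ _ f hf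

section Envelope

variable [Preadditive C] [HasBinaryBiproducts C] [MonoidalPreadditive C]

/-- The inclusions into `K ⊕ A`. -/
def φ : ∀ a, I.Y a ⟶ K.X ⊞ A.X
  | false => biprod.inl
  | true => biprod.inr

/-- The projections from `K ⊕ A`. -/
def ψ : ∀ a, K.X ⊞ A.X ⟶ I.Y a
  | false => biprod.fst
  | true => biprod.snd

lemma φ_ψ (a : Bool) : I.φ a ≫ I.ψ a = 𝟙 (I.Y a) :=
  match a with
  | false => biprod.inl_fst
  | true => biprod.inr_snd

lemma sum_ψ_φ : ∑ a, I.ψ a ≫ I.φ a = 𝟙 (K.X ⊞ A.X) := by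
  rw [Fintype.sum_bool, add_comm]
  exact biprod.total

lemma φ_ψ_ne {a b : Bool} (h : a ≠ b) : I.φ a ≫ I.ψ b = 0 :=
  match a, b, h with
  | false, true, _ => biprod.inl_snd
  | true, false, _ => biprod.inr_fst
  | false, false, h => absurd rfl h
  | true, true, h => absurd rfl h

/-- The multiplication of the semidirect product `K ⊕ A`. It is only used to deduce the identities
between the operators on `Cₙ(K : A)` from those for algebras. -/
def envMul : (K.X ⊞ A.X) ⊗ (K.X ⊞ A.X) ⟶ K.X ⊞ A.X :=
  ∑ a, ∑ b, (I.ψ a ⊗ₘ I.ψ b) ≫ I.m a b ≫ I.φ (a && b)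

lemma φ_envMul (a b : Bool) : (I.φ a ⊗ₘ I.φ b) ≫ I.envMul = I.m a b ≫ I.φ (a && b) := by
  rw [envMul, Preadditive.comp_sum, Finset.sum_eq_single a, Preadditive.comp_sum,
    Finset.sum_eq_single b]
  · rw [tensorHom_comp_tensorHom_assoc, φ_ψ, φ_ψ, id_tensorHom_id, Category.id_comp]
  · intro c _ hc
    rw [tensorHom_comp_tensorHom_assoc, I.φ_ψ_ne hc.symm, MonoidalPreadditive.tensor_zero, zero_comp]
  · simp
  · intro c _ hc
    rw [Preadditive.comp_sum]
    refine Finset.sum_eq_zero fun d _ => ?_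
    rw [tensorHom_comp_tensorHom_assoc, I.φ_ψ_ne hc.symm, MonoidalPreadditive.zero_tensor, zero_comp]
  · simp

lemma env_ext {Z : C} {f g : ((K.X ⊞ A.X) ⊗ (K.X ⊞ A.X)) ⊗ (K.X ⊞ A.X) ⟶ Z}
    (h : ∀ a b c, ((I.φ a ⊗ₘ I.φ b) ⊗ₘ I.φ c) ≫ f = ((I.φ a ⊗ₘ I.φ b) ⊗ₘ I.φ c) ≫ g) : f = g := by
  have e : ∑ a, ∑ b, ∑ c, ((I.ψ a ⊗ₘ I.ψ b) ⊗ₘ I.ψ c) ≫ ((I.φ a ⊗ₘ I.φ b) ⊗ₘ I.φ c) = 𝟙 _ := by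
    simp only [tensorHom_comp_tensorHom, ← tensor_sum, ← sum_tensor, sum_ψ_φ, id_tensorHom_id]
  rw [← Category.id_comp f, ← Category.id_comp g, ← e]
  simp only [Preadditive.sum_comp, Category.assoc, h]

/-- The semidirect product `K ⊕ A`. -/
def env : Alg C where
  X := K.X ⊞ A.X
  mul := I.envMul
  assoc := by
    apply I.env_ext
    intro a b c
    have e : ((I.m a b ▷ I.Y c) ≫ I.m (a && b) c) ≫ I.φ ((a && b) && c) =
      ((α_ (I.Y a) (I.Y b) (I.Y c)).hom ≫ (I.Y a ◁ I.m b c) ≫ I.m a (b && c)) ≫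
        I.φ (a && (b && c)) := by
      have h := I.m_assoc_y a b c
      cases a <;> cases b <;> cases c <;>
        exact congrArg (· ≫ I.φ _) ((cancel_mono (I.y _)).1 h)
    have h1 : ((I.φ a ⊗ₘ I.φ b) ⊗ₘ I.φ c) ≫ I.envMul ▷ (K.X ⊞ A.X) =
        (I.m a b ▷ I.Y c) ≫ (I.φ (a && b) ⊗ₘ I.φ c) := by
      rw [← tensorHom_id, ← tensorHom_id, tensorHom_comp_tensorHom, tensorHom_comp_tensorHom,
        φ_envMul, Category.comp_id, Category.id_comp]
    have h2 : (I.φ a ⊗ₘ (I.φ b ⊗ₘ I.φ c)) ≫ (K.X ⊞ A.X) ◁ I.envMul =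
        (I.Y a ◁ I.m b c) ≫ (I.φ a ⊗ₘ I.φ (b && c)) := by
      rw [← id_tensorHom, ← id_tensorHom, tensorHom_comp_tensorHom, tensorHom_comp_tensorHom,
        φ_envMul, Category.comp_id, Category.id_comp]
    rw [reassoc_of% h1, φ_envMul, associator_naturality_assoc, reassoc_of% h2, φ_envMul]
    simpa only [Category.assoc] using e

/-- The embedding of words. -/
def emb {n : ℕ} (f : Fin n → Bool) : (tens fun j => I.Y (f j)) ⟶ tpow I.env.X n :=
  tensMap fun j => I.φ (f j)

lemma emb_mono {n : ℕ} (f : Fin n → Bool) : Mono (I.emb f) := by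
  refine ⟨fun u v h => ?_⟩
  have e : I.emb f ≫ tensMap (fun j => I.ψ (f j)) = 𝟙 _ := by
    refine (tensMap_comp (fun j => I.φ (f j)) (fun j => I.ψ (f j))).symm.trans ?_
    simp only [φ_ψ]
    exact tensMap_id _
  rw [← Category.comp_id u, ← Category.comp_id v, ← e, ← Category.assoc, ← Category.assoc, h]

lemma emb_mulAt {n : ℕ} (i : Fin (n + 1)) (f : Fin (n + 2) → Bool) :
    I.mulAt i f ≫ I.emb (merge i f) = I.emb f ≫ I.env.mulAt n i :=
  (I.mulAt_hom I.env I.φ (fun a b => (I.φ_envMul a b).symm) i f).symm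

lemma emb_rot {n : ℕ} (f : Fin (n + 1) → Bool) :
    Wodzicki.rot (fun j => I.Y (f j)) ≫ I.emb (fun j => f (rotIdx n j)) =
      I.emb f ≫ rotPow I.env.X n :=
  (rot_naturality fun j => I.φ (f j)).symm

lemma comp_ι_eq {n : ℕ} {Z : C} {f g : Fin (n + 1) → Bool} (hfg : f = g)
    (hf : f ≠ fun _ => true) (hg : g ≠ fun _ => true)
    {u : Z ⟶ tens fun j => I.Y (f j)} {v : Z ⟶ tens fun j => I.Y (g j)}
    (h : u ≫ I.emb f = v ≫ I.emb g) : u ≫ I.ι f hf = v ≫ I.ι g hg := by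
  subst hfg
  have := I.emb_mono f
  rw [(cancel_mono (I.emb f)).1 h]

lemma merge_apply : ∀ {n : ℕ} (i : Fin (n + 1)) (f : Fin (n + 2) → Bool) (j : Fin (n + 1)),
    merge i f j = if j < i then f j.castSucc else if j = i then f j.castSucc && f j.succ
      else f j.succ := by
  have h0 {n : ℕ} (f : Fin (n + 2) → Bool) (j : Fin (n + 1)) :
      (Fin.cases (f 0 && f 1) (fun j => f j.succ.succ) j : Bool) =
        if j < 0 then f j.castSucc else if j = 0 then f j.castSucc && f j.succ else f j.succ := by
    cases j using Fin.cases with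
    | zero => simp
    | succ j => simp
  intro n
  induction n with
  | zero =>
    intro i f j
    obtain rfl : i = 0 := Fin.fin_one_eq_zero i
    exact h0 f j
  | succ n ih =>
    intro i f j
    cases i using Fin.cases with
    | zero => exact h0 f j
    | succ i =>
      cases j using Fin.cases with
      | zero => simp [merge]
      | succ j =>
        refine (ih i (fun j => f j.succ) j).trans ?_
        simp

lemma merge_merge {n : ℕ} (i j : Fin (n + 1)) (h : i ≤ j) (f : Fin (n + 3) → Bool) :
    merge i (merge j.succ f) = merge j (merge i.castSucc f) := by
  funext k
  simp only [merge_apply, Fin.lt_def, Fin.ext_iff, Fin.val_succ, Fin.val_castSucc,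
    Fin.succ_castSucc, Fin.le_def] at h ⊢
  grind

lemma rotIdx_zero (n : ℕ) : rotIdx n 0 = Fin.last n := rfl
lemma rotIdx_succ {n : ℕ} (i : Fin n) : rotIdx n i.succ = i.castSucc := rfl

lemma merge_rot {n : ℕ} (i : Fin n) (f : Fin (n + 2) → Bool) :
    merge i.succ (fun j => f (rotIdx (n + 1) j)) = fun j => merge i.castSucc f (rotIdx n j) := by
  funext j
  cases j using Fin.cases with
  | zero =>
    simp only [merge_apply, rotIdx_zero, Fin.lt_def, Fin.ext_iff, Fin.val_last, Fin.val_castSucc]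
    simp [rotIdx_zero]
    grind
  | succ j =>
    have e1 : rotIdx (n + 1) j.succ.castSucc = j.castSucc.castSucc := rfl
    have e2 : rotIdx (n + 1) j.succ.succ = j.castSucc.succ := rfl
    simp only [merge_apply, rotIdx_succ, e1, e2, Fin.ext_iff, Fin.lt_def, Fin.val_succ,
      Fin.val_castSucc, add_lt_add_iff_right, add_left_inj]

lemma rotWord {n : ℕ} (f : Fin (n + 1) → Bool) (j : Fin (n + 1)) :
    f ((rotIdx n)^[n + 1] j) = f j := by
  have h (j : Fin (n + 1)) : ((rotIdx n j : Fin (n + 1)) : ℕ) = (j + n) % (n + 1) := by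
    cases j using Fin.cases with
    | zero => simp [rotIdx_zero]
    | succ j =>
      rw [rotIdx_succ, Fin.val_succ, Fin.val_castSucc, show (j : ℕ) + 1 + n = j + (n + 1) by ring,
        Nat.add_mod_right, Nat.mod_eq_of_lt (by lia)]
  have h' (k : ℕ) (j : Fin (n + 1)) :
      (((rotIdx n)^[k] j : Fin (n + 1)) : ℕ) = (j + n * k) % (n + 1) := by
    induction k generalizing j with
    | zero => simp [Nat.mod_eq_of_lt j.2]
    | succ k ih =>
      rw [Function.iterate_succ_apply, ih, h, Nat.mod_add_mod]
      congr 1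
      ring
  congr 1
  apply Fin.ext
  rw [h', Nat.add_mul_mod_self_right, Nat.mod_eq_of_lt j.2]

/-- The precyclic object `n ↦ Cₙ(K : A)`. -/
def cyc : Precyclic C where
  obj := I.relX
  face := I.relFace
  rot := I.relRot
  face_face n i j h := I.relX_ext fun f hf => by
    rw [reassoc_of% I.ι_relFace j.succ f hf, reassoc_of% I.ι_relFace i.castSucc f hf, ι_relFace,
      ι_relFace, ← Category.assoc, ← Category.assoc]
    refine I.comp_ι_eq (merge_merge i j h f) _ _ ?_
    rw [Category.assoc, emb_mulAt, ← Category.assoc, emb_mulAt, Category.assoc,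
      Category.assoc, emb_mulAt, ← Category.assoc (I.mulAt _ _), emb_mulAt, Category.assoc,
      I.env.mulAt_mulAt n i j h]
  rot_face n i := I.relX_ext fun f hf => by
    rw [reassoc_of% I.ι_relRot f hf, reassoc_of% I.ι_relFace i.castSucc f hf, ι_relFace, ι_relRot, ← Category.assoc, ← Category.assoc]
    refine I.comp_ι_eq (merge_rot i f) _ _ ?_
    rw [Category.assoc, emb_mulAt, ← Category.assoc, emb_rot, Category.assoc,
      Category.assoc, emb_rot, ← Category.assoc (I.mulAt _ _), emb_mulAt, Category.assoc,
      I.env.rotPow_mulAt n i]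
  iter_rot n := by
    have key (k : ℕ) (f : Fin (n + 1) → Bool) (hf : f ≠ fun _ => true) :
        ∃ (g : Fin (n + 1) → Bool) (hg : g ≠ fun _ => true)
          (u : (tens fun j => I.Y (f j)) ⟶ tens fun j => I.Y (g j)),
          (∀ j, g j = f ((rotIdx n)^[k] j)) ∧
            u ≫ I.emb g = I.emb f ≫ iter (rotPow I.env.X n) k ∧
            I.ι f hf ≫ iter (I.relRot n) k = u ≫ I.ι g hg := by
      induction k with
      | zero => exact ⟨f, hf, 𝟙 _, fun _ => rfl, by simp, by simp⟩
      | succ k ih =>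
        obtain ⟨g, hg, u, h1, h2, h3⟩ := ih
        refine ⟨_, rot_ne hg, u ≫ Wodzicki.rot _, fun j => ?_, ?_, ?_⟩
        · rw [h1, Function.iterate_succ_apply]
        · rw [Category.assoc, emb_rot, reassoc_of% h2, iter_succ]
        · rw [iter_succ, reassoc_of% h3, ι_relRot, Category.assoc]
    apply I.relX_ext
    intro f hf
    obtain ⟨g, hg, u, h1, h2, h3⟩ := key (n + 1) f hf
    rw [h3, Category.comp_id, ← Category.id_comp (I.ι f hf)]
    refine I.comp_ι_eq (funext fun j => (h1 j).trans (rotWord f j)) _ _ ?_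
    rw [h2, iter_rotPow, Category.id_comp]
    exact Category.comp_id _

/-- The natural map from the precyclic object of `K` to that of `K : A`. -/
def toRel : K.cyc ⟶ I.cyc where
  app n := I.ι (fun _ => false) (zero_ne n)
  face_app n i := by
    refine Eq.trans ?_ (I.ι_relFace i (fun _ => false) (zero_ne (n + 1))).symm
    refine I.comp_ι_eq (merge_const i false).symm _ _ ?_
    refine Eq.trans ?_ (I.emb_mulAt i fun _ => false).symm
    exact (K.mulAt_hom I.env biprod.inl (I.φ_envMul false false) n i).symm
  rot_app n := (I.ι_relRot (fun _ => false) (zero_ne n)).symm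

end Envelope

end CofIdeal

/-! ## Excision -/

variable [SymmetricCategory C] [Preadditive C] [HasZeroObject C] [HasBinaryBiproducts C]
  [HasFiniteColimits C]
  [MonoidalPreadditive C]

/-- `K` is `D`-excisive if for every algebra `A` in which `K` is a cof-ideal, the natural map
`D(K) ⟶ D(K : A)` is a weak equivalence. -/
def IsExcisive (J : ObjectProperty C) (D : Precyclic C ⥤ ChainComplex C ℕ) (K : Alg C) : Prop :=
  ∀ (A : Alg C) (I : CofIdeal J K A), IsWeakEquiv J (D.map I.toRel)

end
end Wodzicki

/-! Fix a relatively injective object `R` and pass to cochains `Hom(-, R)`. The map `K^{⊗ n + 1} ⟶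
A^{⊗ n + 1}` is a cofibration and factors through `Cₙ(K : A)`, so every cochain on `C(K)` extends to
`C(K : A)`. To prove excision it therefore suffices that the relative cochains, those vanishing on
`C(K)`, form an acyclic complex (`quasiIso_of_relAcyclic`). Cochains on the colimit `Cₙ(K : A)`
extend to `A^{⊗ n + 1}` (`exists_relWord_comp`), so one may compute with maps `A^{⊗ n + 1} ⟶ R`,
tested on the runs `A^{⊗ p} ⊗ K^{⊗ r} ⊗ A^{⊗ s}`.

From condition 1 to excision: a relative cocycle `u` is changed by coboundaries of relative cochains
until it vanishes on the words with `K` in position `p`, successively for `p = 0, 1, …`. For fixed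
`p` the length of the run of factors `K` that is killed decreases step by step. If `u` vanishes on
words with a `K` before position `p` and on the run of length `r + 1` at `p`, then on the run of
length `r` it descends to `(A/K)^{⊗ p} ⊗ K^{⊗ r} ⊗ A/K ⊗ A^{⊗ s - 1}`. There all faces meeting the
outer factors vanish, and the boundary is, up to sign, `b'` of `K` tensored with a fixed object.
Condition 1 makes the descended cocycle a coboundary. A primitive extends along the cofibration
replacing `K^{⊗ r - 1}` by `A^{⊗ r - 1}`, because `R` is relatively injective, and pulls back to a
tensor power of `A` (`exists_faceSum_step`, `exists_faceSum`). The cyclic face lands in words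
already killed, so `b` and `b'` are treated together. The complexes `Ω` and `𝔅Ω` are built from
these two by extensions (`relAcyclic_omega`, `relAcyclic_bar`).

For the converse, given `V`, let `A = K ⊕ V`, where all products involving `V` vanish. The words `V
⊗ K^{⊗ n + 1}` sit in `Cₙ₊₁(K : A)`, and both `b` and `b'` restrict there to `-(V ⊗ b')`, since `V`
annihilates its neighbours. The projection of `A^{⊗ n + 2}` to `V ⊗ K^{⊗ n + 1}` turns a cocycle on
`V ⊗ C^{bar} K` into a cocycle for both boundaries that vanishes on `C(K)`. Excision makes it a
coboundary, and restricting back to `V ⊗ K^{⊗ n + 1}` shows that the original cocycle bounds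
(`isTest_sqZero`, `cochainAcyclic`). For `Ω` and `𝔅Ω` the norm `N` transports the argument: `N b' =
b N`, and `N` acts as the identity between this inclusion and projection. -/

namespace Wodzicki

/-! ### Quasi-isomorphisms of abelian groups in terms of elements -/

section QuasiIso

variable {S₁ S₂ : ShortComplex AddCommGrpCat.{u}} (φ : S₁ ⟶ S₂)

lemma ab_π_eq_zero_iff (S : ShortComplex AddCommGrpCat.{u}) (x : S.abLeftHomologyData.K) :
    S.abLeftHomologyData.π x = 0 ↔ ∃ y, S.f y = S.abLeftHomologyData.i x := by
  have h (x : AddMonoidHom.ker S.g.hom) :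
      (x : AddMonoidHom.ker S.g.hom ⧸ AddMonoidHom.range S.abToCycles) = 0 ↔
        ∃ y, S.f y = (x : S.X₂) := by
    rw [QuotientAddGroup.eq_zero_iff, AddMonoidHom.mem_range]
    exact exists_congr fun y => Subtype.ext_iff
  exact h x

lemma ab_exists_i_eq (S : ShortComplex AddCommGrpCat.{u}) (x : S.X₂) (hx : S.g x = 0) :
    ∃ k, S.abLeftHomologyData.i k = x :=
  ⟨(⟨x, hx⟩ : AddMonoidHom.ker S.g.hom), rfl⟩

/-- Homology is computed as kernel modulo image; the two clauses are injectivity and surjectivity of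
the induced map, read off on representatives. -/
lemma ab_quasiIso_iff : ShortComplex.QuasiIso φ ↔
    (∀ x : S₁.X₂, S₁.g x = 0 → ∀ y, S₂.f y = φ.τ₂ x → ∃ z, S₁.f z = x) ∧
    (∀ y : S₂.X₂, S₂.g y = 0 → ∃ x z, S₁.g x = 0 ∧ φ.τ₂ x - y = S₂.f z) := by
  let γ : ShortComplex.LeftHomologyMapData φ S₁.abLeftHomologyData S₂.abLeftHomologyData := default
  have hK (x) : S₂.abLeftHomologyData.i (γ.φK x) = φ.τ₂ (S₁.abLeftHomologyData.i x) :=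
    ConcreteCategory.congr_hom γ.commi x
  have hπ (x) : γ.φH (S₁.abLeftHomologyData.π x) = S₂.abLeftHomologyData.π (γ.φK x) :=
    ConcreteCategory.congr_hom γ.commπ x
  have hs (S : ShortComplex AddCommGrpCat.{u}) : Function.Surjective S.abLeftHomologyData.π :=
    (AddCommGrpCat.epi_iff_surjective _).1 inferInstance
  have hg (S : ShortComplex AddCommGrpCat.{u}) (x) : S.g (S.abLeftHomologyData.i x) = 0 :=
    ConcreteCategory.congr_hom S.abLeftHomologyData.wi x
  rw [γ.quasiIso_iff, ConcreteCategory.isIso_iff_bijective]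
  refine and_congr ⟨fun h x hx y hy => ?_, fun h => ?_⟩ ⟨fun h y hy => ?_, fun h => ?_⟩
  · obtain ⟨x, rfl⟩ := ab_exists_i_eq S₁ x hx
    refine (ab_π_eq_zero_iff S₁ x).1 (h ?_)
    rw [map_zero, hπ]
    refine (ab_π_eq_zero_iff S₂ _).2 ⟨y, ?_⟩
    rw [hK, hy]
  · rw [injective_iff_map_eq_zero]
    intro a ha
    obtain ⟨x, rfl⟩ := hs S₁ a
    rw [hπ] at ha
    obtain ⟨y, hy⟩ := (ab_π_eq_zero_iff S₂ _).1 ha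
    rw [hK] at hy
    exact (ab_π_eq_zero_iff S₁ x).2 (h _ (hg S₁ x) y hy)
  · obtain ⟨y, rfl⟩ := ab_exists_i_eq S₂ y hy
    obtain ⟨a, ha⟩ := h (S₂.abLeftHomologyData.π y)
    obtain ⟨x, rfl⟩ := hs S₁ a
    rw [hπ, ← sub_eq_zero, ← map_sub] at ha
    obtain ⟨z, hz⟩ := (ab_π_eq_zero_iff S₂ _).1 ha
    refine ⟨S₁.abLeftHomologyData.i x, z, hg S₁ x, ?_⟩
    rw [hz, ← hK, map_sub]
  · intro a
    obtain ⟨y, rfl⟩ := hs S₂ a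
    obtain ⟨x, z, hx, hz⟩ := h (S₂.abLeftHomologyData.i y) (hg S₂ y)
    obtain ⟨x, rfl⟩ := ab_exists_i_eq S₁ x hx
    refine ⟨S₁.abLeftHomologyData.π x, ?_⟩
    rw [hπ, ← sub_eq_zero, ← map_sub]
    refine (ab_π_eq_zero_iff S₂ _).2 ⟨z, ?_⟩
    rw [← hz, ← hK, map_sub]

end QuasiIso

/-! ### Cohomology of `Hom(f, I)` in terms of morphisms -/

section Cochains

variable {C : Type u} [Category.{v} C] [Preadditive C]

/-- Degree `0` has no predecessor, so `prev` takes its default value there. The incoming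
differential is then the zero map `d 0 0`, which is why degree `0` is a separate clause in the
notions below. -/
lemma symm_down_prev_zero : (ComplexShape.down ℕ).symm.prev 0 = 0 :=
  (ComplexShape.down ℕ).symm.prev_eq_self' 0 fun j h => by
    simp at h

lemma symm_down_prev_succ (n : ℕ) : (ComplexShape.down ℕ).symm.prev (n + 1) = n :=
  (ComplexShape.down ℕ).symm.prev_eq' (by simp)

lemma symm_down_next (n : ℕ) : (ComplexShape.down ℕ).symm.next n = n + 1 :=
  (ComplexShape.down ℕ).symm.next_eq' (by simp)

variable {X Y : ChainComplex C ℕ} (f : X ⟶ Y) (I : C)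

/-- The cochain map `Hom(f, I)` is injective in cohomology. -/
def CohomInjective : Prop :=
  (∀ c : Y.X 0 ⟶ I, Y.d 1 0 ≫ c = 0 → f.f 0 ≫ c = 0 → c = 0) ∧
  ∀ (n : ℕ) (c : Y.X (n + 1) ⟶ I), Y.d (n + 2) (n + 1) ≫ c = 0 →
    ∀ e : X.X n ⟶ I, X.d (n + 1) n ≫ e = f.f (n + 1) ≫ c →
      ∃ z : Y.X n ⟶ I, Y.d (n + 1) n ≫ z = c

/-- The cochain map `Hom(f, I)` is surjective in cohomology. -/
def CohomSurjective : Prop :=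
  (∀ c : X.X 0 ⟶ I, X.d 1 0 ≫ c = 0 → ∃ x : Y.X 0 ⟶ I, Y.d 1 0 ≫ x = 0 ∧ f.f 0 ≫ x = c) ∧
  ∀ (n : ℕ) (c : X.X (n + 1) ⟶ I), X.d (n + 2) (n + 1) ≫ c = 0 →
    ∃ (x : Y.X (n + 1) ⟶ I) (z : X.X n ⟶ I), Y.d (n + 2) (n + 1) ≫ x = 0 ∧
      f.f (n + 1) ≫ x - c = X.d (n + 1) n ≫ z

lemma quasiIso_homInto_iff :
    QuasiIso ((homInto _ I).map f.op) ↔ CohomInjective f I ∧ CohomSurjective f I := by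
  have h0 := (quasiIsoAt_iff' ((homInto _ I).map f.op) 0 0 1 symm_down_prev_zero
    (symm_down_next 0)).trans (ab_quasiIso_iff _)
  have hn (n : ℕ) := (quasiIsoAt_iff' ((homInto _ I).map f.op) n (n + 1) (n + 2)
    (symm_down_prev_succ n) (symm_down_next (n + 1))).trans (ab_quasiIso_iff _)
  -- With the default `prev 0 = 0`, being a coboundary in degree `0` means being zero.
  have e (Z : ChainComplex C ℕ) (z : Z.X 0 ⟶ I) : Z.d 0 0 ≫ z = 0 := by
    rw [Z.shape _ _ (by simp), zero_comp]
  rw [_root_.quasiIso_iff]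
  constructor
  · intro h
    refine ⟨⟨fun c h1 h2 => ?_, fun n c h1 e h2 => ((hn n).1 (h (n + 1))).1 c h1 e h2⟩,
      ⟨fun c h1 => ?_, fun n c h1 => ((hn n).1 (h (n + 1))).2 c h1⟩⟩
    · obtain ⟨z, hz⟩ := (h0.1 (h 0)).1 c h1 (0 : X.X 0 ⟶ I) ((e X 0).trans h2.symm)
      exact hz.symm.trans (e Y z)
    · obtain ⟨x, z, hx, hz⟩ := (h0.1 (h 0)).2 c h1
      exact ⟨x, hx, sub_eq_zero.1 (hz.trans (e X z))⟩
  · rintro ⟨⟨hi0, hi⟩, hs0, hs⟩ n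
    cases n with
    | zero =>
      refine h0.2 ⟨fun c h1 y h2 => ⟨(0 : Y.X 0 ⟶ I), ?_⟩, fun c h1 => ?_⟩
      · exact (e Y 0).trans (hi0 c h1 (h2.symm.trans (e X y))).symm
      · obtain ⟨x, hx, hx'⟩ := hs0 c h1
        exact ⟨x, (0 : X.X 0 ⟶ I), hx, (sub_eq_zero.2 hx').trans (e X 0).symm⟩
    | succ n => exact (hn n).2 ⟨fun c h1 y h2 => hi n c h1 y h2, fun c h1 => hs n c h1⟩

/-- The cochains on `Y` with values in `I` that vanish on `X` form an acyclic complex. -/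
def RelAcyclic (X Y : ℕ → C) (d : ∀ n, Y (n + 1) ⟶ Y n) (f : ∀ n, X n ⟶ Y n) (I : C) : Prop :=
  (∀ c : Y 0 ⟶ I, d 0 ≫ c = 0 → f 0 ≫ c = 0 → c = 0) ∧
  ∀ (n : ℕ) (c : Y (n + 1) ⟶ I), d (n + 1) ≫ c = 0 → f (n + 1) ≫ c = 0 →
    ∃ z : Y n ⟶ I, f n ≫ z = 0 ∧ d n ≫ z = c

/-- By `hf` there is a short exact sequence of relative cochains, cochains on `Y` and cochains on
`X`; the proof is the relevant part of its long exact sequence. -/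
lemma quasiIso_of_relAcyclic (hf : ∀ (n : ℕ) (c : X.X n ⟶ I), ∃ c', f.f n ≫ c' = c)
    (h : RelAcyclic X.X Y.X (fun n => Y.d (n + 1) n) f.f I) :
    QuasiIso ((homInto _ I).map f.op) := by
  rw [quasiIso_homInto_iff]
  have hs (n : ℕ) (c : X.X n ⟶ I) (hc : X.d (n + 1) n ≫ c = 0) :
      ∃ x : Y.X n ⟶ I, Y.d (n + 1) n ≫ x = 0 ∧ f.f n ≫ x = c := by
    obtain ⟨x, rfl⟩ := hf n c
    -- The coboundary of an arbitrary extension `x` is a relative cocycle; subtracting a relative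
    -- primitive turns `x` into a cocycle.
    obtain ⟨z, hz, hz'⟩ := h.2 n (Y.d (n + 1) n ≫ x) (by simp) (by simpa using hc)
    exact ⟨x - z, by simp [hz'], by simp [hz]⟩
  refine ⟨⟨h.1, fun n c h1 e h2 => ?_⟩, hs 0, fun n c h1 => ?_⟩
  · obtain ⟨e, rfl⟩ := hf n e
    -- Extending the primitive `e` of the restriction of `c` reduces to a cocycle that vanishes on
    -- `X`.
    obtain ⟨z, hz, hz'⟩ := h.2 n (c - Y.d (n + 1) n ≫ e) (by simp [h1]) (by simp [← h2])
    exact ⟨e + z, by simp [hz']⟩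
  · obtain ⟨x, hx, hx'⟩ := hs (n + 1) c h1
    exact ⟨x, 0, hx, by simp [hx']⟩

/-- The complex of cochains on `Y` with values in `I` is acyclic. -/
def CochainAcyclic (Y : ℕ → C) (d : ∀ n, Y (n + 1) ⟶ Y n) (I : C) : Prop :=
  (∀ c : Y 0 ⟶ I, d 0 ≫ c = 0 → c = 0) ∧
  ∀ (n : ℕ) (c : Y (n + 1) ⟶ I), d (n + 1) ≫ c = 0 → ∃ z : Y n ⟶ I, d n ≫ z = c

open scoped ZeroObject in
lemma quasiIso_zero_iff [HasZeroObject C] :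
    QuasiIso ((homInto _ I).map (0 : (0 : ChainComplex C ℕ) ⟶ Y).op) ↔
      CochainAcyclic Y.X (fun n => Y.d (n + 1) n) I := by
  have hz (n : ℕ) : IsZero ((0 : ChainComplex C ℕ).X n) :=
    (HomologicalComplex.eval C (ComplexShape.down ℕ) n).map_isZero (isZero_zero _)
  constructor
  · intro h
    obtain ⟨⟨h0, h1⟩, -⟩ := (quasiIso_homInto_iff _ _).1 h
    exact ⟨fun c hc => h0 c hc (by simp), fun n c hc => h1 n c hc 0 (by simp)⟩
  · intro h
    exact quasiIso_of_relAcyclic _ _ (fun n c => ⟨0, (hz n).eq_of_src _ _⟩)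
      ⟨fun c hc _ => h.1 c hc, fun n c hc _ => by
        obtain ⟨z, hz⟩ := h.2 n c hc
        exact ⟨z, by simp, hz⟩⟩

end Cochains

noncomputable section

/-! ### Tensor functors, cofibrations and epimorphisms stable under tensoring -/

section TensorFunctors

variable {C : Type u} [Category.{v} C] [MonoidalCategory C]

/-- Functors isomorphic to `V ⊗ -` for some object `V`. -/
def IsTensorFunctor (F : C ⥤ C) : Prop := ∃ V : C, Nonempty (tensorLeft V ≅ F)

lemma isTensorFunctor_id : IsTensorFunctor (𝟭 C) := ⟨𝟙_ C, ⟨leftUnitorNatIso C⟩⟩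

/-- This closure property drives the later inductions on words: the first factor is absorbed into
the functor, and the statement is applied to the shorter word. -/
lemma IsTensorFunctor.left {F : C ⥤ C} (hF : IsTensorFunctor F) (X : C) :
    IsTensorFunctor (tensorLeft X ⋙ F) := by
  obtain ⟨V, ⟨e⟩⟩ := hF
  exact ⟨V ⊗ X, ⟨tensorLeftTensor V X ≪≫ Functor.isoWhiskerLeft _ e⟩⟩

lemma IsTensorFunctor.right [SymmetricCategory C] {F : C ⥤ C} (hF : IsTensorFunctor F) (X : C) :
    IsTensorFunctor (tensorRight X ⋙ F) := by
  obtain ⟨V, ⟨e⟩⟩ := hF.left X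
  exact ⟨V, ⟨e ≪≫ Functor.isoWhiskerRight (BraidedCategory.tensorLeftIsoTensorRight X) F⟩⟩

variable [Preadditive C] [MonoidalPreadditive C] {F : C ⥤ C}

lemma IsTensorFunctor.additive (hF : IsTensorFunctor F) : F.Additive := by
  obtain ⟨V, ⟨e⟩⟩ := hF
  exact Functor.additive_of_iso e

variable {J : ObjectProperty C}

lemma IsTensorFunctor.cof (hJ : IsTensorProduct J) (hF : IsTensorFunctor F) {X Y : C} {i : X ⟶ Y}
    (hi : IsCofibration J i) :
    IsCofibration J (F.map i) := by
  obtain ⟨V, ⟨e⟩⟩ := hF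
  intro I hI u
  obtain ⟨w, hw⟩ := (hJ.left V).cof i hi I hI (e.hom.app X ≫ u)
  refine ⟨e.inv.app Y ≫ w, ?_⟩
  simp only at hw ⊢
  rw [← Category.assoc, e.inv.naturality, Category.assoc, hw, Iso.inv_hom_id_app_assoc]

variable [HasFiniteColimits C]

/-- Tensoring preserves all cokernels, so `F` of the cokernel is a cokernel of `F.map i`. -/
lemma IsTensorFunctor.exists_desc (hJ : IsTensorProduct J) (hF : IsTensorFunctor F) {X Y Z : C}
    (i : X ⟶ Y) (u : F.obj Y ⟶ Z) (hu : F.map i ≫ u = 0) :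
    ∃ w, F.map (cokernel.π i) ≫ w = u := by
  obtain ⟨V, ⟨e⟩⟩ := hF
  have := (hJ.left V).coker i
  have h : (tensorLeft V).map i ≫ e.hom.app Y ≫ u = 0 := by
    rw [← Category.assoc, e.hom.naturality, Category.assoc, hu, comp_zero]
  have h' := isColimitOfHasCokernelOfPreservesColimit (tensorLeft V) i
  obtain ⟨w, hw⟩ := Cofork.IsColimit.desc' h' (e.hom.app Y ≫ u) (by rw [h, zero_comp])
  refine ⟨e.inv.app _ ≫ w, ?_⟩
  rw [← Category.assoc, e.inv.naturality, Category.assoc]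
  exact (congrArg (e.inv.app Y ≫ ·) hw).trans (Iso.inv_hom_id_app_assoc e _ _)

lemma IsTensorFunctor.epi_π (hJ : IsTensorProduct J) (hF : IsTensorFunctor F) {X Y : C}
    (i : X ⟶ Y) :
    Epi (F.map (cokernel.π i)) := by
  obtain ⟨V, ⟨e⟩⟩ := hF
  have := (hJ.left V).coker i
  have h := isColimitOfHasCokernelOfPreservesColimit (tensorLeft V) i
  have : Epi ((tensorLeft V).map (cokernel.π i)) := Cofork.IsColimit.epi h
  have e' : F.map (cokernel.π i) =
    e.inv.app Y ≫ (tensorLeft V).map (cokernel.π i) ≫ e.hom.app _ := by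
    rw [e.hom.naturality, Iso.inv_hom_id_app_assoc]
  rw [e']
  infer_instance

/-- The maps which become epimorphisms after tensoring with any object. -/
def IsTensorEpi {X Y : C} (e : X ⟶ Y) : Prop := ∀ F : C ⥤ C, IsTensorFunctor F → Epi (F.map e)

lemma isTensorEpi_π (hJ : IsTensorProduct J) {X Y : C} (i : X ⟶ Y) :
    IsTensorEpi (cokernel.π i) := fun _ hF => hF.epi_π hJ i

lemma isTensorEpi_id (X : C) : IsTensorEpi (𝟙 X) := fun F _ => by
  rw [F.map_id]
  infer_instance

/-- The map is a composite of two whiskerings, and whiskering followed by a tensor functor is again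
a tensor functor. Plain epimorphisms would not suffice here. -/
lemma IsTensorEpi.tensorHom [SymmetricCategory C] {X Y X' Y' : C} {e : X ⟶ Y} {e' : X' ⟶ Y'}
    (he : IsTensorEpi e) (he' : IsTensorEpi e') : IsTensorEpi (e ⊗ₘ e') := fun F hF => by
  have h1 : Epi (F.map (e ▷ X')) := he _ (hF.right X')
  have h2 : Epi (F.map (Y ◁ e')) := he' _ (hF.left Y)
  rw [MonoidalCategory.tensorHom_def, F.map_comp]
  infer_instance

lemma isCofibration_id (X : C) : IsCofibration J (𝟙 X) := fun _ _ u => ⟨u, Category.id_comp u⟩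

lemma IsCofibration.comp {X Y Z : C} {i : X ⟶ Y} {j : Y ⟶ Z} (hi : IsCofibration J i)
    (hj : IsCofibration J j) : IsCofibration J (i ≫ j) := fun I hI u => by
  obtain ⟨v, rfl⟩ := hi I hI u
  obtain ⟨w, rfl⟩ := hj I hI v
  exact ⟨w, Category.assoc _ _ _⟩

lemma IsCofibration.tensorHom (hJ : IsTensorProduct J) {X Y X' Y' : C} {i : X ⟶ Y} {i' : X' ⟶ Y'}
    (hi : IsCofibration J i) (hi' : IsCofibration J i') : IsCofibration J (i ⊗ₘ i') := by
  rw [MonoidalCategory.tensorHom_def]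
  exact ((hJ.right X').cof i hi).comp ((hJ.left Y).cof i' hi')

end TensorFunctors

/-! ### Words with a repeated factor followed by a tail -/

section Pad

variable {C : Type u} [Category.{v} C] [MonoidalCategory C]

/-- The object `X ⊗ (⋯ ⊗ (X ⊗ T (n - p)))` with `p` factors `X`, if `p ≤ n`. -/
def pad (X : C) : ℕ → (ℕ → C) → ℕ → C
  | 0, T, n => T n
  | _ + 1, _, 0 => 𝟙_ C
  | p + 1, T, n + 1 => X ⊗ pad X p T n

variable {X X' X'' A : C} {T T' T'' : ℕ → C}

/-- The functoriality of `pad`. -/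
def padMap (x : X ⟶ X') (t : ∀ n, T n ⟶ T' n) : ∀ p n, pad X p T n ⟶ pad X' p T' n
  | 0, n => t n
  | _ + 1, 0 => 𝟙 (𝟙_ C)
  | p + 1, n + 1 => x ⊗ₘ padMap x t p n

/-- The map from `pad` to a tensor power. -/
def padTo (x : X ⟶ A) (t : ∀ n, T n ⟶ tpow A n) : ∀ p n, pad X p T n ⟶ tpow A n
  | 0, n => t n
  | _ + 1, 0 => 𝟙 (𝟙_ C)
  | p + 1, n + 1 => x ⊗ₘ padTo x t p n

/-- The map from a tensor power to `pad`. -/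
def padFrom (x : A ⟶ X) (t : ∀ n, tpow A n ⟶ T n) : ∀ p n, tpow A n ⟶ pad X p T n
  | 0, n => t n
  | _ + 1, 0 => 𝟙 (𝟙_ C)
  | p + 1, n + 1 => x ⊗ₘ padFrom x t p n

lemma padMap_comp (x : X ⟶ X') (t : ∀ n, T n ⟶ T' n) (x' : X' ⟶ X'') (t' : ∀ n, T' n ⟶ T'' n) :
    ∀ p n, padMap x t p n ≫ padMap x' t' p n =
      padMap (x ≫ x') (fun n => t n ≫ t' n) p n
  | 0, _ => rfl
  | _ + 1, 0 => Category.id_comp _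
  | p + 1, n + 1 => by
      refine (tensorHom_comp_tensorHom _ _ _ _).trans ?_
      rw [padMap_comp]
      rfl

lemma padTo_comp_padFrom (x : X ⟶ A) (t : ∀ n, T n ⟶ tpow A n) (x' : A ⟶ X')
    (t' : ∀ n, tpow A n ⟶ T' n) :
    ∀ p n, padTo x t p n ≫ padFrom x' t' p n = padMap (x ≫ x') (fun n => t n ≫ t' n) p n
  | 0, _ => rfl
  | _ + 1, 0 => Category.id_comp _
  | p + 1, n + 1 => by
      refine (tensorHom_comp_tensorHom _ _ _ _).trans ?_
      rw [padTo_comp_padFrom]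
      rfl

/-- The shift map of `pad` induced by a shift map of the tail. -/
def padShift [Preadditive C] (X : C) (t : ∀ n, T (n + 1) ⟶ T' n) :
    ∀ p n, pad X p T (n + 1) ⟶ pad X p T' n
  | 0, n => t n
  | _ + 1, 0 => 0
  | p + 1, n + 1 => X ◁ padShift X t p n

lemma padShift_padMap [Preadditive C] {S S' : ℕ → C} (x : X ⟶ X') (s : ∀ n, S (n + 1) ⟶ S' n)
    (t : ∀ n, T (n + 1) ⟶ T' n) (f : ∀ n, S n ⟶ T n) (f' : ∀ n, S' n ⟶ T' n)
    (h : ∀ n, s n ≫ f' n = f (n + 1) ≫ t n) :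
    ∀ p n, padShift X s p n ≫ padMap x f' p n = padMap x f p (n + 1) ≫ padShift X' t p n
  | 0, n => h n
  | p + 1, 0 => by
      exact (zero_comp (f := padMap x f' (p + 1) 0)).trans
        (comp_zero (f := padMap x f (p + 1) 1)).symm
  | p + 1, n + 1 => (tensor_whisker x (padShift_padMap x s t f f' h p n).symm).symm

variable [Preadditive C] [MonoidalPreadditive C] [HasFiniteColimits C] {J : ObjectProperty C}

lemma padMap_epi [SymmetricCategory C] {x : X ⟶ X'} {t : ∀ n, T n ⟶ T' n} (hx : IsTensorEpi x)
    (ht : ∀ n, IsTensorEpi (t n)) : ∀ p n, IsTensorEpi (padMap x t p n)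
  | 0, n => ht n
  | _ + 1, 0 => isTensorEpi_id _
  | p + 1, n + 1 => hx.tensorHom (padMap_epi hx ht p n)

lemma padMap_cof (hJ : IsTensorProduct J) {x : X ⟶ X'} {t : ∀ n, T n ⟶ T' n}
    (hx : IsCofibration J x) (ht : ∀ n, IsCofibration J (t n)) :
    ∀ p n, IsCofibration J (padMap x t p n)
  | 0, n => ht n
  | _ + 1, 0 => isCofibration_id _
  | p + 1, n + 1 => hx.tensorHom hJ (padMap_cof hJ hx ht p n)

end Pad

end

/-! ### Runs of factors `K` in tensor powers of `A` -/

noncomputable section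

variable {C : Type u} [Category.{v} C] [MonoidalCategory C]

lemma tensorHom_eq_whiskerLeft_comp {X X' Y Y' : C} (f : X ⟶ X') (g : Y ⟶ Y') :
    f ⊗ₘ g = X ◁ g ≫ f ▷ Y' := MonoidalCategory.tensorHom_def' f g

namespace CofIdeal

variable {J : ObjectProperty C} {K A : Alg C} (I : CofIdeal J K A)

/-- The subobject `A^{⊗ p} ⊗ K^{⊗ r} ⊗ A^{⊗ n - p - r}` of `A^{⊗ n}`. -/
def runMap (_ : CofIdeal J K A) (p r n : ℕ) : C := pad A.X p (pad K.X r (tpow A.X)) n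

/-- The map `A^{⊗ p} ⊗ K^{⊗ r} ⊗ A^{⊗ n - p - r} ⟶ A^{⊗ n}`. -/
def run (p r n : ℕ) : I.runMap p r n ⟶ tpow A.X n :=
  padTo (𝟙 A.X) (padTo I.incl (fun n => 𝟙 (tpow A.X n)) r) p n

lemma run_succ (p r n : ℕ) : I.run (p + 1) r (n + 1) = A.X ◁ I.run p r n :=
  id_tensorHom _ _

lemma run_zero_succ (r n : ℕ) :
    I.run 0 (r + 1) (n + 1) = K.X ◁ I.run 0 r n ≫ I.incl ▷ tpow A.X n :=
  tensorHom_eq_whiskerLeft_comp _ _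

lemma run_zero_one (n : ℕ) : I.run 0 1 (n + 1) = I.incl ▷ tpow A.X n :=
  tensorHom_id _ _

lemma map_run_zero_succ (F : C ⥤ C) {R : C} (r n : ℕ) (u : F.obj (tpow A.X (n + 1)) ⟶ R) :
    F.map (I.run 0 (r + 1) (n + 1)) ≫ u =
      (tensorLeft K.X ⋙ F).map (I.run 0 r n) ≫ F.map (I.incl ▷ tpow A.X n) ≫ u :=
  (congrArg (F.map · ≫ u) (I.run_zero_succ r n)).trans (F.map_comp_assoc _ _ _)

/-- The map `Y_{f 0} ⊗ ⋯ ⊗ Y_{f (n - 1)} ⟶ A^{⊗ n}`. -/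
def word {n : ℕ} (f : Fin n → Bool) : (tens fun j => I.Y (f j)) ⟶ tpow A.X n :=
  tensMap fun j => I.y (f j)

lemma exists_incl_comp_y : ∀ a : Bool, ∃ x : K.X ⟶ I.Y a, x ≫ I.y a = I.incl
  | false => ⟨𝟙 K.X, Category.id_comp _⟩
  | true => ⟨I.incl, Category.comp_id _⟩

lemma exists_comp_incl : ∀ {a : Bool}, a = false → ∃ x : I.Y a ⟶ K.X, x ≫ I.incl = I.y a
  | false, _ => ⟨𝟙 K.X, Category.id_comp _⟩

lemma exists_comp_y : ∀ {a : Bool}, a = true → ∃ x : A.X ⟶ I.Y a, x ≫ I.y a = 𝟙 A.X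
  | true, _ => ⟨𝟙 A.X, Category.comp_id _⟩

lemma exists_word_of_true : ∀ {n : ℕ} (f : Fin n → Bool), (∀ j, f j = true) →
    ∃ θ, 𝟙 (tpow A.X n) = θ ≫ I.word f
  | 0, _, _ => ⟨𝟙 (𝟙_ C), (Category.id_comp (𝟙 (𝟙_ C))).symm⟩
  | n + 1, f, h => by
      obtain ⟨x, hx⟩ := I.exists_comp_y (h 0)
      obtain ⟨θ, hθ⟩ := exists_word_of_true (fun j => f j.succ) fun j => h j.succ
      refine ⟨x ⊗ₘ θ, Eq.trans ?_ (tensorHom_comp_tensorHom _ _ _ _).symm⟩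
      refine Eq.trans ?_ (congrArg₂ (· ⊗ₘ ·) hx.symm hθ)
      exact (id_tensorHom_id _ _).symm

/-- Inside the run any letter of `f` is allowed, since `K` maps to `K` and to `A`; only outside it
must the letters be `A`. Together with the opposite factorization in `exists_word_eq_run`, this
allows passing between the words indexing the colimit and the runs used in the induction. -/
lemma exists_run_eq_word : ∀ (p r : ℕ) {n : ℕ} (f : Fin n → Bool),
    (∀ j : Fin n, j < p ∨ p + r ≤ j → f j = true) → ∃ θ, I.run p r n = θ ≫ I.word f
  | 0, 0, n, f, h => I.exists_word_of_true f fun j => h j (by simp)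
  | 0, r + 1, 0, f, h => ⟨𝟙 (𝟙_ C), (Category.id_comp (𝟙 (𝟙_ C))).symm⟩
  | 0, r + 1, n + 1, f, h => by
      obtain ⟨x, hx⟩ := I.exists_incl_comp_y (f 0)
      obtain ⟨θ, hθ⟩ := exists_run_eq_word 0 r (fun j => f j.succ) fun j hj => h j.succ (by
        simp only [Fin.val_succ]; lia)
      refine ⟨x ⊗ₘ θ, Eq.trans ?_ (tensorHom_comp_tensorHom _ _ _ _).symm⟩
      exact congrArg₂ (· ⊗ₘ ·) hx.symm hθ
  | p + 1, r, 0, f, h => ⟨𝟙 (𝟙_ C), (Category.id_comp (𝟙 (𝟙_ C))).symm⟩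
  | p + 1, r, n + 1, f, h => by
      obtain ⟨x, hx⟩ := I.exists_comp_y (h 0 (by simp))
      obtain ⟨θ, hθ⟩ := exists_run_eq_word p r (fun j => f j.succ) fun j hj => h j.succ (by
        simp only [Fin.val_succ]; lia)
      refine ⟨x ⊗ₘ θ, Eq.trans ?_ (tensorHom_comp_tensorHom _ _ _ _).symm⟩
      exact congrArg₂ (· ⊗ₘ ·) hx.symm hθ

lemma exists_word_eq_run : ∀ (p r : ℕ) {n : ℕ} (f : Fin n → Bool),
    (∀ j : Fin n, p ≤ j → j < p + r → f j = false) → ∃ θ, I.word f = θ ≫ I.run p r n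
  | 0, 0, n, f, h => ⟨I.word f, (Category.comp_id _).symm⟩
  | 0, r + 1, 0, f, h => ⟨𝟙 (𝟙_ C), (Category.id_comp (𝟙 (𝟙_ C))).symm⟩
  | 0, r + 1, n + 1, f, h => by
      obtain ⟨x, hx⟩ := I.exists_comp_incl (h 0 (by simp) (by simp))
      obtain ⟨θ, hθ⟩ := exists_word_eq_run 0 r (fun j => f j.succ) fun j hj hj' => h j.succ
        (by simp) (by simp only [Fin.val_succ]; lia)
      refine ⟨x ⊗ₘ θ, Eq.trans ?_ (tensorHom_comp_tensorHom _ _ _ _).symm⟩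
      exact congrArg₂ (· ⊗ₘ ·) hx.symm hθ
  | p + 1, r, 0, f, h => ⟨𝟙 (𝟙_ C), (Category.id_comp (𝟙 (𝟙_ C))).symm⟩
  | p + 1, r, n + 1, f, h => by
      obtain ⟨θ, hθ⟩ := exists_word_eq_run p r (fun j => f j.succ) fun j hj hj' => h j.succ
        (by simp only [Fin.val_succ]; lia) (by simp only [Fin.val_succ]; lia)
      refine ⟨I.y (f 0) ⊗ₘ θ, Eq.trans ?_ (tensorHom_comp_tensorHom _ _ _ _).symm⟩
      exact congrArg₂ (· ⊗ₘ ·) (Category.comp_id _).symm hθ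

/-- If `[p', p' + r')` is contained in `[p, p + r)`, then `run p r n` factors through
`run p' r' n`. -/
lemma exists_run_eq_run {p r p' r' : ℕ} (h : p ≤ p') (h' : p' + r' ≤ p + r) (n : ℕ) :
    ∃ θ, I.run p r n = θ ≫ I.run p' r' n := by
  -- The intermediate word has the letter `K` exactly in the positions of the larger run.
  obtain ⟨θ, hθ⟩ := I.exists_run_eq_word p r (n := n) (fun j => decide ((j : ℕ) < p ∨ p + r ≤ j))
    fun j hj => by simpa using hj
  obtain ⟨θ', hθ'⟩ := I.exists_word_eq_run p' r' (n := n)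
    (fun j => decide ((j : ℕ) < p ∨ p + r ≤ j)) fun j h1 h2 => by
      rw [decide_eq_false_iff_not]
      lia
  exact ⟨θ ≫ θ', by rw [hθ, hθ', Category.assoc]⟩

lemma word_mulAt {n : ℕ} (i : Fin (n + 1)) (f : Fin (n + 2) → Bool) :
    I.word f ≫ A.mulAt n i = I.mulAt i f ≫ I.word (merge i f) :=
  I.mulAt_hom A I.y I.m_y i f

lemma word_rot [SymmetricCategory C] {n : ℕ} (f : Fin (n + 1) → Bool) :
    I.word f ≫ rotPow A.X n =
      Wodzicki.rot (fun j => I.Y (f j)) ≫ I.word (fun j => f (rotIdx n j)) :=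
  rot_naturality fun j => I.y (f j)

/-- The cyclic face applied to a word. -/
lemma exists_run_rot_face [SymmetricCategory C] {p r p' r' n : ℕ}
    (h : ∀ j, p' ≤ j → j < p' + r' → j ≤ n → p ≤ j ∧ j < p + r ∨
      j = 0 ∧ p ≤ n + 1 ∧ n + 1 < p + r) :
    ∃ θ, I.run p r (n + 2) ≫ rotPow A.X (n + 1) ≫ A.mulAt n 0 = θ ≫ I.run p' r' (n + 1) := by
  obtain ⟨θ, hθ⟩ := I.exists_run_eq_word p r (n := n + 2)
    (fun j => decide ((j : ℕ) < p ∨ p + r ≤ j)) fun j hj => by simpa using hj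
  -- After rotation and multiplication, position `0` carries the product of the last and the first
  -- letter, which lies in `K` as soon as one of them does; the other positions are unchanged.
  obtain ⟨θ', hθ'⟩ := I.exists_word_eq_run p' r' (n := n + 1)
    (merge 0 fun j => (fun j : Fin (n + 2) => decide ((j : ℕ) < p ∨ p + r ≤ j))
      (rotIdx (n + 1) j)) fun j h1 h2 => by
      have := h j h1 h2 (by lia)
      rw [merge_apply]
      cases j using Fin.cases with
      | zero =>
        have e : rotIdx (n + 1) 1 = 0 := rfl
        simp [rotIdx_zero, e] at this ⊢
        lia
      | succ j =>
        simp [rotIdx_succ] at this ⊢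
        lia
  refine ⟨θ ≫ Wodzicki.rot _ ≫ I.mulAt 0 _ ≫ θ', ?_⟩
  rw [hθ, Category.assoc, ← Category.assoc (I.word _), word_rot, Category.assoc, word_mulAt, hθ']
  simp only [Category.assoc]

/-! ### Passing to the quotient `A / K` outside a run -/

section Quotient

variable [SymmetricCategory C] [Preadditive C] [MonoidalPreadditive C] [HasFiniteColimits C]

/-- The quotient `A / K` of objects. -/
def quot : C := cokernel I.incl

/-- The projection `A ⟶ A / K`. -/
def π : A.X ⟶ I.quot := cokernel.π I.incl

/-- The quotient of `A^{⊗ n}` by `K ⊗ A^{⊗ n - 1}`, if `n ≥ 1`. -/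
def tailX : ℕ → C
  | 0 => 𝟙_ C
  | n + 1 => I.quot ⊗ tpow A.X n

/-- The projection `A^{⊗ n} ⟶ A / K ⊗ A^{⊗ n - 1}`. -/
def tailπ : ∀ n, tpow A.X n ⟶ I.tailX n
  | 0 => 𝟙 (𝟙_ C)
  | n + 1 => I.π ▷ tpow A.X n

/-- The projection `A^{⊗ p} ⊗ K^{⊗ r} ⊗ A^{⊗ s} ⟶ (A / K)^{⊗ p} ⊗ K^{⊗ r} ⊗ A / K ⊗ A^{⊗ s - 1}`,
`s = n - p - r`. -/
def runπ (p r n : ℕ) : I.runMap p r n ⟶ pad I.quot p (pad K.X r I.tailX) n :=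
  padMap I.π (padMap (𝟙 K.X) I.tailπ r) p n

/-- The projection `A^{⊗ n} ⟶ (A / K)^{⊗ p} ⊗ A^{⊗ r} ⊗ A / K ⊗ A^{⊗ s - 1}`, `s = n - p - r`. -/
def powπ (p r n : ℕ) : tpow A.X n ⟶ pad I.quot p (pad A.X r I.tailX) n :=
  padFrom I.π (padFrom (𝟙 A.X) I.tailπ r) p n

/-- The cofibration `(A / K)^{⊗ p} ⊗ K^{⊗ r} ⊗ A / K ⊗ A^{⊗ s - 1} ⟶
(A / K)^{⊗ p} ⊗ A^{⊗ r} ⊗ A / K ⊗ A^{⊗ s - 1}`, `s = n - p - r`. -/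
def runCof (p r n : ℕ) :
    pad I.quot p (pad K.X r I.tailX) n ⟶ pad I.quot p (pad A.X r I.tailX) n :=
  padMap (𝟙 I.quot) (padMap I.incl (fun n => 𝟙 (I.tailX n)) r) p n

/-- This square extends a cochain from the quotient of a run to `A^{⊗ n}`: extend it along the
cofibration `runCof`, then pull back along `powπ`. The result restricts to the given cochain on the
run. -/
lemma run_powπ (p r n : ℕ) : I.run p r n ≫ I.powπ p r n = I.runπ p r n ≫ I.runCof p r n := by
  refine (padTo_comp_padFrom _ _ _ _ p n).trans (Eq.trans ?_ (padMap_comp _ _ _ _ p n).symm)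
  rw [Category.comp_id, Category.id_comp]
  congr 1
  funext n
  refine (padTo_comp_padFrom _ _ _ _ r n).trans (Eq.trans ?_ (padMap_comp _ _ _ _ r n).symm)
  simp only [Category.comp_id, Category.id_comp]

lemma isTensorEpi_runπ (hJ : IsTensorProduct J) (p r n : ℕ) : IsTensorEpi (I.runπ p r n) :=
  padMap_epi (isTensorEpi_π hJ _) (padMap_epi (isTensorEpi_id _) (fun
    | 0 => isTensorEpi_id _
    | n + 1 => by
      have := (isTensorEpi_π hJ I.incl).tensorHom (isTensorEpi_id (tpow A.X n))
      rwa [tensorHom_id] at this) r) p n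

lemma isCofibration_runCof (hJ : IsTensorProduct J) (p r n : ℕ) :
    IsCofibration J (I.runCof p r n) :=
  padMap_cof hJ (isCofibration_id _) (padMap_cof hJ I.cof (fun _ => isCofibration_id _) r) p n

/-- A map on `F (A ⊗ X)` vanishing on `F (K ⊗ X)` factors through `F (A / K ⊗ X)`. -/
lemma exists_desc (hJ : IsTensorProduct J) {F : C ⥤ C} (hF : IsTensorFunctor F) {X R : C}
    (u : F.obj (A.X ⊗ X) ⟶ R) (hu : F.map (I.incl ▷ X) ≫ u = 0) :
    ∃ w : F.obj (I.quot ⊗ X) ⟶ R, F.map (I.π ▷ X) ≫ w = u :=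
  (hF.right X).exists_desc hJ I.incl u hu

lemma epi_π (hJ : IsTensorProduct J) {F : C ⥤ C} (hF : IsTensorFunctor F) (X : C) :
    Epi (F.map (I.π ▷ X)) :=
  (hF.right X).epi_π hJ I.incl

lemma map_run_succ_π (F : C ⥤ C) {R : C} (p r n : ℕ)
    {w : F.obj (I.quot ⊗ tpow A.X n) ⟶ R} {u : F.obj (tpow A.X (n + 1)) ⟶ R}
    (h : F.map (I.π ▷ tpow A.X n) ≫ w = u) :
    F.map (I.run (p + 1) r (n + 1)) ≫ u =
      F.map (I.π ▷ I.runMap p r n) ≫ (tensorLeft I.quot ⋙ F).map (I.run p r n) ≫ w := by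
  subst h
  have h {X Y : C} (g : X ⟶ Y) (w : F.obj (I.quot ⊗ Y) ⟶ R) :
      F.map (A.X ◁ g) ≫ F.map (I.π ▷ Y) ≫ w =
        F.map (I.π ▷ X) ≫ F.map (I.quot ◁ g) ≫ w := by
    rw [← F.map_comp_assoc, whisker_exchange, F.map_comp_assoc]
  exact (congrArg (F.map · ≫ _) (I.run_succ p r n)).trans (h _ w)

lemma map_runπ_succ (F : C ⥤ C) {R : C} (p r n : ℕ)
    (x : (tensorLeft I.quot ⋙ F).obj (pad I.quot p (pad K.X r I.tailX) n) ⟶ R) :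
    F.map (I.runπ (p + 1) r (n + 1)) ≫ x =
      F.map (I.π ▷ I.runMap p r n) ≫ (tensorLeft I.quot ⋙ F).map (I.runπ p r n) ≫ x :=
  (congrArg (F.map · ≫ x) (MonoidalCategory.tensorHom_def _ _)).trans (F.map_comp_assoc _ _ _)

/-- A map on `F (A^{⊗ n})` that vanishes on the images of the words with a factor `K` in a position
`< p`, and of the word with factors `K` in the positions `p`, …, `p + r`, is determined on
`F (A^{⊗ p} ⊗ K^{⊗ r} ⊗ A^{⊗ s})` by a map on the quotient. -/
lemma exists_runπ_comp (hJ : IsTensorProduct J) {R : C} : ∀ (p r n : ℕ) (F : C ⥤ C)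
    (_ : IsTensorFunctor F)
    (u : F.obj (tpow A.X n) ⟶ R) (_ : p + r ≤ n) (_ : ∀ i < p, F.map (I.run i 1 n) ≫ u = 0)
    (_ : p + r < n → F.map (I.run p (r + 1) n) ≫ u = 0),
    ∃ w, F.map (I.run p r n) ≫ u = F.map (I.runπ p r n) ≫ w
  | 0, 0, 0, F, hF, u, hn, h1, h2 => ⟨u, rfl⟩
  | 0, 0, n + 1, F, hF, u, hn, h1, h2 => by
      -- With nothing left of the run, vanishing on `K ⊗ A^{⊗ n}` lets the first factor of the tail
      -- descend to `A / K`.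
      have h := h2 (by lia)
      rw [run_zero_one] at h
      obtain ⟨w, hw⟩ := I.exists_desc hJ hF u h
      refine ⟨w, Eq.trans ?_ hw.symm⟩
      exact (congrArg (· ≫ u) (F.map_id _)).trans (Category.id_comp u)
  | 0, r + 1, n + 1, F, hF, u, hn, h1, h2 => by
      obtain ⟨w, hw⟩ := exists_runπ_comp hJ 0 r n _ (hF.left K.X) (F.map (I.incl ▷ _) ≫ u)
        (by lia) (by simp) fun h =>
          (I.map_run_zero_succ F (r + 1) n u).symm.trans (h2 (by lia))
      refine ⟨w, (I.map_run_zero_succ F r n u).trans ?_⟩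
      refine hw.trans (congrArg (F.map · ≫ w) ?_)
      exact (id_tensorHom _ _).symm
  | _ + 1, _, 0, _, _, _, h, _, _ => absurd h (by lia)
  | p + 1, r, n + 1, F, hF, u, hn, h1, h2 => by
      have h := h1 0 (by lia)
      rw [run_zero_one] at h
      obtain ⟨w, hw⟩ := I.exists_desc hJ hF u h
      -- The vanishing conditions pass to the map induced on the quotient because `A ⟶ A / K`
      -- remains an epimorphism after tensoring.
      have e (q s : ℕ) (h : F.map (I.run (q + 1) s (n + 1)) ≫ u = 0) :
          (tensorLeft I.quot ⋙ F).map (I.run q s n) ≫ w = 0 := by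
        have := I.epi_π hJ hF (I.runMap q s n)
        exact (cancel_epi (F.map (I.π ▷ I.runMap q s n))).1
          ((I.map_run_succ_π F q s n hw).symm.trans (h.trans comp_zero.symm))
      obtain ⟨x, hx⟩ := exists_runπ_comp hJ p r n _ (hF.left I.quot) w (by lia)
        (fun i hi => e i 1 (h1 (i + 1) (by lia))) fun h => e p (r + 1) (h2 (by lia))
      refine ⟨x, (I.map_run_succ_π F p r n hw).trans ?_⟩
      exact (congrArg (F.map (I.π ▷ I.runMap p r n) ≫ ·) hx).trans (I.map_runπ_succ F p r n x).symm

end Quotient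

end CofIdeal
end

/-! ### The boundary `b'` on runs -/

noncomputable section

variable {C : Type u} [Category.{v} C] [MonoidalCategory C] [SymmetricCategory C] [Preadditive C]
  [MonoidalPreadditive C]

/-- The difference of two morphisms, for use with objects that agree only by definition. -/
abbrev homSub {X Y : C} (f g : X ⟶ Y) : X ⟶ Y := f - g

lemma homSub_comp {X Y Z : C} (f g : X ⟶ Y) (h : Y ⟶ Z) :
    homSub f g ≫ h = homSub (f ≫ h) (g ≫ h) := Preadditive.sub_comp _ _ _

lemma comp_homSub {X Y Z : C} (h : X ⟶ Y) (f g : Y ⟶ Z) :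
    h ≫ homSub f g = homSub (h ≫ f) (h ≫ g) := Preadditive.comp_sub _ _ _

namespace Alg

variable (K A : Alg C)

/-- The boundary `b'` on tensor powers. -/
def barB (n : ℕ) : tpow A.X (n + 2) ⟶ tpow A.X (n + 1) := A.cyc.b' n

lemma barB_zero : A.barB 0 = mulHead A.mul (tpow A.X 0) := by
  change ∑ i : Fin 1, (-1 : ℤ) ^ (i : ℕ) • A.mulAt 0 i = A.mulAt 0 0
  simp

/-- Splitting off the face `0`; the faces not touching the first factor form `A ⊗ b'`, with their
sign changed. The inductions on words use this recursion. -/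
lemma barB_succ (n : ℕ) :
    A.barB (n + 1) = homSub (X := tpow A.X (n + 3)) (Y := tpow A.X (n + 2))
      (mulHead A.mul (tpow A.X (n + 1))) (A.X ◁ A.barB n) := by
  have h : A.X ◁ A.barB n = ∑ i : Fin (n + 1), (-1 : ℤ) ^ (i : ℕ) • A.X ◁ A.mulAt n i := by
    refine ((tensorLeft A.X).map_sum (fun i : Fin (n + 1) => (-1 : ℤ) ^ (i : ℕ) • A.mulAt n i)
      Finset.univ).trans (Finset.sum_congr rfl fun i _ => (tensorLeft A.X).map_zsmul)
  rw [h]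
  change ∑ i : Fin (n + 2), (-1 : ℤ) ^ (i : ℕ) • A.mulAt (n + 1) i = A.mulAt (n + 1) 0 -
    ∑ i : Fin (n + 1), (-1 : ℤ) ^ (i : ℕ) • A.mulAt (n + 1) i.succ
  rw [Fin.sum_univ_succ]
  simp [pow_succ, sub_eq_add_neg]

variable {T T' : ℕ → C}

/-- The boundary `b'` on the factors `K` of `K^{⊗ r + 1} ⊗ T (n - r)`, if `r ≤ n`. -/
def runB (T : ℕ → C) : ∀ r n, pad K.X (r + 1) T (n + 1) ⟶ pad K.X r T n
  | 0, _ => 0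
  | _ + 1, 0 => 0
  | r + 1, n + 1 => homSub (X := pad K.X (r + 2) T (n + 2)) (Y := pad K.X (r + 1) T (n + 1))
      (mulHead K.mul (pad K.X r T n)) (K.X ◁ runB T r n)

lemma runB_naturality (t : ∀ n, T n ⟶ T' n) : ∀ r n, K.runB T r n ≫ padMap (𝟙 K.X) t r n =
    padMap (𝟙 K.X) t (r + 1) (n + 1) ≫ K.runB T' r n
  | 0, n => (zero_comp (f := padMap (𝟙 K.X) t 0 n)).trans
      (comp_zero (f := padMap (𝟙 K.X) t 1 (n + 1))).symm
  | r + 1, 0 => (zero_comp (f := padMap (𝟙 K.X) t (r + 1) 0)).trans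
      (comp_zero (f := padMap (𝟙 K.X) t (r + 2) 1)).symm
  | r + 1, n + 1 => by
      refine (homSub_comp _ _ _).trans
        (Eq.trans ?_ (comp_homSub _ _ _).symm)
      refine congrArg₂ homSub (mulHead_naturality (by simp) _) ?_
      exact (tensor_whisker (𝟙 K.X) (runB_naturality t r n).symm).symm

/-- The isomorphism between `K^{⊗ r} ⊗ T s` and the corresponding value of `pad`. -/
def padIso (T : ℕ → C) (s : ℕ) : ∀ r, tpow K.X r ⊗ T s ≅ pad K.X r T (s + r)
  | 0 => λ_ (T s)
  | r + 1 => α_ K.X (tpow K.X r) (T s) ≪≫ whiskerLeftIso K.X (padIso T s r)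

lemma mulHead_whiskerRight (P Q : C) : mulHead K.mul P ▷ Q ≫ (α_ K.X P Q).hom =
    (α_ K.X (K.X ⊗ P) Q).hom ≫ K.X ◁ (α_ K.X P Q).hom ≫ mulHead K.mul (P ⊗ Q) := by
  simp [mulHead]

lemma whiskerLeft_whiskerRight {P Q R S : C} {f : P ⟶ Q} {p : P ⊗ S ⟶ R} {q : Q ⊗ S ⟶ T 0}
    {g : R ⟶ T 0} (e : f ▷ S ≫ q = p ≫ g) :
    (K.X ◁ f) ▷ S ≫ (α_ K.X Q S).hom ≫ K.X ◁ q = ((α_ K.X P S).hom ≫ K.X ◁ p) ≫ K.X ◁ g := by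
  rw [associator_naturality_middle_assoc, Category.assoc, ← whiskerLeft_comp, ← whiskerLeft_comp, e]

/-- The internal boundary of the runs is `b'` of `K` tensored with the constant object `T s`. The
index starts at `r + 1` because on a single factor `K` there is no internal face. -/
lemma padIso_naturality (T : ℕ → C) (s : ℕ) : ∀ r,
    K.barB r ▷ T s ≫ (K.padIso T s (r + 1)).hom =
      (K.padIso T s (r + 2)).hom ≫ K.runB T (r + 1) (s + r + 1) := by
  have h (r : ℕ) : mulHead K.mul (tpow K.X r) ▷ T s ≫ (K.padIso T s (r + 1)).hom =
      (K.padIso T s (r + 2)).hom ≫ mulHead K.mul (pad K.X r T (s + r)) := by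
    refine (Category.assoc _ _ _).symm.trans ?_
    refine (congrArg (· ≫ _) (K.mulHead_whiskerRight _ _)).trans ?_
    refine Eq.trans ?_ (Category.assoc _ _ _).symm
    refine (Category.assoc _ _ _).trans (congrArg (_ ≫ ·) ?_)
    refine (Category.assoc _ _ _).trans ?_
    refine (congrArg (_ ≫ ·) (mulHead_whisker K.mul (K.padIso T s r).hom)).trans ?_
    refine (Category.assoc _ _ _).symm.trans (congrArg (· ≫ _) ?_)
    exact (whiskerLeft_comp _ _ _).symm
  intro r
  induction r with
  | zero =>
    rw [barB_zero]
    refine (h 0).trans (congrArg (_ ≫ ·) ?_)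
    refine (sub_zero _).symm.trans ?_
    exact congrArg (homSub (mulHead K.mul (T s)))
      (MonoidalPreadditive.whiskerLeft_zero (X := K.X)).symm
  | succ r ih =>
    rw [barB_succ]
    refine (congrArg (· ≫ _) ((tensorRight (T s)).map_sub)).trans ?_
    refine (homSub_comp _ _ _).trans
        (Eq.trans ?_ (comp_homSub _ _ _).symm)
    exact congrArg₂ homSub (h (r + 1)) (K.whiskerLeft_whiskerRight (T := fun _ => _) ih)

end Alg

namespace CofIdeal

variable {J : ObjectProperty C} {K A : Alg C} (I : CofIdeal J K A)

lemma mulHead_right (P : C) : I.incl ▷ (A.X ⊗ P) ≫ mulHead A.mul P =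
    mulHead I.right P ≫ I.incl ▷ P := by
  have := mulHead_naturality (m := I.right) (m' := A.mul) (x := I.incl) (y := 𝟙 A.X) (z := I.incl)
    (by rw [I.right_incl, tensorHom_id]) (𝟙 P)
  simpa using this.symm

lemma mulHead_left {P P' : C} (e : P ⟶ P') : A.X ◁ (I.incl ⊗ₘ e) ≫ mulHead A.mul P' =
    mulHead I.left P ≫ (I.incl ⊗ₘ e) := by
  have := mulHead_naturality (m := I.left) (m' := A.mul) (x := 𝟙 A.X) (y := I.incl) (z := I.incl)
    (by rw [I.left_incl, id_tensorHom]) e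
  rw [this, id_tensorHom]

/-- The words beginning with `K` are stable under `b'`, because `K` is a right ideal. -/
lemma exists_incl_barB : ∀ n, ∃ θ,
    (I.incl ▷ tpow A.X (n + 1) ≫ A.barB n : K.X ⊗ tpow A.X (n + 1) ⟶ tpow A.X (n + 1)) =
      θ ≫ I.incl ▷ tpow A.X n
  | 0 => ⟨_, (congrArg (_ ≫ ·) A.barB_zero).trans (I.mulHead_right _)⟩
  | n + 1 => ⟨homSub (X := K.X ⊗ tpow A.X (n + 2)) (Y := K.X ⊗ tpow A.X (n + 1))
      (mulHead I.right (tpow A.X (n + 1))) (K.X ◁ A.barB n), by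
      refine (congrArg (_ ≫ ·) (A.barB_succ n)).trans ((comp_homSub _ _ _).trans
        (Eq.trans ?_ (homSub_comp _ _ _).symm))
      exact congrArg₂ homSub (I.mulHead_right _) (whisker_exchange _ _).symm⟩

lemma run_mulHead (r n : ℕ) : I.run 0 (r + 2) (n + 2) ≫ mulHead A.mul (tpow A.X n) =
    mulHead K.mul (pad K.X r (tpow A.X) n) ≫ I.run 0 (r + 1) (n + 1) :=
  (mulHead_naturality I.mul_incl (I.run 0 r n)).symm

/-- For `p = 0` the first two factors are `A ⊗ K`, whose product lies in `K`; otherwise both lie in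
`A`, and the run moves one position to the left. Either way a factor `K` ends up in position `p`,
where the test cochains vanish. -/
lemma exists_run_mulHead : ∀ (p r n : ℕ), ∃ θ,
    I.run (p + 1) (r + 1) (n + 2) ≫ mulHead A.mul (tpow A.X n) = θ ≫ I.run p 1 (n + 1)
  | 0, r, n => by
      refine ⟨mulHead I.left _ ≫ K.X ◁ I.run 0 r n, ?_⟩
      refine (congrArg (· ≫ _) (I.run_succ 0 (r + 1) (n + 1))).trans ?_
      refine (I.mulHead_left (I.run 0 r n)).trans ?_
      refine Eq.trans ?_ (Category.assoc _ _ _).symm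
      exact congrArg (_ ≫ ·) ((I.run_zero_succ r n).trans
        (congrArg (_ ≫ ·) (I.run_zero_one n).symm))
  | p + 1, r, n => by
      obtain ⟨θ, hθ⟩ := I.exists_run_eq_run (p := p + 1) (r := r + 1) (p' := p + 1) (r' := 1)
        le_rfl (by lia) (n + 1)
      refine ⟨mulHead A.mul _ ≫ θ, ?_⟩
      refine Eq.trans ?_ ((congrArg (mulHead A.mul _ ≫ ·) hθ).trans (Category.assoc _ _ _).symm)
      refine (congrArg (· ≫ _) (I.run_succ (p + 1) (r + 1) (n + 1))).trans ?_
      refine (congrArg (A.X ◁ · ≫ _) (I.run_succ p (r + 1) n)).trans ?_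
      refine (mulHead_whisker A.mul (I.run p (r + 1) n)).symm.trans ?_
      exact congrArg (_ ≫ ·) (I.run_succ p (r + 1) n).symm

variable {R : C} {F : C ⥤ C}

lemma map_eq_zero_of_factors {X Y Z : C} {f : X ⟶ Z} {θ : X ⟶ Y} {g : Y ⟶ Z} (e : f = θ ≫ g)
    {u : F.obj Z ⟶ R} (h : F.map g ≫ u = 0) : F.map f ≫ u = 0 := by
  rw [e, F.map_comp, Category.assoc, h, comp_zero]

lemma map_homSub_comp (hF : F.Additive) {X Y : C} (f g : X ⟶ Y) (u : F.obj Y ⟶ R) :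
    F.map (homSub f g) ≫ u = F.map f ≫ u - F.map g ≫ u := by
  rw [homSub, F.map_sub, Preadditive.sub_comp]

/-- A face multiplying the last `K` with an `A`, or two factors `A`, keeps all `r + 1` factors `K`,
and so lands where `u` vanishes. Only the faces inside the run remain. -/
lemma map_run_zero_barB : ∀ (r n : ℕ) (F : C ⥤ C) (_ : F.Additive)
    (u : F.obj (tpow A.X (n + 1)) ⟶ R) (_ : r ≤ n + 1)
    (_ : r < n + 1 → F.map (I.run 0 (r + 1) (n + 1)) ≫ u = 0),
    F.map (I.run 0 (r + 1) (n + 2)) ≫ F.map (A.barB n) ≫ u =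
      F.map (K.runB (tpow A.X) r (n + 1)) ≫ F.map (I.run 0 r (n + 1)) ≫ u
  | 0, n, F, hF, u, hn, h2 => by
      obtain ⟨θ, hθ⟩ := I.exists_incl_barB n
      have h3 := h2 (by lia)
      rw [run_zero_one] at h3 ⊢
      refine (F.map_comp_assoc _ _ _).symm.trans ((map_eq_zero_of_factors hθ h3).trans ?_)
      exact ((congrArg (· ≫ _) (F.map_zero _ _)).trans zero_comp).symm
  | r + 1, 0, F, hF, u, hn, h2 => by
      obtain rfl : r = 0 := by lia
      refine (F.map_comp_assoc _ _ _).symm.trans (Eq.trans ?_ (F.map_comp_assoc _ _ _))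
      refine congrArg (F.map · ≫ u) ((congrArg (_ ≫ ·) A.barB_zero).trans ?_)
      refine (I.run_mulHead 0 0).trans (congrArg (· ≫ _) ?_)
      refine (sub_zero _).symm.trans ?_
      exact congrArg (homSub (mulHead K.mul (𝟙_ C)))
        (MonoidalPreadditive.whiskerLeft_zero (X := K.X)).symm
  | r + 1, n + 1, F, hF, u, hn, h2 => by
      refine (congrArg (_ ≫ F.map · ≫ u) (A.barB_succ n)).trans ?_
      refine (congrArg (_ ≫ ·) (map_homSub_comp hF _ _ _)).trans ?_
      refine (Preadditive.comp_sub _ _ _).trans (Eq.trans ?_ (map_homSub_comp hF _ _ _).symm)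
      refine congrArg₂ (· - ·) ?_ ?_
      · refine (F.map_comp_assoc _ _ _).symm.trans (Eq.trans ?_ (F.map_comp_assoc _ _ _))
        exact congrArg (F.map · ≫ u) (I.run_mulHead r (n + 1))
      · have ih := map_run_zero_barB r n (tensorLeft K.X ⋙ F) inferInstance
          (F.map (I.incl ▷ tpow A.X (n + 1)) ≫ u) (by lia) fun h =>
            (I.map_run_zero_succ F (r + 1) (n + 1) u).symm.trans (h2 (by lia))
        refine (I.map_run_zero_succ F (r + 1) (n + 2) _).trans (Eq.trans ?_
          (ih.trans (congrArg (_ ≫ ·) (I.map_run_zero_succ F r (n + 1) u).symm)))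
        refine congrArg (_ ≫ ·) ?_
        refine (F.map_comp_assoc _ _ _).symm.trans (Eq.trans ?_ (F.map_comp_assoc _ _ _))
        exact congrArg (F.map · ≫ u) (whisker_exchange _ _).symm

lemma map_run_succ (F : C ⥤ C) {R : C} (p r n : ℕ) (u : F.obj (tpow A.X (n + 1)) ⟶ R) :
    F.map (I.run (p + 1) r (n + 1)) ≫ u = (tensorLeft A.X ⋙ F).map (I.run p r n) ≫ u :=
  congrArg (F.map · ≫ u) (I.run_succ p r n)

/-- Up to words with fewer factors in `K`, the boundary `b'` on `A^{⊗ p} ⊗ K^{⊗ r + 1} ⊗ A^{⊗ s}`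
acts on the factors `K` only. -/
lemma map_run_barB : ∀ (p r n : ℕ) (F : C ⥤ C) (_ : F.Additive) (u : F.obj (tpow A.X (n + 1)) ⟶ R)
    (_ : p + r ≤ n + 1) (_ : ∀ i < p, F.map (I.run i 1 (n + 1)) ≫ u = 0)
    (_ : p + r < n + 1 → F.map (I.run p (r + 1) (n + 1)) ≫ u = 0),
    F.map (I.run p (r + 1) (n + 2)) ≫ F.map (A.barB n) ≫ u =
      (-1 : ℤ) ^ p • (F.map (padShift A.X (K.runB (tpow A.X) r) p (n + 1)) ≫
        F.map (I.run p r (n + 1)) ≫ u)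
  | 0, r, n, F, hF, u, hn, h1, h2 => by
      refine (I.map_run_zero_barB r n F hF u (by lia) fun h => h2 (by lia)).trans ?_
      rw [pow_zero, one_smul]
      rfl
  | p + 1, r, n, F, hF, u, hn, h1, h2 => by
      -- The face `0` puts a factor `K` in position `p < p + 1`, so it is killed; each factor `A` to
      -- the left thus only contributes the sign of `barB_succ`.
      have h0 : F.map (I.run (p + 1) (r + 1) (n + 2)) ≫ F.map (mulHead A.mul (tpow A.X n)) ≫ u =
          0 := by
        obtain ⟨θ, hθ⟩ := I.exists_run_mulHead p r n
        exact (F.map_comp_assoc _ _ _).symm.trans (map_eq_zero_of_factors hθ (h1 p (by lia)))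
      cases n with
      | zero =>
        obtain ⟨rfl, rfl⟩ : p = 0 ∧ r = 0 := by lia
        refine ((congrArg (_ ≫ F.map · ≫ u) A.barB_zero).trans h0).trans (Eq.symm ?_)
        have e : F.map (padShift A.X (K.runB (tpow A.X) 0) 1 1) = 0 :=
          (congrArg F.map (MonoidalPreadditive.whiskerLeft_zero (X := A.X))).trans (F.map_zero _ _)
        rw [e, zero_comp, smul_zero]
        rfl
      | succ n =>
        have ih := map_run_barB p r n (tensorLeft A.X ⋙ F) inferInstance u (by lia)
          (fun i hi => (I.map_run_succ F i 1 (n + 1) u).symm.trans (h1 (i + 1) (by lia)))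
          fun h => (I.map_run_succ F p (r + 1) (n + 1) u).symm.trans (h2 (by lia))
        refine (congrArg (_ ≫ F.map · ≫ u) (A.barB_succ n)).trans ?_
        refine (congrArg (_ ≫ ·) (map_homSub_comp hF _ _ _)).trans ?_
        refine (Preadditive.comp_sub _ _ _).trans ?_
        refine (congrArg (· - _) h0).trans ((zero_sub _).trans ?_)
        refine (congrArg Neg.neg ((I.map_run_succ F p (r + 1) (n + 2) _).trans ih)).trans ?_
        rw [pow_succ, mul_neg_one, neg_smul]
        refine congrArg (fun x => -((-1 : ℤ) ^ p • x)) (congrArg (_ ≫ ·) ?_)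
        exact (I.map_run_succ F p r (n + 1) u).symm

end CofIdeal

end

/-! ### Acyclicity of the cochains on the internal boundary of a run -/

noncomputable section

variable {C : Type u} [Category.{v} C]

lemma CochainAcyclic.of_iso [Preadditive C] {Y Y' : ℕ → C} {d : ∀ n, Y (n + 1) ⟶ Y n}
    {d' : ∀ n, Y' (n + 1) ⟶ Y' n} {R : C} (h : CochainAcyclic Y d R) (e : ∀ n, Y n ≅ Y' n)
    (comm : ∀ n, d n ≫ (e n).hom = (e (n + 1)).hom ≫ d' n) : CochainAcyclic Y' d' R := by
  refine ⟨fun c hc => ?_, fun n c hc => ?_⟩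
  · have := h.1 ((e 0).hom ≫ c) (by rw [reassoc_of% comm 0, hc, comp_zero])
    rwa [Preadditive.IsIso.comp_left_eq_zero] at this
  · obtain ⟨z, hz⟩ := h.2 n ((e (n + 1)).hom ≫ c) (by rw [reassoc_of% comm (n + 1), hc, comp_zero])
    refine ⟨(e n).inv ≫ z, ?_⟩
    rw [← cancel_epi (e (n + 1)).hom, ← reassoc_of% comm n, Iso.hom_inv_id_assoc, hz]

variable [MonoidalCategory C] [SymmetricCategory C] [Preadditive C] [MonoidalPreadditive C]

lemma padShift_zero (X : C) {T T' : ℕ → C} :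
    ∀ p n, padShift X (fun n => (0 : T (n + 1) ⟶ T' n)) p n = 0
  | 0, _ => rfl
  | _ + 1, 0 => rfl
  | p + 1, n + 1 => (congrArg (X ◁ ·) (padShift_zero X p n)).trans
      (MonoidalPreadditive.whiskerLeft_zero (X := X))

lemma tensorHom_eq_zero_left {X X' Y Y' Z Z' : C} {f : X ⟶ Y} {g : Y ⟶ Z} (h : f ≫ g = 0)
    (f' : X' ⟶ Y') (g' : Y' ⟶ Z') : (f ⊗ₘ f') ≫ (g ⊗ₘ g') = 0 := by
  rw [tensorHom_comp_tensorHom, h, MonoidalPreadditive.zero_tensor]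

lemma tensorHom_eq_zero_right {X X' Y Y' Z Z' : C} {f' : X' ⟶ Y'} {g' : Y' ⟶ Z'}
    (h : f' ≫ g' = 0) (f : X ⟶ Y) (g : Y ⟶ Z) : (f ⊗ₘ f') ≫ (g ⊗ₘ g') = 0 := by
  rw [tensorHom_comp_tensorHom, h, MonoidalPreadditive.tensor_zero]

namespace Alg

/-- The cochains on `V ⊗ C^{bar} K` with values in `R` are acyclic for all `V`. -/
def IsBarAcyclic (K : Alg C) (R : C) : Prop :=
  ∀ V : C, CochainAcyclic (fun n => V ⊗ tpow K.X (n + 1)) (fun n => V ◁ K.barB n) R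

variable {K A : Alg C} {R : C}

lemma IsBarAcyclic.of_functor (hK : K.IsBarAcyclic R) {F : C ⥤ C} (hF : IsTensorFunctor F) :
    CochainAcyclic (fun n => F.obj (tpow K.X (n + 1))) (fun n => F.map (K.barB n)) R := by
  obtain ⟨V, ⟨e⟩⟩ := hF
  exact (hK V).of_iso (fun n => e.app _) fun n => e.hom.naturality _

/-- Here the freedom of choosing `V` is used: it absorbs both `F` and the tail `T s`. -/
lemma IsBarAcyclic.pad (hK : K.IsBarAcyclic R) {F : C ⥤ C} (hF : IsTensorFunctor F) (T : ℕ → C)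
    (s : ℕ) :
    CochainAcyclic (fun r => F.obj (pad K.X (r + 1) T (s + r + 1)))
      (fun r => F.map (K.runB T (r + 1) (s + r + 1))) R :=
  (hK.of_functor (hF.right (T s))).of_iso (fun r => F.mapIso (K.padIso T s (r + 1))) fun r =>
    (F.map_comp _ _).symm.trans ((congrArg F.map (K.padIso_naturality T s r)).trans
      (F.map_comp _ _))

lemma IsBarAcyclic.eq_zero (hK : K.IsBarAcyclic R) (X : C) (T : ℕ → C) : ∀ (p n : ℕ)
    (_ : p + 1 ≤ n) {F : C ⥤ C} (_ : IsTensorFunctor F)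
    (c : F.obj (Wodzicki.pad X p (Wodzicki.pad K.X 1 T) n) ⟶ R)
    (_ : F.map (padShift X (K.runB T 1) p n) ≫ c = 0), c = 0
  | 0, n, hn, F, hF, c, hc => by
      obtain ⟨s, rfl⟩ := Nat.exists_eq_add_of_le' hn
      exact (hK.pad hF T s).1 c hc
  | _ + 1, 0, hn, _, _, _, _ => absurd hn (by lia)
  | p + 1, n + 1, hn, F, hF, c, hc => hK.eq_zero X T p n (by lia) (hF.left X) c hc

lemma IsBarAcyclic.exists_eq (hK : K.IsBarAcyclic R) (X : C) (T : ℕ → C) : ∀ (p r n : ℕ)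
    (_ : p + r + 1 ≤ n) {F : C ⥤ C} (_ : IsTensorFunctor F)
    (c : F.obj (Wodzicki.pad X p (Wodzicki.pad K.X (r + 2) T) (n + 1)) ⟶ R)
    (_ : F.map (padShift X (K.runB T (r + 2)) p (n + 1)) ≫ c = 0),
    ∃ e : F.obj (Wodzicki.pad X p (Wodzicki.pad K.X (r + 1) T) n) ⟶ R,
      F.map (padShift X (K.runB T (r + 1)) p n) ≫ e = c
  | 0, r, n, hn, F, hF, c, hc => by
      obtain ⟨s, rfl⟩ : ∃ s, n = s + r + 1 := ⟨n - r - 1, by lia⟩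
      exact (hK.pad hF T s).2 r c hc
  | _ + 1, _, 0, hn, _, _, _, _ => absurd hn (by lia)
  | p + 1, r, n + 1, hn, F, hF, c, hc => hK.exists_eq X T p r n (by lia) (hF.left X) c hc

end Alg

namespace CofIdeal

variable {J : ObjectProperty C} {K A : Alg C} (I : CofIdeal J K A) [HasFiniteColimits C]

/-- The boundary `b'` on the factors `K` of `A^{⊗ p} ⊗ K^{⊗ r + 1} ⊗ A^{⊗ s}`. -/
def runD (p r n : ℕ) : I.runMap p (r + 1) (n + 1) ⟶ I.runMap p r n :=
  padShift A.X (K.runB (tpow A.X) r) p n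

lemma runD_runπ (p r n : ℕ) : I.runD p r n ≫ I.runπ p r n =
      I.runπ p (r + 1) (n + 1) ≫ padShift I.quot (K.runB I.tailX r) p n :=
  padShift_padMap _ _ _ _ _ (fun n => K.runB_naturality I.tailπ r n) p n

lemma incl_π : I.incl ≫ I.π = 0 := cokernel.condition I.incl

/-- The factor `K` in position `i` meets the quotient `A / K`. This and `run_succ_powπ` give the
vanishing of the cochains pulled back along `powπ`. -/
lemma run_one_powπ : ∀ (p i r n : ℕ), i < p → i < n → I.run i 1 n ≫ I.powπ p r n = 0
  | 0, _, _, _, h, _ => absurd h (by lia)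
  | _ + 1, _, _, 0, _, h => absurd h (by lia)
  | _ + 1, 0, _, _ + 1, _, _ => tensorHom_eq_zero_left I.incl_π _ _
  | p + 1, i + 1, r, n + 1, h, h' =>
      tensorHom_eq_zero_right (run_one_powπ p i r n (by lia) (by lia)) _ _

lemma run_succ_powπ : ∀ (p r n : ℕ), p + r < n → I.run p (r + 1) n ≫ I.powπ p r n = 0
  | 0, _, 0, h => absurd h (by lia)
  | 0, 0, n + 1, _ => by
      refine (congrArg (· ≫ I.π ▷ tpow A.X n) (I.run_zero_one n)).trans ?_
      exact (comp_whiskerRight _ _ _).symm.trans ((congrArg (· ▷ tpow A.X n) I.incl_π).trans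
        MonoidalPreadditive.zero_whiskerRight)
  | 0, r + 1, n + 1, h => tensorHom_eq_zero_right (run_succ_powπ 0 r n (by lia)) _ _
  | _ + 1, _, 0, h => absurd h (by lia)
  | p + 1, r, n + 1, h => tensorHom_eq_zero_right (run_succ_powπ p r n (by lia)) _ _

end CofIdeal

/-- The boundary `b'` (for `z = 0`) or `b`, for `z n = (-1) ^ (n + 1)`. -/
def Alg.faceSum (A : Alg C) (z : ℕ → ℤ) (n : ℕ) : tpow A.X (n + 2) ⟶ tpow A.X (n + 1) :=
  A.barB n + z n • (rotPow A.X (n + 1) ≫ A.mulAt n 0)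

lemma Alg.faceSum_zero (A : Alg C) (n : ℕ) : A.faceSum 0 n = A.barB n := by
  rw [faceSum, Pi.zero_apply, zero_smul, add_zero]

/-! ### Killing relative cocycles position by position -/

namespace CofIdeal

variable {J : ObjectProperty C} {K A : Alg C} (I : CofIdeal J K A) [HasFiniteColimits C] {R : C}

lemma comp_eq_zero_of_factors {X Y Z : C} {f : X ⟶ Z} {g : Y ⟶ Z} (e : ∃ θ, f = θ ≫ g)
    {u : Z ⟶ R} (h : g ≫ u = 0) : f ≫ u = 0 := by
  obtain ⟨θ, rfl⟩ := e
  rw [Category.assoc, h, comp_zero]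

/-- If the last factor is outside the run, the cyclic face preserves all `r + 1` factors `K` and
`h2` applies. If it is inside and `p > 0`, the product in position `0` lies in `K` and `h1` applies.
The remaining case is the full tensor power of `K`, covered by `h3`. -/
lemma run_rot_face_comp {p r n : ℕ} (u : tpow A.X (n + 1) ⟶ R) (hn : p + r ≤ n + 1)
    (h1 : ∀ i < p, I.run i 1 (n + 1) ≫ u = 0)
    (h2 : p + r < n + 1 → I.run p (r + 1) (n + 1) ≫ u = 0)
    (h3 : p = 0 → r = n + 1 → I.run 0 (n + 1) (n + 1) ≫ u = 0) :
    (I.run p (r + 1) (n + 2) ≫ rotPow A.X (n + 1) ≫ A.mulAt n 0) ≫ u = 0 := by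
  by_cases hr : p + r < n + 1
  · exact comp_eq_zero_of_factors (I.exists_run_rot_face fun j _ _ _ => by lia) (h2 hr)
  · by_cases hp : p = 0
    · subst hp
      exact comp_eq_zero_of_factors (I.exists_run_rot_face fun j _ _ _ => by lia)
        (h3 rfl (by lia))
    · exact comp_eq_zero_of_factors (I.exists_run_rot_face fun j _ _ _ => by lia)
        (h1 0 (by lia))

lemma run_faceSum (z : ℕ → ℤ) {p r n : ℕ} (u : tpow A.X (n + 1) ⟶ R) (hn : p + r ≤ n + 1)
    (h1 : ∀ i < p, I.run i 1 (n + 1) ≫ u = 0)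
    (h2 : p + r < n + 1 → I.run p (r + 1) (n + 1) ≫ u = 0)
    (h3 : p = 0 → r = n + 1 → I.run 0 (n + 1) (n + 1) ≫ u = 0) :
    I.run p (r + 1) (n + 2) ≫ A.faceSum z n ≫ u =
      (-1 : ℤ) ^ p • (I.runD p r (n + 1) ≫ I.run p r (n + 1) ≫ u) := by
  have h := I.map_run_barB p r n (𝟭 C) inferInstance u hn h1 h2
  have h' := I.run_rot_face_comp u hn h1 h2 h3
  rw [Category.assoc] at h'
  rw [Alg.faceSum, Preadditive.add_comp, Preadditive.comp_add, Preadditive.zsmul_comp,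
    Preadditive.comp_zsmul, h', smul_zero, add_zero]
  exact h

/-- The coboundary of a cochain vanishing on the words with a factor `K` in a position `< p`
has the same property. -/
lemma run_one_faceSum (z : ℕ → ℤ) {p n : ℕ} (u : tpow A.X (n + 1) ⟶ R) (hp : p ≤ n + 1)
    (h1 : ∀ i < p, I.run i 1 (n + 1) ≫ u = 0) (i : ℕ) (hi : i < p) :
    I.run i 1 (n + 2) ≫ A.faceSum z n ≫ u = 0 := by
  rw [I.run_faceSum z u (by lia) (fun j hj => h1 j (by lia)) (fun _ => h1 i hi)
    (fun _ h => by lia)]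
  -- A run with a single factor `K` has no internal face.
  have e : I.runD i 0 (n + 1) = 0 := padShift_zero A.X i (n + 1)
  rw [e, zero_comp, smul_zero]

/-- On the run of length `r + 1` the cochain descends to the quotient by `A / K` outside the run,
where it is a cocycle for `b'` of `K`. Acyclicity provides a primitive there, and relative
injectivity extends it to `A^{⊗ m + 1}`. The hypothesis `hpr` excludes the full tensor power of `K`,
where relative cochains vanish by definition and nothing may be altered. -/
lemma exists_faceSum_step (hJ : IsTensorProduct J) (hR : IsRelInjective J R)
    (hK : K.IsBarAcyclic R) (z : ℕ → ℤ) {p r m : ℕ} (u : tpow A.X (m + 2) ⟶ R)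
    (hu : ∀ i < m + 3, I.run i 1 (m + 3) ≫ A.faceSum z (m + 1) ≫ u = 0)
    (hr : p + (r + 1) ≤ m + 2) (hpr : p = 0 → r ≠ m + 1)
    (h1 : ∀ i < p, I.run i 1 (m + 2) ≫ u = 0)
    (h2 : p + (r + 1) < m + 2 → I.run p (r + 2) (m + 2) ≫ u = 0) :
    ∃ v : tpow A.X (m + 1) ⟶ R, I.run 0 (m + 1) (m + 1) ≫ v = 0 ∧
      (∀ i < p, I.run i 1 (m + 2) ≫ (u - A.faceSum z m ≫ v) = 0) ∧
      I.run p (r + 1) (m + 2) ≫ (u - A.faceSum z m ≫ v) = 0 := by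
  obtain ⟨c, hc⟩ : ∃ c, I.run p (r + 1) (m + 2) ≫ u = I.runπ p (r + 1) (m + 2) ≫ c :=
    I.exists_runπ_comp hJ p (r + 1) (m + 2) (𝟭 C) isTensorFunctor_id u hr h1 h2
  have hc0 : padShift I.quot (K.runB I.tailX (r + 1)) p (m + 2) ≫ c = 0 := by
    have : Epi (I.runπ p (r + 2) (m + 3)) := I.isTensorEpi_runπ hJ p (r + 2) (m + 3) _
      isTensorFunctor_id
    rw [← cancel_epi (I.runπ p (r + 2) (m + 3)), comp_zero, ← Category.assoc, ← runD_runπ,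
      Category.assoc, ← hc]
    have h := I.run_faceSum z u hr h1 h2 (fun h h' => absurd h' (by have := hpr h; lia))
    -- The coboundary of `u` vanishes on words with a `K` in position `p`, in particular on the run
    -- of length `r + 2`; by `run_faceSum` this is the cocycle condition for `c` up to a sign.
    rw [comp_eq_zero_of_factors (I.exists_run_eq_run le_rfl (by lia) _) (hu p (by lia))] at h
    have h' := congrArg ((-1 : ℤ) ^ p • ·) h
    simp only [smul_zero, smul_smul, ← mul_pow] at h'
    simpa using h'.symm
  cases r with
  | zero =>
    -- For a single factor `K` this is the lowest degree of the bar complex, where a cocycle is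
    -- zero: no correction is needed.
    obtain rfl := hK.eq_zero I.quot I.tailX p (m + 2) (by lia) isTensorFunctor_id c hc0
    refine ⟨0, by simp, fun i hi => by simp [h1 i hi], ?_⟩
    rw [comp_zero, sub_zero, hc, comp_zero]
  | succ r =>
    obtain ⟨e, he⟩ : ∃ e, padShift I.quot (K.runB I.tailX (r + 1)) p (m + 1) ≫ e = c :=
      hK.exists_eq I.quot I.tailX p r (m + 1) (by lia) isTensorFunctor_id c hc0
    -- Extend the primitive from `K^{⊗ r + 1}` to `A^{⊗ r + 1}`, the outer factors remaining
    -- quotients.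
    obtain ⟨w, hw⟩ := hR _ (I.isCofibration_runCof hJ p (r + 1) (m + 1)) e
    simp only at hw
    have hv1 : ∀ i < p, I.run i 1 (m + 1) ≫ I.powπ p (r + 1) (m + 1) ≫ w = 0 := fun i hi => by
      rw [← Category.assoc, I.run_one_powπ p i (r + 1) (m + 1) hi (by lia), zero_comp]
    have hv2 (h : p + (r + 1) < m + 1) :
        I.run p (r + 2) (m + 1) ≫ I.powπ p (r + 1) (m + 1) ≫ w = 0 := by
      rw [← Category.assoc, I.run_succ_powπ p (r + 1) (m + 1) h, zero_comp]
    have hv3 : I.run 0 (m + 1) (m + 1) ≫ I.powπ p (r + 1) (m + 1) ≫ w = 0 := by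
      by_cases hp : p = 0
      · subst hp
        have := hpr rfl
        exact comp_eq_zero_of_factors (I.exists_run_eq_run le_rfl (by lia) _) (hv2 (by lia))
      · exact comp_eq_zero_of_factors (I.exists_run_eq_run le_rfl (by lia) _) (hv1 0 (by lia))
    have hv4 : I.run p (r + 2) (m + 2) ≫ A.faceSum z m ≫ I.powπ p (r + 1) (m + 1) ≫ w =
        (-1 : ℤ) ^ p • (I.run p (r + 2) (m + 2) ≫ u) := by
      rw [I.run_faceSum z _ (by lia) hv1 hv2 fun _ _ => hv3]
      congr 1
      rw [← Category.assoc (I.run p (r + 1) (m + 1)), run_powπ, Category.assoc, hw,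
        ← Category.assoc, runD_runπ, Category.assoc, he, hc]
    -- The sign cancels the one that the boundary acquires from the `p` factors `A` before the run.
    refine ⟨(-1 : ℤ) ^ p • (I.powπ p (r + 1) (m + 1) ≫ w), ?_, fun i hi => ?_, ?_⟩
    · rw [Preadditive.comp_zsmul, hv3, smul_zero]
    · rw [Preadditive.comp_sub, h1 i hi, Preadditive.comp_zsmul, Preadditive.comp_zsmul,
        I.run_one_faceSum z _ (by lia) hv1 i hi, smul_zero, sub_zero]
    · rw [Preadditive.comp_sub, Preadditive.comp_zsmul, Preadditive.comp_zsmul, hv4, smul_smul,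
        ← mul_pow, neg_one_mul, neg_neg, one_pow, one_smul, sub_self]

variable {z : ℕ → ℤ}

/-- Cochains modulo coboundaries of cochains vanishing on the tensor powers of `K`. -/
lemma exists_faceSum_run (hJ : IsTensorProduct J) (hR : IsRelInjective J R)
    (hK : K.IsBarAcyclic R) (hz : ∀ n, A.faceSum z (n + 1) ≫ A.faceSum z n = 0) {p m : ℕ}
    (hp : p < m + 2) : ∀ (r : ℕ) (u : tpow A.X (m + 2) ⟶ R)
    (_ : ∀ i < m + 3, I.run i 1 (m + 3) ≫ A.faceSum z (m + 1) ≫ u = 0)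
    (_ : p + r ≤ m + 2) (_ : p = 0 → r ≠ m + 2)
    (_ : ∀ i < p, I.run i 1 (m + 2) ≫ u = 0)
    (_ : p + r < m + 2 → I.run p (r + 1) (m + 2) ≫ u = 0),
    ∃ v : tpow A.X (m + 1) ⟶ R, I.run 0 (m + 1) (m + 1) ≫ v = 0 ∧
      ∀ i < p + 1, I.run i 1 (m + 2) ≫ (u - A.faceSum z m ≫ v) = 0
  | 0, u, _, _, _, h1, h2 => ⟨0, by simp, fun i hi => by
      rw [comp_zero, sub_zero]
      rcases Nat.lt_succ_iff_lt_or_eq.1 hi with h | rfl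
      · exact h1 i h
      · exact h2 (by lia)⟩
  | r + 1, u, hu, hr, hpr, h1, h2 => by
      obtain ⟨v, hv, hv1, hv2⟩ := I.exists_faceSum_step hJ hR hK z u hu hr
        (fun h => by have := hpr h; lia) h1 h2
      -- Subtracting a coboundary preserves the cocycle condition by `hz`, and `hv2` is the
      -- vanishing hypothesis for the next shorter run.
      obtain ⟨w, hw, hw1⟩ := exists_faceSum_run hJ hR hK hz hp r (u - A.faceSum z m ≫ v)
        (fun i hi => by
          rw [Preadditive.comp_sub, ← Category.assoc (A.faceSum z (m + 1)), hz, zero_comp,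
            sub_zero, hu i hi]) (by lia) (fun h => by lia) hv1 fun _ => hv2
      refine ⟨v + w, by rw [Preadditive.comp_add, hv, hw, add_zero], fun i hi => ?_⟩
      rw [Preadditive.comp_add, ← sub_sub]
      exact hw1 i hi

/-- For position `0` the descent starts from the full power of `K`, on which `u` vanishes by `h0`.
For a later position it starts from the run reaching the end of the word, where the tail is empty
and no vanishing is required. -/
lemma exists_faceSum (hJ : IsTensorProduct J) (hR : IsRelInjective J R)
    (hK : K.IsBarAcyclic R) (hz : ∀ n, A.faceSum z (n + 1) ≫ A.faceSum z n = 0) {m : ℕ}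
    (u : tpow A.X (m + 2) ⟶ R)
    (hu : ∀ i < m + 3, I.run i 1 (m + 3) ≫ A.faceSum z (m + 1) ≫ u = 0)
    (h0 : I.run 0 (m + 2) (m + 2) ≫ u = 0) : ∀ p ≤ m + 2,
    ∃ v : tpow A.X (m + 1) ⟶ R, I.run 0 (m + 1) (m + 1) ≫ v = 0 ∧
      ∀ i < p, I.run i 1 (m + 2) ≫ (u - A.faceSum z m ≫ v) = 0
  | 0, _ => ⟨0, by simp, fun i hi => absurd hi (by lia)⟩
  | 1, _ => I.exists_faceSum_run hJ hR hK hz (p := 0) (by lia) (m + 1) u hu (by lia)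
      (fun _ => by lia) (fun i hi => absurd hi (by lia)) fun _ => h0
  | p + 2, hp => by
      obtain ⟨v, hv, hv1⟩ := exists_faceSum hJ hR hK hz u hu h0 (p + 1) (by lia)
      obtain ⟨w, hw, hw1⟩ := I.exists_faceSum_run hJ hR hK hz (p := p + 1) (by lia)
        (m + 1 - p) (u - A.faceSum z m ≫ v)
        (fun i hi => by
          rw [Preadditive.comp_sub, ← Category.assoc (A.faceSum z (m + 1)), hz, zero_comp,
            sub_zero, hu i hi]) (by lia) (by lia) hv1 (fun h => absurd h (by lia))
      refine ⟨v + w, by rw [Preadditive.comp_add, hv, hw, add_zero], fun i hi => ?_⟩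
      rw [Preadditive.comp_add, ← sub_sub]
      exact hw1 i hi

end CofIdeal

end

/-! ### Extending cochains from `Cₙ(K : A)` to `A^{⊗ n + 1}` -/

noncomputable section

variable {C : Type u} [Category.{v} C] [MonoidalCategory C] [SymmetricCategory C] [Preadditive C]
  [MonoidalPreadditive C] [HasFiniteColimits C]

namespace CofIdeal

variable {J : ObjectProperty C} {K A : Alg C} (I : CofIdeal J K A) {R : C}

lemma tensMap_cof (hJ : IsTensorProduct J) : ∀ {n : ℕ} {X Y : Fin n → C} {f : ∀ i, X i ⟶ Y i},
    (∀ i, IsCofibration J (f i)) → IsCofibration J (tensMap f)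
  | 0, _, _, _, _ => isCofibration_id _
  | _ + 1, _, _, _, h => (h 0).tensorHom hJ (tensMap_cof hJ fun i => h i.succ)

lemma word_cof (hJ : IsTensorProduct J) {n : ℕ} (f : Fin n → Bool) :
    IsCofibration J (I.word f) :=
  tensMap_cof hJ fun j => match f j with
    | false => I.cof
    | true => isCofibration_id _

lemma Ymap_word {n : ℕ} {f g : Fin n → Bool} (h : f ≤ g) :
    tensMap (fun j => I.Ymap (h j)) ≫ I.word g = I.word f := by
  rw [word, ← tensMap_comp]
  simp only [Ymap_y]
  rfl

lemma cons_ne {n : ℕ} {g : Fin n → Bool} (hg : g ≠ fun _ => true) (b : Bool) :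
    (Fin.cons b g : Fin (n + 1) → Bool) ≠ fun _ => true := fun h =>
  hg (funext fun j => congrFun h j.succ)

lemma cons_false_ne {n : ℕ} (g : Fin n → Bool) :
    (Fin.cons false g : Fin (n + 1) → Bool) ≠ fun _ => true := fun h =>
  Bool.noConfusion (congrFun h 0)

lemma tensMap_Ymap_refl {n : ℕ} (g : Fin n → Bool) (h : g ≤ g) :
    tensMap (fun j => I.Ymap (h j)) = 𝟙 (tens fun j => I.Y (g j)) := by
  refine Eq.trans ?_ (tensMap_id _)
  congr 1
  funext j
  exact I.Ymap_rfl _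

lemma cons_le {n : ℕ} {f g : Fin n → Bool} (h : f ≤ g) {a b : Bool} (hab : a ≤ b) :
    (Fin.cons a f : Fin (n + 1) → Bool) ≤ Fin.cons b g := fun j => by
  cases j using Fin.cases with
  | zero => exact hab
  | succ j => exact h j

lemma exists_cons {n : ℕ} (f : Fin (n + 1) → Bool) : ∃ b g, f = Fin.cons b g :=
  ⟨f 0, fun j => f j.succ, (Fin.cons_self_tail f).symm⟩

lemma map_word_cons_true (F : C ⥤ C) {n : ℕ} (g : Fin n → Bool)
    (U : F.obj (I.quot ⊗ tpow A.X n) ⟶ R) :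
    F.map (I.word (Fin.cons true g)) ≫ F.map (I.π ▷ tpow A.X n) ≫ U =
      F.map (I.π ▷ tens fun j => I.Y (g j)) ≫ F.map (I.quot ◁ I.word g) ≫ U := by
  refine (F.map_comp_assoc _ _ _).symm.trans (Eq.trans ?_ (F.map_comp_assoc _ _ _))
  refine congrArg (F.map · ≫ U) ?_
  have h : I.word (Fin.cons true g) = A.X ◁ I.word g := id_tensorHom _ _
  exact (congrArg (· ≫ I.π ▷ tpow A.X n) h).trans (whisker_exchange _ _)

lemma map_word_cons_false (F : C ⥤ C) (hF : F.Additive) {n : ℕ} (g : Fin n → Bool)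
    (U : F.obj (I.quot ⊗ tpow A.X n) ⟶ R) :
    F.map (I.word (Fin.cons false g)) ≫ F.map (I.π ▷ tpow A.X n) ≫ U = 0 := by
  refine (F.map_comp_assoc _ _ _).symm.trans ?_
  have h : I.word (Fin.cons false g) ≫ I.π ▷ tpow A.X n = 0 := by
    refine (congrArg (_ ≫ ·) (tensorHom_id I.π _).symm).trans ?_
    exact tensorHom_eq_zero_left I.incl_π _ _
  exact (congrArg (F.map · ≫ U) h).trans (by rw [F.map_zero, zero_comp])

/-- Compatible maps on the words extend to `A^{⊗ n}`. -/
lemma exists_map_word_comp (hJ : IsTensorProduct J) (hR : IsRelInjective J R) :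
    ∀ (n : ℕ) (F : C ⥤ C) (_ : IsTensorFunctor F)
    (u : ∀ f : Fin n → Bool, (f ≠ fun _ => true) → (F.obj (tens fun j => I.Y (f j)) ⟶ R))
    (_ : ∀ (f g : Fin n → Bool) hf hg (h : f ≤ g),
      F.map (tensMap fun j => I.Ymap (h j)) ≫ u g hg = u f hf),
    ∃ U : F.obj (tpow A.X n) ⟶ R, ∀ f hf, F.map (I.word f) ≫ U = u f hf
  | 0, F, hF, u, hu => ⟨0, fun f hf => absurd (funext fun j => j.elim0) hf⟩
  | n + 1, F, hF, u, hu => by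
      have hF' := hF.additive
      -- First extend the component on `K ⊗ A^{⊗ n}` along a cofibration. It determines the
      -- components on all words beginning with `K`, so after subtracting `w` these become zero.
      obtain ⟨w, hw⟩ : ∃ w : F.obj (tpow A.X (n + 1)) ⟶ R,
          F.map (I.word (Fin.cons false fun _ : Fin n => true)) ≫ w = u _ (cons_false_ne _) :=
        hR _ (hF.cof hJ (I.word_cof hJ (Fin.cons false fun _ : Fin n => true))) _
      obtain ⟨u', hu'⟩ : ∃ u' : ∀ f : Fin (n + 1) → Bool, (f ≠ fun _ => true) →
          (F.obj (tens fun j => I.Y (f j)) ⟶ R),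
          ∀ f hf, u' f hf = u f hf - F.map (I.word f) ≫ w := ⟨_, fun _ _ => rfl⟩
      have hc : ∀ (f g : Fin (n + 1) → Bool) hf hg (h : f ≤ g),
          F.map (tensMap fun j => I.Ymap (h j)) ≫ u' g hg = u' f hf :=
          fun f g hf hg (h : f ≤ g) => by
        rw [hu', hu', Preadditive.comp_sub, hu f g hf hg h, ← F.map_comp_assoc, Ymap_word]
      have h0 (g : Fin n → Bool) : u' (Fin.cons false g) (cons_false_ne g) = 0 := by
        rw [hu', ← hu _ _ (cons_false_ne g) (cons_false_ne _)
          (cons_le (fun j => Bool.le_true (g j)) le_rfl), ← hw, ← F.map_comp_assoc, Ymap_word,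
          sub_self]
      -- The corrected components on words beginning with `A` vanish when that letter is replaced by
      -- `K`, so they descend to `A / K`. The resulting family on words of length `n` is treated by
      -- induction, with `A / K` absorbed into `F`.
      have h1 (g : Fin n → Bool) (hg : g ≠ fun _ => true) :
          ∃ v : F.obj (I.quot ⊗ tens fun j => I.Y (g j)) ⟶ R,
            F.map (I.π ▷ _) ≫ v = u' (Fin.cons true g) (cons_ne hg true) := by
        refine I.exists_desc hJ hF _ ?_
        refine Eq.trans ?_ ((hc _ _ (cons_false_ne g) (cons_ne hg true)
          (cons_le le_rfl (Bool.false_le true))).trans (h0 g))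
        refine congrArg (F.map · ≫ _) ?_
        refine (tensorHom_id _ _).symm.trans ?_
        exact congrArg (I.incl ⊗ₘ ·) (I.tensMap_Ymap_refl g le_rfl).symm
      choose v hv using h1
      obtain ⟨U, hU⟩ := exists_map_word_comp hJ hR n (tensorLeft I.quot ⋙ F) (hF.left I.quot) v
        fun f g hf hg h => by
          have := I.epi_π hJ hF (tens fun j => I.Y (f j))
          rw [← cancel_epi (F.map (I.π ▷ tens fun j => I.Y (f j))), hv,
            ← hc _ _ _ (cons_ne hg true) (cons_le h le_rfl), ← hv]
          refine (F.map_comp_assoc _ _ _).symm.trans (Eq.trans ?_ (F.map_comp_assoc _ _ _))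
          refine congrArg (F.map · ≫ _) ?_
          refine (whisker_exchange _ _).symm.trans (congrArg (· ≫ _) ?_)
          exact (id_tensorHom _ _).symm
      obtain ⟨U', hU'⟩ : ∃ U' : F.obj (tpow A.X (n + 1)) ⟶ R,
          U' = F.map (I.π ▷ tpow A.X n) ≫ U := ⟨_, rfl⟩
      refine ⟨w + U', fun f hf => ?_⟩
      obtain ⟨b, g, rfl⟩ := exists_cons f
      rw [Preadditive.comp_add, ← eq_sub_iff_add_eq', ← hu', hU']
      cases b with
      | false => exact (I.map_word_cons_false F hF' g U).trans (h0 g).symm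
      | true =>
        have hg : g ≠ fun _ => true := fun h => hf (by
          subst h
          funext j
          cases j using Fin.cases <;> rfl)
        refine (I.map_word_cons_true F g U).trans (Eq.trans ?_ (hv g hg))
        exact congrArg (_ ≫ ·) (hU g hg)

variable [HasBinaryBiproducts C]

/-- The natural map `C_n(K : A) ⟶ C_n(A)`. -/
def relWord (n : ℕ) : I.relX n ⟶ tpow A.X (n + 1) :=
  I.desc (fun f _ => I.word f) fun _ _ _ _ h => I.Ymap_word h

/-- The natural map `C_n(K) ⟶ C_n(K : A)`. -/
def relIncl (n : ℕ) : tpow K.X (n + 1) ⟶ I.relX n := I.ι (fun _ => false) (zero_ne n)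

lemma ι_relWord {n : ℕ} (f : Fin (n + 1) → Bool) (hf : f ≠ fun _ => true) :
    I.ι f hf ≫ I.relWord n = I.word f := I.ι_desc _ _ f hf

lemma relFace_relWord (n : ℕ) (i : Fin (n + 1)) :
    I.relFace n i ≫ I.relWord n = I.relWord (n + 1) ≫ A.mulAt n i :=
  I.relX_ext fun f hf => by
    rw [reassoc_of% I.ι_relFace i f hf, ι_relWord, ← Category.assoc, ι_relWord, word_mulAt]

lemma relRot_relWord (n : ℕ) : I.relRot n ≫ I.relWord n = I.relWord n ≫ rotPow A.X n :=
  I.relX_ext fun f hf => by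
    rw [reassoc_of% I.ι_relRot f hf, ι_relWord, ← Category.assoc, ι_relWord, word_rot]

/-- The natural map `C_*(K : A) ⟶ C_*(A)`. -/
def toAlg : I.cyc ⟶ A.cyc where
  app := I.relWord
  face_app := I.relFace_relWord
  rot_app := I.relRot_relWord

/-- This replaces cochains on the colimit by cochains on `A^{⊗ n + 1}`, so the colimit itself need
not be analysed. -/
lemma exists_relWord_comp (hJ : IsTensorProduct J) (hR : IsRelInjective J R) {n : ℕ}
    (u : I.relX n ⟶ R) : ∃ U : tpow A.X (n + 1) ⟶ R, I.relWord n ≫ U = u := by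
  obtain ⟨U, hU⟩ : ∃ U : tpow A.X (n + 1) ⟶ R, ∀ f hf, I.word f ≫ U = I.ι f hf ≫ u :=
    I.exists_map_word_comp hJ hR (n + 1) (𝟭 C) isTensorFunctor_id
    (fun f hf => I.ι f hf ≫ u) fun f g hf hg h => by
      refine (Category.assoc _ _ _).symm.trans (congrArg (· ≫ u) (I.w hf hg h))
  refine ⟨U, I.relX_ext fun f hf => ?_⟩
  rw [← Category.assoc, ι_relWord, hU]

lemma relIncl_relWord (n : ℕ) : I.relIncl n ≫ I.relWord n =
    I.word fun _ => false := I.ι_relWord _ _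

/-- Every word other than the constant one has a letter `K` in some position `i`, so it factors
through the run of length `1` at `i`. -/
lemma relWord_comp_eq_zero_iff {n : ℕ} (U : tpow A.X (n + 1) ⟶ R) :
    I.relWord n ≫ U = 0 ↔ ∀ i < n + 1, I.run i 1 (n + 1) ≫ U = 0 := by
  constructor
  · intro h i hi
    obtain ⟨θ, hθ⟩ := I.exists_run_eq_word i 1 (n := n + 1)
      (fun j => decide ((j : ℕ) < i ∨ i + 1 ≤ j)) fun j hj => by simpa using hj
    have hf : (fun j : Fin (n + 1) => decide ((j : ℕ) < i ∨ i + 1 ≤ j)) ≠ fun _ => true :=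
      fun h => by simpa using congrFun h ⟨i, hi⟩
    rw [← I.ι_relWord _ hf] at hθ
    rw [hθ, Category.assoc, Category.assoc, h, comp_zero, comp_zero]
  · intro h
    refine I.relX_ext fun f hf => ?_
    obtain ⟨j, hj⟩ : ∃ j, f j = false := by
      by_contra! hc
      exact hf (funext fun j => by simpa using hc j)
    rw [comp_zero, ← Category.assoc, ι_relWord]
    refine comp_eq_zero_of_factors (I.exists_word_eq_run j 1 f fun j' h1 h2 => ?_) (h j j.2)
    obtain rfl : j' = j := Fin.ext (by lia)
    exact hj

lemma relIncl_relWord_comp_eq_zero_iff {n : ℕ} (U : tpow A.X (n + 1) ⟶ R) :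
    I.relIncl n ≫ I.relWord n ≫ U = 0 ↔ I.run 0 (n + 1) (n + 1) ≫ U = 0 := by
  rw [← Category.assoc, relIncl_relWord]
  exact ⟨comp_eq_zero_of_factors (I.exists_run_eq_word 0 (n + 1) _ fun j hj => by lia),
    comp_eq_zero_of_factors (I.exists_word_eq_run 0 (n + 1) _ fun j _ _ => rfl)⟩

lemma exists_relIncl_comp (hJ : IsTensorProduct J) (hR : IsRelInjective J R) {n : ℕ}
    (u : tpow K.X (n + 1) ⟶ R) : ∃ U : I.relX n ⟶ R, I.relIncl n ≫ U = u := by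
  obtain ⟨w, hw⟩ := hR _ (I.word_cof hJ fun _ : Fin (n + 1) => false) u
  refine ⟨I.relWord n ≫ w, ?_⟩
  rw [← Category.assoc, relIncl_relWord]
  exact hw

/-- Translation of `exists_faceSum`: after extension to tensor powers of `A`, vanishing on `C(K :
A)` and on `C(K)` becomes vanishing on runs. In degree `0` the only run is `K` itself. -/
lemma relAcyclic_of_faceSum (hJ : IsTensorProduct J) (hR : IsRelInjective J R)
    (hK : K.IsBarAcyclic R) {z : ℕ → ℤ} (hz : ∀ n, A.faceSum z (n + 1) ≫ A.faceSum z n = 0)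
    {d : ∀ n, I.relX (n + 1) ⟶ I.relX n}
    (hd : ∀ n, d n ≫ I.relWord n = I.relWord (n + 1) ≫ A.faceSum z n) :
    RelAcyclic (fun n => tpow K.X (n + 1)) I.relX d I.relIncl R := by
  refine ⟨fun c _ hc => ?_, fun n c h hc => ?_⟩
  · obtain ⟨U, rfl⟩ := I.exists_relWord_comp hJ hR c
    rw [relWord_comp_eq_zero_iff]
    intro i hi
    obtain rfl : i = 0 := by lia
    exact (I.relIncl_relWord_comp_eq_zero_iff U).1 hc
  · obtain ⟨U, rfl⟩ := I.exists_relWord_comp hJ hR c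
    rw [← Category.assoc, hd, Category.assoc, relWord_comp_eq_zero_iff] at h
    obtain ⟨v, hv, hv'⟩ := I.exists_faceSum hJ hR hK hz U h
      ((I.relIncl_relWord_comp_eq_zero_iff U).1 hc) (n + 2) le_rfl
    refine ⟨I.relWord n ≫ v, (I.relIncl_relWord_comp_eq_zero_iff v).2 hv, ?_⟩
    rw [← relWord_comp_eq_zero_iff, Preadditive.comp_sub, sub_eq_zero] at hv'
    rw [← Category.assoc, hd, Category.assoc, hv']

lemma relAcyclic_b' (hJ : IsTensorProduct J) (hR : IsRelInjective J R)
    (hK : K.IsBarAcyclic R) :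
    RelAcyclic K.cyc.obj I.cyc.obj I.cyc.b' (Precyclic.app I.toRel) R := by
  refine I.relAcyclic_of_faceSum hJ hR hK (z := 0) (fun n => ?_) fun n => ?_
  · rw [A.faceSum_zero, A.faceSum_zero]
    exact A.cyc.b'_b' n
  · rw [A.faceSum_zero]
    exact Precyclic.b'_app I.toAlg n

lemma relAcyclic_b (hJ : IsTensorProduct J) (hR : IsRelInjective J R)
    (hK : K.IsBarAcyclic R) :
    RelAcyclic K.cyc.obj I.cyc.obj I.cyc.b (Precyclic.app I.toRel) R := by
  have h (n : ℕ) : A.faceSum (fun n => (-1) ^ (n + 1)) n = A.cyc.b n := rfl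
  refine I.relAcyclic_of_faceSum hJ hR hK (z := fun n => (-1) ^ (n + 1)) (fun n => ?_) fun n => ?_
  · rw [h, h]
    exact A.cyc.b_b n
  · rw [h]
    exact Precyclic.b_app I.toAlg n

end CofIdeal

end

/-! ### From `b` and `b'` to `Ω` and `𝔅Ω` -/

noncomputable section

section Operators

variable {C : Type u} [Category.{v} C] [Preadditive C] [HasBinaryBiproducts C] {R : C}

lemma exists_eq_desc {P Q : C} (c : P ⊞ Q ⟶ R) : ∃ a b, c = biprod.desc a b :=
  ⟨biprod.inl ≫ c, biprod.inr ≫ c, by apply biprod.hom_ext' <;> simp⟩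

lemma desc_eq_zero_iff {P Q : C} {a : P ⟶ R} {b : Q ⟶ R} :
    biprod.desc a b = 0 ↔ a = 0 ∧ b = 0 := by
  constructor
  · intro h
    exact ⟨by simpa using congrArg (biprod.inl ≫ ·) h, by simpa using congrArg (biprod.inr ≫ ·) h⟩
  · rintro ⟨rfl, rfl⟩
    exact desc_zero

lemma tri_comp_desc_eq_zero_iff {P Q S T : C} {f : P ⟶ S} {g : Q ⟶ S} {h : Q ⟶ T} {a : S ⟶ R}
    {b : T ⟶ R} : tri f g h ≫ biprod.desc a b = 0 ↔ f ≫ a = 0 ∧ g ≫ a + h ≫ b = 0 := by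
  rw [tri_comp_desc, desc_eq_zero_iff]

lemma map_comp_desc_eq_zero_iff {P Q S T : C} {f : P ⟶ S} {g : Q ⟶ T} {a : S ⟶ R} {b : T ⟶ R} :
    biprod.map f g ≫ biprod.desc a b = 0 ↔ f ≫ a = 0 ∧ g ≫ b = 0 := by
  rw [map_comp_desc, desc_eq_zero_iff]

lemma desc_comp_eq_zero_iff {P Q S : C} {f : P ⟶ S} {g : Q ⟶ S} {a : S ⟶ R} :
    biprod.desc f g ≫ a = 0 ↔ f ≫ a = 0 ∧ g ≫ a = 0 := by
  rw [desc_comp, desc_eq_zero_iff]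

lemma Precyclic.one_sub_t_b (X : Precyclic C) (n : ℕ) :
    (𝟙 _ - X.t (n + 1)) ≫ X.b n = X.b' n ≫ (𝟙 _ - X.t n) := by
  have := X.t_b n
  rw [Preadditive.sub_comp, Preadditive.comp_sub, Category.id_comp, Category.comp_id,
    sub_eq_sub_iff_add_eq_add, ← this, add_comm (X.b' n)]

variable {X Y : Precyclic C} {f : X ⟶ Y}

/-- `Ω` is an extension of the shifted bar complex by the Hochschild complex, glued by `1 - t`. For
a relative cocycle `(α, β)`, choose `a` bounding `α`; then `β - (1 - t) a` is a relative cocycle for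
`b'`, because `(1 - t) b = b' (1 - t)`. -/
lemma Precyclic.relAcyclic_omega (hb : RelAcyclic X.obj Y.obj Y.b (app f) R)
    (hb' : RelAcyclic X.obj Y.obj Y.b' (app f) R) :
    RelAcyclic X.omegaX Y.omegaX Y.omegab (omegaMap f) R := by
  have key (n : ℕ) {a : Y.obj n ⟶ R} {β : Y.obj n ⟶ R} (ha : app f n ≫ a = 0)
      (hβ : app f n ≫ β = 0) (h : (𝟙 _ - Y.t (n + 1)) ≫ Y.b n ≫ a + (-Y.b' n) ≫ β = 0) :
      Y.b' n ≫ (β - (𝟙 _ - Y.t n) ≫ a) = 0 ∧ app f n ≫ (β - (𝟙 _ - Y.t n) ≫ a) = 0 := by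
    constructor
    · rw [Preadditive.comp_sub, ← Category.assoc (Y.b' n) (𝟙 _ - Y.t n), ← one_sub_t_b,
        Category.assoc, eq_neg_of_add_eq_zero_left h, Preadditive.neg_comp, neg_neg, sub_self]
    · rw [Preadditive.comp_sub, hβ, Preadditive.sub_comp, Category.id_comp, Preadditive.comp_sub,
        ha, ← Category.assoc, ← t_app, Category.assoc, ha, comp_zero, sub_zero, sub_zero]
  refine ⟨fun c h hc => ?_, fun n c h hc => ?_⟩
  · exact hb.1 c (desc_comp_eq_zero_iff.1 h).1 hc
  · obtain ⟨α, β, rfl⟩ : ∃ (α : Y.obj (n + 1) ⟶ R) (β : Y.obj n ⟶ R), c = biprod.desc α β :=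
      exists_eq_desc c
    obtain ⟨h1, h2⟩ := tri_comp_desc_eq_zero_iff.1 h
    obtain ⟨hα, hβ⟩ := map_comp_desc_eq_zero_iff.1 hc
    obtain ⟨a, ha, rfl⟩ := hb.2 n α h1 hα
    obtain ⟨h3, h4⟩ := key n ha hβ h2
    cases n with
    | zero =>
      refine ⟨a, ha, ?_⟩
      rw [sub_eq_zero.1 (hb'.1 _ h3 h4)]
      exact desc_comp _ _ _
    | succ n =>
      obtain ⟨γ, hγ, hγ'⟩ := hb'.2 n _ h3 h4
      -- The boundary of `Ω` is `-b'` on the second summand, whence the sign of `γ`.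
      refine ⟨(biprod.desc a (-γ) : Y.obj (n + 1) ⊞ Y.obj n ⟶ R), ?_, ?_⟩
      · exact map_comp_desc_eq_zero_iff.2 ⟨ha, by rw [Preadditive.comp_neg, hγ, neg_zero]⟩
      · refine (tri_comp_desc _ _ _ _ _).trans (congrArg (biprod.desc _) ?_)
        rw [Preadditive.neg_comp, Preadditive.comp_neg, neg_neg, hγ', add_sub_cancel]

variable {M N : MixedComplex C} {g : M ⟶ N}

/-- `𝔅` is an iterated extension of copies of `(M, b)`. A primitive of the component with `p = 0` is
chosen first; correcting by its composite with `B` leaves a relative cocycle two degrees lower, to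
which the induction applies. -/
lemma MixedComplex.relAcyclic_bar (h : RelAcyclic M.X N.X N.b (app g) R) :
    RelAcyclic M.barX N.barX N.barD (barMap g) R := by
  have key (n : ℕ) {e : N.X (n + 1) ⟶ R} {c : N.barX n ⟶ R} (he : app g (n + 1) ≫ e = 0)
      (hc : barMap g n ≫ c = 0)
      (h : (N.barTop (n + 1) ≫ N.B (n + 1)) ≫ N.b (n + 1) ≫ e + N.barD n ≫ c = 0) :
      N.barD n ≫ (c - (N.barTop n ≫ N.B n) ≫ e) = 0 ∧
        barMap g n ≫ (c - (N.barTop n ≫ N.B n) ≫ e) = 0 := by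
    constructor
    · rw [← Category.assoc, eq_neg_of_add_eq_zero_left (N.barTop_B_b n), Preadditive.neg_comp,
        neg_add_eq_zero, Category.assoc] at h
      rw [Preadditive.comp_sub, ← h, sub_self]
    · rw [Preadditive.comp_sub, hc, Category.assoc, ← Category.assoc (barMap g n), ← barTop_app,
        Category.assoc, ← Category.assoc (app g n), ← Hom.B_app, Category.assoc, he, comp_zero,
        comp_zero, sub_zero]
  refine ⟨h.1, fun n => ?_⟩
  induction n using Nat.twoStepInduction with
  | zero => exact fun c hc hc' => h.2 0 c (desc_comp_eq_zero_iff.1 hc).1 hc'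
  | one =>
    intro c hc hc'
    obtain ⟨c₀, c₁, rfl⟩ : ∃ (c₀ : N.X 2 ⟶ R) (c₁ : N.barX 0 ⟶ R), c = biprod.desc c₀ c₁ :=
      exists_eq_desc c
    obtain ⟨h1, h2⟩ := tri_comp_desc_eq_zero_iff.1 hc
    obtain ⟨h3, h4⟩ := map_comp_desc_eq_zero_iff.1 hc'
    obtain ⟨e, he, rfl⟩ := h.2 1 c₀ h1 h3
    obtain ⟨h5, h6⟩ := key 0 he h4 h2
    refine ⟨e, he, ?_⟩
    rw [sub_eq_zero.1 (h.1 _ h5 h6)]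
    refine (desc_comp _ _ _).trans (congrArg (biprod.desc _) ?_)
    exact congrArg (· ≫ e) (Category.id_comp _).symm
  | more n ih _ =>
    intro c hc hc'
    obtain ⟨c₀, c₁, rfl⟩ : ∃ (c₀ : N.X (n + 3) ⟶ R) (c₁ : N.barX (n + 1) ⟶ R),
      c = biprod.desc c₀ c₁ := exists_eq_desc c
    obtain ⟨h1, h2⟩ := tri_comp_desc_eq_zero_iff.1 hc
    obtain ⟨h3, h4⟩ := map_comp_desc_eq_zero_iff.1 hc'
    obtain ⟨e, he, rfl⟩ := h.2 (n + 2) c₀ h1 h3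
    obtain ⟨h5, h6⟩ := key (n + 1) he h4 h2
    obtain ⟨z, hz, hz'⟩ := ih _ h5 h6
    refine ⟨(biprod.desc e z : N.X (n + 2) ⊞ N.barX n ⟶ R), ?_, ?_⟩
    · exact map_comp_desc_eq_zero_iff.2 ⟨he, hz⟩
    · refine (tri_comp_desc _ _ _ _ _).trans (congrArg (biprod.desc _) ?_)
      rw [hz', add_sub_cancel]

end Operators

/-! ### Condition 1 implies excision for the four complexes -/

section Excision

variable {C : Type u} [Category.{v} C] [Preadditive C]

lemma quasiIso_of_relAcyclic_of {X Y : ChainComplex C ℕ} (f : X ⟶ Y) (R : C)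
    (hf : ∀ (n : ℕ) (c : X.X n ⟶ R), ∃ c', f.f n ≫ c' = c) {d : ∀ n, Y.X (n + 1) ⟶ Y.X n}
    (hd : ∀ n, Y.d (n + 1) n = d n) (h : RelAcyclic X.X Y.X d f.f R) :
    QuasiIso ((homInto _ R).map f.op) := by
  obtain rfl : (fun n => Y.d (n + 1) n) = d := funext hd
  exact quasiIso_of_relAcyclic f R hf h

variable [HasBinaryBiproducts C] {R : C}

lemma exists_biprod_map_comp {P Q S T : C} {f : P ⟶ S} {g : Q ⟶ T}
    (hf : ∀ c : P ⟶ R, ∃ c', f ≫ c' = c) (hg : ∀ c : Q ⟶ R, ∃ c', g ≫ c' = c) (c : P ⊞ Q ⟶ R) :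
    ∃ c', biprod.map f g ≫ c' = c := by
  obtain ⟨a, b, rfl⟩ := exists_eq_desc c
  obtain ⟨a, rfl⟩ := hf a
  obtain ⟨b, rfl⟩ := hg b
  exact ⟨biprod.desc a b, map_comp_desc _ _ _ _⟩

lemma Precyclic.exists_omegaMap_comp {X Y : Precyclic C} (f : X ⟶ Y)
    (hf : ∀ n (c : X.obj n ⟶ R), ∃ c', app f n ≫ c' = c) :
    ∀ n (c : X.omegaX n ⟶ R), ∃ c', omegaMap f n ≫ c' = c
  | 0 => hf 0
  | n + 1 => exists_biprod_map_comp (hf (n + 1)) (hf n)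

lemma MixedComplex.exists_barMap_comp {M N : MixedComplex C} (f : M ⟶ N)
    (hf : ∀ n (c : M.X n ⟶ R), ∃ c', app f n ≫ c' = c) :
    ∀ n (c : M.barX n ⟶ R), ∃ c', barMap f n ≫ c' = c
  | 0 => hf 0
  | 1 => hf 1
  | n + 2 => exists_biprod_map_comp (hf (n + 2)) (exists_barMap_comp f hf n)

variable [HasZeroObject C] [HasFiniteColimits C] [MonoidalCategory C] [SymmetricCategory C]
  [MonoidalPreadditive C] {J : ObjectProperty C} {K : Alg C}

lemma isExcisive_hochschild (hJ : IsTensorProduct J)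
    (hK : ∀ R, IsRelInjective J R → K.IsBarAcyclic R) :
    IsExcisive J Precyclic.hochschild K := fun _ I R hR =>
  quasiIso_of_relAcyclic_of _ _ (fun _ => I.exists_relIncl_comp hJ hR)
    (fun n => ChainComplex.of_d _ _ n) (I.relAcyclic_b hJ hR (hK R hR))

lemma isExcisive_bar (hJ : IsTensorProduct J)
    (hK : ∀ R, IsRelInjective J R → K.IsBarAcyclic R) :
    IsExcisive J Precyclic.bar K := fun _ I R hR =>
  quasiIso_of_relAcyclic_of _ _ (fun _ => I.exists_relIncl_comp hJ hR)
    (fun n => ChainComplex.of_d _ _ n) (I.relAcyclic_b' hJ hR (hK R hR))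

lemma isExcisive_omega (hJ : IsTensorProduct J)
    (hK : ∀ R, IsRelInjective J R → K.IsBarAcyclic R) :
    IsExcisive J (Precyclic.omega ⋙ MixedComplex.forget) K := fun _ I R hR =>
  quasiIso_of_relAcyclic_of _ _
    (Precyclic.exists_omegaMap_comp I.toRel fun _ => I.exists_relIncl_comp hJ hR)
    (fun n => ChainComplex.of_d _ _ n)
    (Precyclic.relAcyclic_omega (I.relAcyclic_b hJ hR (hK R hR)) (I.relAcyclic_b' hJ hR (hK R hR)))

lemma isExcisive_omega_bar (hJ : IsTensorProduct J)
    (hK : ∀ R, IsRelInjective J R → K.IsBarAcyclic R) :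
    IsExcisive J (Precyclic.omega ⋙ MixedComplex.bar) K := fun _ I R hR =>
  quasiIso_of_relAcyclic_of _ _
    (MixedComplex.exists_barMap_comp (Precyclic.omega.map I.toRel)
      (Precyclic.exists_omegaMap_comp I.toRel fun _ => I.exists_relIncl_comp hJ hR))
    (fun n => ChainComplex.of_d _ _ n)
    (MixedComplex.relAcyclic_bar (g := Precyclic.omega.map I.toRel) (Precyclic.relAcyclic_omega
      (I.relAcyclic_b hJ hR (hK R hR)) (I.relAcyclic_b' hJ hR (hK R hR))))

end Excision

end

/-! ### Detecting acyclicity by test maps -/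

noncomputable section

section Test

variable {C : Type u} [Category.{v} C] [Preadditive C]

/-- A cocycle on `Y` that vanishes on `X` restricts to the zero class, so it bounds; the primitive
itself need not vanish on `X`. Of excision, the converse uses only this. -/
lemma CohomInjective.exists_eq {X Y : ChainComplex C ℕ} {f : X ⟶ Y} {R : C}
    (hf : CohomInjective f R) {d : ∀ n, Y.X (n + 1) ⟶ Y.X n} (hd : ∀ n, Y.d (n + 1) n = d n)
    {n : ℕ} {c : Y.X (n + 1) ⟶ R} (h : d (n + 1) ≫ c = 0) (h' : f.f (n + 1) ≫ c = 0) :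
    ∃ e : Y.X n ⟶ R, d n ≫ e = c := by
  obtain rfl : (fun n => Y.d (n + 1) n) = d := funext hd
  exact hf.2 n c h 0 (by rw [comp_zero, h'])

namespace Precyclic

/-- Maps `σ n` from the chains of a complex `(T, δ)` to the chains of `Y` which allow to deduce the
acyclicity of the cochains on `T` from properties of the map `f`. -/
structure IsTest {X Y : Precyclic C} (f : X ⟶ Y) {T : ℕ → C} (δ : ∀ n, T (n + 1) ⟶ T n)
    (σ : ∀ n, T n ⟶ Y.obj (n + 1)) (R : C) : Prop where
  exists_cochain (n : ℕ) (c : T n ⟶ R) (hc : δ n ≫ c = 0) : ∃ β : Y.obj (n + 1) ⟶ R,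
    app f (n + 1) ≫ β = 0 ∧ Y.b' (n + 1) ≫ β = 0 ∧ Y.b (n + 1) ≫ β = 0 ∧ σ n ≫ β = c ∧
      σ n ≫ Y.N (n + 1) ≫ β = c
  b_zero (e : Y.obj 0 ⟶ R) : σ 0 ≫ Y.b 0 ≫ e = 0
  b'_zero (e : Y.obj 0 ⟶ R) : σ 0 ≫ Y.b' 0 ≫ e = 0
  b_succ (n : ℕ) (e : Y.obj (n + 1) ⟶ R) : ∃ z, δ n ≫ z = σ (n + 1) ≫ Y.b (n + 1) ≫ e
  b'_succ (n : ℕ) (e : Y.obj (n + 1) ⟶ R) : ∃ z, δ n ≫ z = σ (n + 1) ≫ Y.b' (n + 1) ≫ e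

namespace IsTest

variable {X Y : Precyclic C} {f : X ⟶ Y} {T : ℕ → C} {δ : ∀ n, T (n + 1) ⟶ T n}
  {σ : ∀ n, T n ⟶ Y.obj (n + 1)} {R : C}

/-- A cocycle `c` on `T` is the restriction along `σ` of some `β`. If `β` agrees along `σ` with a
coboundary for `b` or for `b'`, then `c` is a coboundary for `δ`. In the lowest degree both
boundaries vanish on `σ 0`, so `c = 0`. -/
lemma cochainAcyclic (h : IsTest f δ σ R)
    (hs : ∀ (n : ℕ) (β : Y.obj (n + 1) ⟶ R), app f (n + 1) ≫ β = 0 → Y.b' (n + 1) ≫ β = 0 →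
      Y.b (n + 1) ≫ β = 0 → σ n ≫ Y.N (n + 1) ≫ β = σ n ≫ β →
      ∃ e : Y.obj n ⟶ R, σ n ≫ Y.b n ≫ e = σ n ≫ β ∨ σ n ≫ Y.b' n ≫ e = σ n ≫ β) :
    CochainAcyclic T δ R := by
  refine ⟨fun c hc => ?_, fun n c hc => ?_⟩
  · obtain ⟨β, h1, h2, h3, rfl, h5⟩ := h.exists_cochain 0 c hc
    obtain ⟨e, he | he⟩ := hs 0 β h1 h2 h3 h5
    · exact he.symm.trans (h.b_zero e)
    · exact he.symm.trans (h.b'_zero e)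
  · obtain ⟨β, h1, h2, h3, rfl, h5⟩ := h.exists_cochain (n + 1) c hc
    obtain ⟨e, he | he⟩ := hs (n + 1) β h1 h2 h3 h5
    · rw [← he]
      exact h.b_succ n e
    · rw [← he]
      exact h.b'_succ n e

lemma cochainAcyclic_of_hochschild (h : IsTest f δ σ R)
    (hf : CohomInjective (hochschild.map f) R) : CochainAcyclic T δ R :=
  h.cochainAcyclic fun n β h1 _ h3 _ => by
    obtain ⟨e, he⟩ : ∃ e : Y.obj n ⟶ R, Y.b n ≫ e = β :=
      hf.exists_eq (fun n => ChainComplex.of_d _ _ n) h3 h1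
    exact ⟨e, Or.inl (by rw [he])⟩

lemma cochainAcyclic_of_bar (h : IsTest f δ σ R)
    (hf : CohomInjective (bar.map f) R) : CochainAcyclic T δ R :=
  h.cochainAcyclic fun n β h1 h2 _ _ => by
    obtain ⟨e, he⟩ : ∃ e : Y.obj n ⟶ R, Y.b' n ≫ e = β :=
      hf.exists_eq (fun n => ChainComplex.of_d _ _ n) h2 h1
    exact ⟨e, Or.inr (by rw [he])⟩

variable [HasBinaryBiproducts C]

lemma cochainAcyclic_of_omega (h : IsTest f δ σ R)
    (hf : CohomInjective ((omega ⋙ MixedComplex.forget).map f) R) : CochainAcyclic T δ R :=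
  h.cochainAcyclic fun n β h1 h2 _ h4 => by
    -- The cochain `(0, β)` lives in degree `n + 2` of `Ω`, and is a cocycle because `β` is one for
    -- `b'`.
    obtain ⟨c, hc⟩ : ∃ c : Y.obj (n + 2) ⊞ Y.obj (n + 1) ⟶ R, c = biprod.desc 0 β := ⟨_, rfl⟩
    have hc1 : Y.omegab (n + 2) ≫ c = 0 := by
      rw [hc]
      refine tri_comp_desc_eq_zero_iff.2 ⟨comp_zero, ?_⟩
      rw [comp_zero, zero_add, Preadditive.neg_comp, h2, neg_zero]
    have hc2 : omegaMap f (n + 2) ≫ c = 0 := by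
      rw [hc]
      exact map_comp_desc_eq_zero_iff.2 ⟨comp_zero, h1⟩
    obtain ⟨e, he⟩ : ∃ e : Y.omegaX (n + 1) ⟶ R, Y.omegab (n + 1) ≫ e = c :=
      hf.exists_eq (fun n => ChainComplex.of_d _ _ n) hc1 hc2
    obtain ⟨α, γ, rfl⟩ : ∃ (α : Y.obj (n + 1) ⟶ R) (γ : Y.obj n ⟶ R), e = biprod.desc α γ :=
      exists_eq_desc e
    have h5 : biprod.desc (Y.b (n + 1) ≫ α) ((𝟙 _ - Y.t (n + 1)) ≫ α + (-Y.b' n) ≫ γ) =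
        biprod.desc 0 β := (tri_comp_desc _ _ _ _ _).symm.trans (he.trans hc)
    have h6 : (𝟙 _ - Y.t (n + 1)) ≫ α + (-Y.b' n) ≫ γ = β := by
      simpa using congrArg (biprod.inr ≫ ·) h5
    have h7 : Y.N (n + 1) ≫ (𝟙 _ - Y.t (n + 1)) = 0 := by
      rw [Preadditive.comp_sub, N_t, Category.comp_id, sub_self]
    -- Applying `N` to `β = (1 - t) α - b' γ` kills the first term and gives `N β = -b (N γ)`, by `N
    -- b' = b N`.
    refine ⟨-(Y.N n ≫ γ), Or.inl ?_⟩
    rw [← h4, ← h6]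
    refine congrArg (σ n ≫ ·) ?_
    rw [Preadditive.comp_add, ← Category.assoc, h7, zero_comp, zero_add, Preadditive.neg_comp,
      Preadditive.comp_neg, Preadditive.comp_neg, ← Category.assoc, ← Category.assoc, N_b']

end IsTest

end Precyclic

namespace MixedComplex

variable [HasBinaryBiproducts C] (M : MixedComplex C) {R : C}

/-- The inclusion of the summand `M_n` of `⨁_{p ≥ 0} M_{n - 2p}`, `p = 0`. -/
def barIn : ∀ n, M.X n ⟶ M.barX n
  | 0 => 𝟙 _
  | 1 => 𝟙 _
  | _ + 2 => biprod.inl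

lemma barIn_barTop : ∀ n, M.barIn n ≫ M.barTop n = 𝟙 (M.X n)
  | 0 => Category.id_comp _
  | 1 => Category.id_comp _
  | _ + 2 => biprod.inl_fst

lemma barIn_barD : ∀ n, M.barIn (n + 1) ≫ M.barD n = M.b n ≫ M.barIn n
  | 0 => (Category.id_comp (M.b 0)).trans (Category.comp_id (M.b 0)).symm
  | 1 => (biprod.inl_desc (M.b 1) (M.B 0)).trans (Category.comp_id (M.b 1)).symm
  | _ + 2 => biprod.inl_desc _ _

/-- The component with `p = 0` of the differential involves only `b` on that summand and `B` from
the next one. -/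
lemma barD_barTop_comp_eq_zero : ∀ (n : ℕ) (ψ : M.X (n + 1) ⟶ R),
    M.b (n + 1) ≫ ψ = 0 → M.B n ≫ ψ = 0 → M.barD (n + 1) ≫ M.barTop (n + 1) ≫ ψ = 0
  | 0, ψ, h, h' => (congrArg (M.barD 1 ≫ ·) (Category.id_comp ψ)).trans
      (desc_comp_eq_zero_iff.2 ⟨h, h'⟩)
  | n + 1, ψ, h, h' => by
      refine (Category.assoc _ _ _).symm.trans ((congrArg (· ≫ ψ) (tri_comp_fst _ _ _)).trans ?_)
      exact desc_comp_eq_zero_iff.2 ⟨h, by rw [Category.assoc, h', comp_zero]⟩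

end MixedComplex

namespace Precyclic.IsTest

variable {X Y : Precyclic C} {f : X ⟶ Y} {T : ℕ → C} {δ : ∀ n, T (n + 1) ⟶ T n}
  {σ : ∀ n, T n ⟶ Y.obj (n + 1)} {R : C} [HasBinaryBiproducts C]

lemma exists_inl_omegab : ∀ n, ∃ i : Y.obj n ⟶ Y.omegaX n,
    (biprod.inl : Y.obj (n + 1) ⟶ Y.obj (n + 1) ⊞ Y.obj n) ≫ Y.omegab n = Y.b n ≫ i
  | 0 => ⟨𝟙 _, (biprod.inl_desc _ _).trans (Category.comp_id _).symm⟩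
  | _ + 1 => ⟨biprod.inl, biprod.inl_desc _ _⟩

lemma omegaB_fst : ∀ n, Y.omegaB n ≫ (biprod.fst : Y.obj (n + 1) ⊞ Y.obj n ⟶ _) = 0
  | 0 => (Category.assoc _ _ _).trans ((congrArg (Y.N 0 ≫ ·) biprod.inr_fst).trans comp_zero)
  | n + 1 => by
      refine (Category.assoc _ _ _).trans ((congrArg (biprod.fst ≫ ·) ?_).trans comp_zero)
      exact (Category.assoc _ _ _).trans ((congrArg (_ ≫ ·) biprod.inr_fst).trans comp_zero)

lemma cochainAcyclic_of_omega_bar (h : IsTest f δ σ R)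
    (hf : CohomInjective ((omega ⋙ MixedComplex.bar).map f) R) : CochainAcyclic T δ R :=
  h.cochainAcyclic fun n β h1 h2 _ h4 => by
    have h7 : (𝟙 _ - Y.t (n + 1)) ≫ Y.N (n + 1) = 0 := by
      rw [Preadditive.sub_comp, t_N, Category.id_comp, sub_self]
    -- The cochain `(N β, 0)` is killed by `b`, since `b N = N b'` and `(1 - t) N = 0`, and by `B`,
    -- whose image lies in the second summand. Hence it defines a cocycle on `𝔅Ω`.
    obtain ⟨ψ, hψ⟩ : ∃ ψ : Y.obj (n + 1) ⊞ Y.obj n ⟶ R, ψ = biprod.fst ≫ Y.N (n + 1) ≫ β :=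
      ⟨_, rfl⟩
    have hb : Y.omegab (n + 1) ≫ ψ = 0 := by
      rw [hψ]
      refine (Category.assoc _ _ _).symm.trans ((congrArg (· ≫ _) (tri_comp_fst _ _ _)).trans ?_)
      refine desc_comp_eq_zero_iff.2 ⟨?_, ?_⟩
      · rw [← Category.assoc, ← N_b', Category.assoc, h2, comp_zero]
      · rw [← Category.assoc, h7, zero_comp]
    have hB : Y.omegaB n ≫ ψ = 0 := by
      rw [hψ]
      exact (Category.assoc _ _ _).symm.trans ((congrArg (· ≫ _) (omegaB_fst n)).trans zero_comp)
    have hm : omegaMap f (n + 1) ≫ ψ = 0 := by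
      rw [hψ]
      refine (Category.assoc _ _ _).symm.trans ((congrArg (· ≫ _) (biprod.map_fst _ _)).trans ?_)
      rw [Category.assoc, ← Category.assoc (app f (n + 1)), ← N_app, Category.assoc, h1, comp_zero,
        comp_zero]
      rfl
    let M := omega.obj Y
    have hm' : MixedComplex.barMap (omega.map f) (n + 1) ≫ M.barTop (n + 1) ≫ ψ = 0 := by
      refine (Category.assoc _ _ _).symm.trans
        ((congrArg (· ≫ ψ) (MixedComplex.barTop_app (omega.map f) (n + 1)).symm).trans ?_)
      exact (Category.assoc _ _ _).trans ((congrArg (_ ≫ ·) hm).trans comp_zero)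
    obtain ⟨e, he⟩ : ∃ e : M.barX n ⟶ R, M.barD n ≫ e = M.barTop (n + 1) ≫ ψ :=
      hf.exists_eq (fun n => ChainComplex.of_d _ _ n) (M.barD_barTop_comp_eq_zero n ψ hb hB) hm'
    have h9 : M.b n ≫ M.barIn n ≫ e = ψ := by
      rw [← Category.assoc, ← M.barIn_barD, Category.assoc, he]
      exact (Category.assoc _ _ _).symm.trans
        ((congrArg (· ≫ ψ) (M.barIn_barTop (n + 1))).trans (Category.id_comp ψ))
    obtain ⟨i, hi⟩ := exists_inl_omegab (Y := Y) n
    -- Restricting the primitive to the summand `p = 0`, and there to the Hochschild part, exhibits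
    -- `N β` as a coboundary for `b`; along `σ` it agrees with `β`.
    refine ⟨i ≫ M.barIn n ≫ e, Or.inl ?_⟩
    rw [← h4]
    refine congrArg (σ n ≫ ·) ?_
    refine (Category.assoc _ _ _).symm.trans ((congrArg (· ≫ _) hi.symm).trans ?_)
    refine (Category.assoc _ _ _).trans ((congrArg (biprod.inl ≫ ·) h9).trans ?_)
    rw [hψ, biprod.inl_fst_assoc]

end Precyclic.IsTest

end Test

end

/-! ### The extension `K ⊕ V` with zero products on `V` -/

noncomputable section

variable {C : Type u} [Category.{v} C] [MonoidalCategory C]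

lemma mulHead_comp_eq_zero [Preadditive C] [MonoidalPreadditive C] {X Y Z Z' P P' : C}
    {m : X ⊗ Y ⟶ Z} {z : Z ⟶ Z'} (h : m ≫ z = 0) (e : P ⟶ P') :
    mulHead m P ≫ (z ⊗ₘ e) = 0 := by
  rw [mulHead, Category.assoc, ← tensorHom_id, tensorHom_comp_tensorHom, h,
    MonoidalPreadditive.zero_tensor, comp_zero]

lemma comp_mulHead_eq_zero [Preadditive C] [MonoidalPreadditive C] {X Y Z X' Y' P P' : C}
    {m : X ⊗ Y ⟶ Z} {x : X' ⟶ X} {y : Y' ⟶ Y} (h : (x ⊗ₘ y) ≫ m = 0) (e : P' ⟶ P) :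
    (x ⊗ₘ (y ⊗ₘ e)) ≫ mulHead m P = 0 := by
  rw [mulHead, associator_inv_naturality_assoc, ← tensorHom_id, tensorHom_comp_tensorHom, h,
    MonoidalPreadditive.zero_tensor, comp_zero]

lemma tensMap_comp_mulAt_zero [Preadditive C] [MonoidalPreadditive C] (A : Alg C) {n : ℕ}
    {X : Fin (n + 2) → C} {f : ∀ i, X i ⟶ A.X} (h : (f 0 ⊗ₘ f 1) ≫ A.mul = 0) :
    tensMap f ≫ A.mulAt n 0 = 0 :=
  (congrArg (tensMap f ≫ ·) (A.mulAt_zero n)).trans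
    (comp_mulHead_eq_zero h (tensMap fun i : Fin n => f i.succ.succ))

variable [SymmetricCategory C]

lemma exists_tensMap_comp_iter_rotPow {A : C} {n : ℕ} {X : Fin (n + 1) → C} (f : ∀ i, X i ⟶ A)
    (k : ℕ) : ∃ θ, tensMap f ≫ iter (rotPow A n) k =
      θ ≫ tensMap fun j => f ((rotIdx n)^[k] j) := by
  induction k with
  | zero => exact ⟨𝟙 _, (Category.comp_id _).trans (Category.id_comp _).symm⟩
  | succ k ih =>
    obtain ⟨θ, hθ⟩ := ih
    refine ⟨θ ≫ rot _, ?_⟩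
    rw [iter_succ, reassoc_of% hθ]
    exact (congrArg (θ ≫ ·) (rot_naturality fun j => f ((rotIdx n)^[k] j))).trans
      (Category.assoc _ _ _).symm

/-- After `k + 1` rotations the front factor is number `n - k`. For `k < n` it is not the original
first factor, so in the norm only the identity term keeps `V` in front. -/
lemma rotIdx_iterate_zero (n : ℕ) : ∀ k, k ≤ n → (((rotIdx n)^[k + 1] 0 : Fin (n + 1)) : ℕ) = n - k
  | 0, _ => rfl
  | k + 1, h => by
      rw [Function.iterate_succ_apply']
      have ih := rotIdx_iterate_zero n k (by lia)
      generalize (rotIdx n)^[k + 1] 0 = j at ih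
      cases j using Fin.cases with
      | zero => simp at ih; lia
      | succ j =>
        rw [CofIdeal.rotIdx_succ, Fin.val_castSucc]
        rw [Fin.val_succ] at ih
        lia

variable [Preadditive C] [MonoidalPreadditive C]

lemma Precyclic.iter_t_eq (X : Precyclic C) (n k : ℕ) :
    iter (X.t n) k = (-1 : ℤ) ^ (n * k) • iter (X.rot n) k := by
  induction k with
  | zero => simp
  | succ k ih =>
    rw [iter_succ, ih, t, iter_succ, Preadditive.zsmul_comp, Preadditive.comp_zsmul, smul_smul,
      mul_add, pow_add, mul_one]

lemma Precyclic.N_eq (X : Precyclic C) (n : ℕ) :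
    X.N n = ∑ i ∈ Finset.range (n + 1), (-1 : ℤ) ^ (n * i) • iter (X.rot n) i :=
  Finset.sum_congr rfl fun i _ => X.iter_t_eq n i

namespace Alg

lemma barB_hom {A B : Alg C} (φ : A.X ⟶ B.X) (hφ : (φ ⊗ₘ φ) ≫ B.mul = A.mul ≫ φ) (n : ℕ) :
    tensMap (fun _ : Fin (n + 2) => φ) ≫ B.barB n =
      A.barB n ≫ tensMap fun _ : Fin (n + 1) => φ := by
  change _ ≫ (∑ i : Fin (n + 1), (-1 : ℤ) ^ (i : ℕ) • B.mulAt n i) =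
    (∑ i : Fin (n + 1), (-1 : ℤ) ^ (i : ℕ) • A.mulAt n i) ≫ _
  rw [Preadditive.comp_sum, Preadditive.sum_comp]
  refine Finset.sum_congr rfl fun i _ => ?_
  rw [Preadditive.comp_zsmul, Preadditive.zsmul_comp, mulAt_hom A B φ hφ n i]

/-- The norm operator on tensor powers. -/
def normPow (A : Alg C) (n : ℕ) : tpow A.X (n + 1) ⟶ tpow A.X (n + 1) := A.cyc.N n

lemma normPow_eq (A : Alg C) (n : ℕ) : A.normPow n =
    ∑ i ∈ Finset.range (n + 1), (-1 : ℤ) ^ (n * i) • iter (rotPow A.X n) i :=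
  A.cyc.N_eq n

variable [HasBinaryBiproducts C] (K : Alg C) (V : C)

/-- The algebra `K ⊕ V` in which all products with elements of `V` vanish. -/
def sqZero : Alg C where
  X := K.X ⊞ V
  mul := (biprod.fst ⊗ₘ biprod.fst) ≫ K.mul ≫ biprod.inl
  assoc := by
    have h1 : ((biprod.fst : K.X ⊞ V ⟶ _) ⊗ₘ (biprod.fst : K.X ⊞ V ⟶ _)) ≫ K.mul ≫
        (biprod.inl : _ ⟶ K.X ⊞ V) ≫ biprod.fst = (biprod.fst ⊗ₘ biprod.fst) ≫ K.mul := by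
      rw [biprod.inl_fst, Category.comp_id]
    rw [← tensorHom_id, ← id_tensorHom, tensorHom_comp_tensorHom_assoc,
      tensorHom_comp_tensorHom_assoc]
    simp only [Category.assoc, Category.id_comp]
    rw [h1]
    have h2 : ((biprod.fst : K.X ⊞ V ⟶ _) ⊗ₘ (biprod.fst : K.X ⊞ V ⟶ _)) ≫ K.mul ⊗ₘ
        (biprod.fst : K.X ⊞ V ⟶ _) = ((biprod.fst ⊗ₘ biprod.fst) ⊗ₘ biprod.fst) ≫ K.mul ▷ K.X := by
      rw [← tensorHom_id, tensorHom_comp_tensorHom, Category.comp_id]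
    have h3 : (biprod.fst : K.X ⊞ V ⟶ _) ⊗ₘ
        (((biprod.fst : K.X ⊞ V ⟶ _) ⊗ₘ (biprod.fst : K.X ⊞ V ⟶ _)) ≫ K.mul) =
        (biprod.fst ⊗ₘ (biprod.fst ⊗ₘ biprod.fst)) ≫ K.X ◁ K.mul := by
      rw [← id_tensorHom, tensorHom_comp_tensorHom, Category.comp_id]
    rw [h2, h3, Category.assoc, reassoc_of% K.assoc, Category.assoc, associator_naturality_assoc]

lemma fst_mul : ((biprod.fst : (K.sqZero V).X ⟶ K.X) ⊗ₘ biprod.fst) ≫ K.mul =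
    (K.sqZero V).mul ≫ biprod.fst := by
  simp [sqZero]

lemma inl_mul : ((biprod.inl : K.X ⟶ K.X ⊞ V) ⊗ₘ (biprod.inl : K.X ⟶ K.X ⊞ V)) ≫
    (K.sqZero V).mul = K.mul ≫ biprod.inl := by
  simp [sqZero]

lemma mul_snd : (K.sqZero V).mul ≫ (biprod.snd : K.X ⊞ V ⟶ V) = 0 := by
  simp [sqZero]
  rfl

lemma inr_mul {X : C} (x : X ⟶ K.X ⊞ V) :
    ((biprod.inr : V ⟶ K.X ⊞ V) ⊗ₘ x) ≫ (K.sqZero V).mul = 0 := by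
  simp [sqZero]
  rfl

lemma mul_inr {X : C} (x : X ⟶ K.X ⊞ V) :
    (x ⊗ₘ (biprod.inr : V ⟶ K.X ⊞ V)) ≫ (K.sqZero V).mul = 0 := by
  simp [sqZero]
  rfl

/-- The projection `(K ⊕ V)^{⊗ n + 1} ⟶ V ⊗ K^{⊗ n}`. -/
def sqZeroProj (n : ℕ) : tpow (K.sqZero V).X (n + 1) ⟶ V ⊗ tpow K.X n :=
  (biprod.snd : K.X ⊞ V ⟶ V) ⊗ₘ tensMap fun _ : Fin n => (biprod.fst : K.X ⊞ V ⟶ K.X)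

/-- The inclusion `V ⊗ K^{⊗ n} ⟶ (K ⊕ V)^{⊗ n + 1}`. -/
def sqZeroIn (n : ℕ) : V ⊗ tpow K.X n ⟶ tpow (K.sqZero V).X (n + 1) :=
  (biprod.inr : V ⟶ K.X ⊞ V) ⊗ₘ tensMap fun _ : Fin n => (biprod.inl : K.X ⟶ K.X ⊞ V)

/-- The factors of `V ⊗ K^{⊗ n}`. -/
def sqZeroFam (n : ℕ) : Fin (n + 1) → C := Fin.cons V fun _ => K.X

/-- The inclusions of the factors of `V ⊗ K^{⊗ n}`. -/
def sqZeroFamIn (n : ℕ) : ∀ i, K.sqZeroFam V n i ⟶ (K.sqZero V).X :=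
  Fin.cases (biprod.inr : V ⟶ K.X ⊞ V) fun _ => (biprod.inl : K.X ⟶ K.X ⊞ V)

lemma sqZeroFamIn_ne_zero_snd {n : ℕ} {i : Fin (n + 1)} (h : i ≠ 0) :
    K.sqZeroFamIn V n i ≫ (biprod.snd : K.X ⊞ V ⟶ V) = 0 := by
  cases i using Fin.cases with
  | zero => exact absurd rfl h
  | succ i => exact biprod.inl_snd

lemma sqZeroIn_mulAt_zero (n : ℕ) : K.sqZeroIn V (n + 1) ≫ (K.sqZero V).mulAt n 0 = 0 :=
  tensMap_comp_mulAt_zero (K.sqZero V) (f := K.sqZeroFamIn V (n + 1)) (K.inr_mul V _)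

lemma sqZeroIn_rot_mulAt_zero (n : ℕ) :
    K.sqZeroIn V (n + 1) ≫ rotPow (K.sqZero V).X (n + 1) ≫ (K.sqZero V).mulAt n 0 = 0 := by
  refine (Category.assoc _ _ _).symm.trans
    ((congrArg (· ≫ _) (rot_naturality (K.sqZeroFamIn V (n + 1)))).trans ?_)
  refine (Category.assoc _ _ _).trans ((congrArg (_ ≫ ·) ?_).trans comp_zero)
  exact tensMap_comp_mulAt_zero (K.sqZero V)
    (f := fun i => K.sqZeroFamIn V (n + 1) (rotIdx (n + 1) i)) (K.mul_inr V _)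

lemma mulAt_zero_sqZeroProj (n : ℕ) : (K.sqZero V).mulAt n 0 ≫ K.sqZeroProj V n = 0 :=
  (congrArg (· ≫ _) ((K.sqZero V).mulAt_zero n)).trans (mulHead_comp_eq_zero (K.mul_snd V) _)

/-- Products lie in `K`, so the face `0` and the cyclic face die when position `0` is projected to
`V`. The other faces form `b'` on the remaining factors, with the sign of the shift by one position.
-/
lemma faceSum_sqZeroProj (z : ℕ → ℤ) (n : ℕ) :
    (K.sqZero V).faceSum z (n + 1) ≫ K.sqZeroProj V (n + 1) =
      -(K.sqZeroProj V (n + 2) ≫ V ◁ K.barB n) := by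
  have h1 : (K.sqZero V).barB (n + 1) ≫ K.sqZeroProj V (n + 1) =
      -(K.sqZeroProj V (n + 2) ≫ V ◁ K.barB n) := by
    refine (congrArg (· ≫ _) (barB_succ _ n)).trans ((homSub_comp _ _ _).trans ?_)
    refine (congrArg₂ homSub (mulHead_comp_eq_zero (K.mul_snd V) _)
      (tensor_whisker (biprod.snd : K.X ⊞ V ⟶ V)
        (barB_hom (A := K.sqZero V) (B := K) biprod.fst (K.fst_mul V) n)).symm).trans ?_
    exact zero_sub _
  rw [faceSum, Preadditive.add_comp, h1, Preadditive.zsmul_comp, Category.assoc,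
    mulAt_zero_sqZeroProj, comp_zero, smul_zero, add_zero]

/-- The face `0` and the cyclic face multiply by an element of `V`, hence vanish; this covers `b`
and `b'` at once. -/
lemma sqZeroIn_faceSum (z : ℕ → ℤ) (n : ℕ) :
    K.sqZeroIn V (n + 2) ≫ (K.sqZero V).faceSum z (n + 1) =
      -(V ◁ K.barB n ≫ K.sqZeroIn V (n + 1)) := by
  have h1 : K.sqZeroIn V (n + 2) ≫ (K.sqZero V).barB (n + 1) =
      -(V ◁ K.barB n ≫ K.sqZeroIn V (n + 1)) := by
    refine (congrArg (_ ≫ ·) (barB_succ _ n)).trans ((comp_homSub _ _ _).trans ?_)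
    refine (congrArg₂ homSub ((congrArg (_ ≫ ·) ((K.sqZero V).mulAt_zero (n + 1))).symm.trans
      (K.sqZeroIn_mulAt_zero V (n + 1)))
      (tensor_whisker (biprod.inr : V ⟶ K.X ⊞ V)
        (barB_hom (A := K) (B := K.sqZero V) biprod.inl (K.inl_mul V) n))).trans ?_
    exact zero_sub _
  rw [faceSum, Preadditive.comp_add, h1, Preadditive.comp_zsmul, sqZeroIn_rot_mulAt_zero,
    smul_zero, add_zero]

lemma sqZeroIn_faceSum_zero (z : ℕ → ℤ) :
    K.sqZeroIn V 1 ≫ (K.sqZero V).faceSum z 0 = 0 := by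
  have h1 : K.sqZeroIn V 1 ≫ (K.sqZero V).barB 0 = 0 :=
    (congrArg (_ ≫ ·) (barB_zero _)).trans (K.sqZeroIn_mulAt_zero V 0)
  rw [faceSum, Preadditive.comp_add, h1, Preadditive.comp_zsmul, sqZeroIn_rot_mulAt_zero,
    smul_zero, add_zero]

lemma sqZeroIn_sqZeroProj (n : ℕ) : K.sqZeroIn V n ≫ K.sqZeroProj V n = 𝟙 _ := by
  refine (tensorHom_comp_tensorHom _ _ _ _).trans ?_
  refine (congrArg₂ (· ⊗ₘ ·) biprod.inr_snd ?_).trans (id_tensorHom_id _ _)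
  exact (tensMap_comp _ _).symm.trans
    ((congrArg tensMap (funext fun _ => biprod.inl_fst)).trans (tensMap_id _))

/-- A nontrivial rotation puts a factor `K` in position `0`, where the projection to `V` kills it;
only the identity term of the norm survives. -/
lemma sqZeroIn_normPow_sqZeroProj (n : ℕ) :
    K.sqZeroIn V n ≫ (K.sqZero V).normPow n ≫ K.sqZeroProj V n = 𝟙 _ := by
  rw [normPow_eq, Finset.sum_range_succ', mul_zero, pow_zero, one_smul, iter_zero,
    Preadditive.add_comp, Category.id_comp, Preadditive.comp_add, sqZeroIn_sqZeroProj,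
    Preadditive.sum_comp, Preadditive.comp_sum]
  refine (congrArg (· + _) (Finset.sum_eq_zero fun k hk => ?_)).trans (zero_add _)
  rw [Finset.mem_range] at hk
  obtain ⟨θ, hθ⟩ := exists_tensMap_comp_iter_rotPow (K.sqZeroFamIn V n) (k + 1)
  have h0 : (rotIdx n)^[k + 1] 0 ≠ 0 := fun h => by
    have := rotIdx_iterate_zero n k (by lia)
    rw [h, Fin.val_zero] at this
    lia
  rw [Preadditive.zsmul_comp, Preadditive.comp_zsmul]
  refine (congrArg (_ • ·) ?_).trans (smul_zero _)
  refine (Category.assoc _ _ _).symm.trans ((congrArg (· ≫ K.sqZeroProj V n) hθ).trans ?_)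
  refine (Category.assoc _ _ _).trans ((congrArg (θ ≫ ·) ?_).trans comp_zero)
  exact tensorHom_eq_zero_left (K.sqZeroFamIn_ne_zero_snd V h0) _ _

/-- `K` is a cof-ideal in `K ⊕ V`. -/
def sqZeroCofIdeal (J : ObjectProperty C) : CofIdeal J K (K.sqZero V) where
  incl := (biprod.inl : K.X ⟶ K.X ⊞ V)
  mono := inferInstanceAs (Mono (biprod.inl : K.X ⟶ K.X ⊞ V))
  -- A split monomorphism is a cofibration for any class of basic objects.
  cof _ _ u := ⟨(biprod.fst : K.X ⊞ V ⟶ K.X) ≫ u, biprod.inl_fst_assoc u⟩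
  mul_incl := (K.inl_mul V).symm
  left := (biprod.fst : K.X ⊞ V ⟶ K.X) ▷ K.X ≫ K.mul
  left_incl := by
    simp only [sqZero, Category.assoc]
    rw [← id_tensorHom, tensorHom_comp_tensorHom_assoc, Category.id_comp, biprod.inl_fst,
      tensorHom_id]
  right := K.X ◁ (biprod.fst : K.X ⊞ V ⟶ K.X) ≫ K.mul
  right_incl := by
    simp only [sqZero, Category.assoc]
    rw [← tensorHom_id, tensorHom_comp_tensorHom_assoc, Category.id_comp, biprod.inl_fst,
      id_tensorHom]

variable [HasFiniteColimits C] {J : ObjectProperty C} {R : C}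

/-- The map `V ⊗ K^{⊗ n + 1} ⟶ C_{n + 1}(K : K ⊕ V)`. -/
def sqZeroRel (J : ObjectProperty C) (n : ℕ) :
    V ⊗ tpow K.X (n + 1) ⟶ (K.sqZeroCofIdeal V J).relX (n + 1) :=
  (biprod.inr : V ⟶ K.X ⊞ V) ▷ tpow K.X (n + 1) ≫
    (K.sqZeroCofIdeal V J).ι (Fin.cons true fun _ => false)
      (CofIdeal.cons_ne (CofIdeal.zero_ne n) true)

lemma sqZeroRel_relWord (n : ℕ) :
    K.sqZeroRel V J n ≫ (K.sqZeroCofIdeal V J).relWord (n + 1) = K.sqZeroIn V (n + 1) := by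
  refine (Category.assoc _ _ _).trans
    ((congrArg ((biprod.inr : V ⟶ K.X ⊞ V) ▷ tpow K.X (n + 1) ≫ ·)
      ((K.sqZeroCofIdeal V J).ι_relWord _ _)).trans ?_)
  refine (congrArg (· ≫ _) (tensorHom_id _ _).symm).trans
    ((tensorHom_comp_tensorHom _ _ _ _).trans ?_)
  exact congrArg₂ (· ⊗ₘ ·) (Category.comp_id _) (Category.id_comp _)

lemma relIncl_relWord_sqZeroProj (n : ℕ) :
    (K.sqZeroCofIdeal V J).relIncl n ≫ (K.sqZeroCofIdeal V J).relWord n ≫ K.sqZeroProj V n =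
      0 := by
  rw [← Category.assoc, CofIdeal.relIncl_relWord]
  exact tensorHom_eq_zero_left biprod.inl_snd _ _

section

variable {z : ℕ → ℤ}
  {d : ∀ n, (K.sqZeroCofIdeal V J).relX (n + 1) ⟶ (K.sqZeroCofIdeal V J).relX n}

lemma relD_relWord_sqZeroProj_comp (hd : ∀ n, d n ≫ (K.sqZeroCofIdeal V J).relWord n =
      (K.sqZeroCofIdeal V J).relWord (n + 1) ≫ (K.sqZero V).faceSum z n)
    {n : ℕ} {c : V ⊗ tpow K.X (n + 1) ⟶ R} (hc : V ◁ K.barB n ≫ c = 0) :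
    d (n + 1) ≫ (K.sqZeroCofIdeal V J).relWord (n + 1) ≫ K.sqZeroProj V (n + 1) ≫ c = 0 := by
  rw [← Category.assoc (d (n + 1)), hd, Category.assoc,
    ← Category.assoc ((K.sqZero V).faceSum z (n + 1)), faceSum_sqZeroProj, Preadditive.neg_comp,
    Category.assoc, hc, comp_zero, neg_zero, comp_zero]

lemma sqZeroRel_relD_zero_comp (hJ : IsTensorProduct J) (hR : IsRelInjective J R)
    (hd : ∀ n, d n ≫ (K.sqZeroCofIdeal V J).relWord n =
      (K.sqZeroCofIdeal V J).relWord (n + 1) ≫ (K.sqZero V).faceSum z n)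
    (e : (K.sqZeroCofIdeal V J).relX 0 ⟶ R) : K.sqZeroRel V J 0 ≫ d 0 ≫ e = 0 := by
  obtain ⟨u, rfl⟩ := (K.sqZeroCofIdeal V J).exists_relWord_comp hJ hR e
  rw [← Category.assoc (d 0), hd, Category.assoc, ← Category.assoc, sqZeroRel_relWord,
    ← Category.assoc, sqZeroIn_faceSum_zero, zero_comp]

lemma exists_whiskerLeft_barB_comp_eq (hJ : IsTensorProduct J) (hR : IsRelInjective J R)
    (hd : ∀ n, d n ≫ (K.sqZeroCofIdeal V J).relWord n =
      (K.sqZeroCofIdeal V J).relWord (n + 1) ≫ (K.sqZero V).faceSum z n)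
    (n : ℕ) (e : (K.sqZeroCofIdeal V J).relX (n + 1) ⟶ R) :
    ∃ w, V ◁ K.barB n ≫ w = K.sqZeroRel V J (n + 1) ≫ d (n + 1) ≫ e := by
  obtain ⟨u, rfl⟩ := (K.sqZeroCofIdeal V J).exists_relWord_comp hJ hR e
  -- The primitive is the restriction of `u` to `V ⊗ K^{⊗ n + 1}`; the sign is that of
  -- `sqZeroIn_faceSum`.
  refine ⟨-(K.sqZeroIn V (n + 1) ≫ u), ?_⟩
  rw [← Category.assoc (d (n + 1)), hd, Category.assoc, ← Category.assoc, sqZeroRel_relWord,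
    ← Category.assoc, sqZeroIn_faceSum, Preadditive.neg_comp, Preadditive.comp_neg, Category.assoc]

end

/-- The cochain attached to a cocycle `c` is its pullback along the projection of `(K ⊕ V)^{⊗ n +
2}` to `V ⊗ K^{⊗ n + 1}`. It vanishes on powers of `K`, and is a cocycle for both boundaries by
`faceSum_sqZeroProj`. The degree shifts by one because of the additional factor `V`. -/
lemma isTest_sqZero (hJ : IsTensorProduct J) (hR : IsRelInjective J R) :
    Precyclic.IsTest (K.sqZeroCofIdeal V J).toRel (fun n => V ◁ K.barB n) (K.sqZeroRel V J) R := by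
  let I := K.sqZeroCofIdeal V J
  have hb' (n : ℕ) : I.cyc.b' n ≫ Precyclic.app I.toAlg n =
      Precyclic.app I.toAlg (n + 1) ≫ (K.sqZero V).faceSum 0 n := by
    rw [(K.sqZero V).faceSum_zero]
    exact Precyclic.b'_app I.toAlg n
  have hb (n : ℕ) : I.cyc.b n ≫ Precyclic.app I.toAlg n =
      Precyclic.app I.toAlg (n + 1) ≫ (K.sqZero V).faceSum (fun n => (-1) ^ (n + 1)) n :=
    Precyclic.b_app I.toAlg n
  have hN (n : ℕ) : I.cyc.N n ≫ Precyclic.app I.toAlg n =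
      Precyclic.app I.toAlg n ≫ (K.sqZero V).normPow n := Precyclic.N_app I.toAlg n
  refine ⟨fun n c hc => ⟨I.relWord (n + 1) ≫ K.sqZeroProj V (n + 1) ≫ c, ?_, ?_, ?_, ?_, ?_⟩,
    K.sqZeroRel_relD_zero_comp V hJ hR hb, K.sqZeroRel_relD_zero_comp V hJ hR hb',
    K.exists_whiskerLeft_barB_comp_eq V hJ hR hb, K.exists_whiskerLeft_barB_comp_eq V hJ hR hb'⟩
  · have h : I.relIncl (n + 1) ≫ I.relWord (n + 1) ≫ K.sqZeroProj V (n + 1) ≫ c = 0 := by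
      have h := congrArg (· ≫ c) (K.relIncl_relWord_sqZeroProj V (J := J) (n + 1))
      simpa only [Category.assoc, zero_comp] using h
    exact h
  · exact K.relD_relWord_sqZeroProj_comp V hb' hc
  · exact K.relD_relWord_sqZeroProj_comp V hb hc
  · have h : K.sqZeroRel V J n ≫ I.relWord (n + 1) ≫ K.sqZeroProj V (n + 1) ≫ c = c := by
      rw [← Category.assoc, sqZeroRel_relWord, ← Category.assoc, sqZeroIn_sqZeroProj,
        Category.id_comp]
    exact h
  · have h : K.sqZeroRel V J n ≫ (I.relWord (n + 1) ≫ (K.sqZero V).normPow (n + 1)) ≫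
        K.sqZeroProj V (n + 1) ≫ c = c := by
      rw [Category.assoc, ← Category.assoc, sqZeroRel_relWord, ← Category.assoc (normPow _ _),
        ← Category.assoc, sqZeroIn_normPow_sqZeroProj, Category.id_comp]
    refine Eq.trans (congrArg (K.sqZeroRel V J n ≫ ·) ?_) h
    exact (Category.assoc _ _ _).symm.trans (congrArg (· ≫ K.sqZeroProj V (n + 1) ≫ c) (hN (n + 1)))

end Alg

end

/-! ### Condition 1 in terms of cochains, and the equivalence -/

section

variable {C : Type u} [Category.{v} C] [Preadditive C] [HasZeroObject C]
  [HasBinaryBiproducts C] [HasFiniteColimits C]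
  [MonoidalCategory C] [SymmetricCategory C] [MonoidalPreadditive C] {J : ObjectProperty C}
  {K : Alg C}

open scoped ZeroObject in
lemma isWeaklyContractible_tensorLeft_bar_iff :
    (∀ V : C, IsWeaklyContractible J
      (((tensorLeft V).mapHomologicalComplex _).obj (Precyclic.bar.obj K.cyc))) ↔
      ∀ R, IsRelInjective J R → K.IsBarAcyclic R := by
  have h (V R : C) : QuasiIso ((homInto _ R).map (0 : (0 : ChainComplex C ℕ) ⟶
      ((tensorLeft V).mapHomologicalComplex _).obj (Precyclic.bar.obj K.cyc)).op) ↔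
      CochainAcyclic (fun n => V ⊗ tpow K.X (n + 1)) (fun n => V ◁ K.barB n) R := by
    have hd : (fun n => (((tensorLeft V).mapHomologicalComplex _).obj
        (Precyclic.bar.obj K.cyc)).d (n + 1) n) = fun n => V ◁ K.barB n :=
      funext fun n => congrArg (V ◁ ·) (ChainComplex.of_d _ _ n)
    rw [quasiIso_zero_iff, hd]
    rfl
  exact ⟨fun H R hR V => (h V R).1 (H V R hR), fun H V R hR => (h V R).2 (H R hR V)⟩

lemma isBarAcyclic_of_isExcisive (hJ : IsTensorProduct J) {D : Precyclic C ⥤ ChainComplex C ℕ}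
    (hD : IsExcisive J D K)
    (h : ∀ {X Y : Precyclic C} {f : X ⟶ Y} {T : ℕ → C} {δ : ∀ n, T (n + 1) ⟶ T n}
      {σ : ∀ n, T n ⟶ Y.obj (n + 1)} {R : C}, Precyclic.IsTest f δ σ R →
      CohomInjective (D.map f) R → CochainAcyclic T δ R) (R : C) (hR : IsRelInjective J R) :
    K.IsBarAcyclic R := fun V =>
  h (K.isTest_sqZero V hJ hR)
    ((quasiIso_homInto_iff _ _).1 (hD _ (K.sqZeroCofIdeal V J) R hR)).1

end

end Wodzicki

theorem theorem5p2 {𝔄 : Type u} [Category.{v} 𝔄] [Preadditive 𝔄]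
    [HasZeroObject 𝔄] [HasBinaryBiproducts 𝔄]
    [HasFiniteLimits 𝔄] [HasFiniteColimits 𝔄]
    [MonoidalCategory 𝔄] [SymmetricCategory 𝔄] [MonoidalPreadditive 𝔄]
    (𝔍 : ObjectProperty 𝔄) (h𝔍 : Wodzicki.IsTensorProduct 𝔍) (K : Wodzicki.Alg 𝔄) :
    List.TFAE [
      ∀ V : 𝔄, Wodzicki.IsWeaklyContractible 𝔍
        (((tensorLeft V).mapHomologicalComplex _).obj (Wodzicki.Precyclic.bar.obj K.cyc)),
      Wodzicki.IsExcisive 𝔍 Wodzicki.Precyclic.hochschild K,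
      Wodzicki.IsExcisive 𝔍 Wodzicki.Precyclic.bar K,
      Wodzicki.IsExcisive 𝔍 (Wodzicki.Precyclic.omega ⋙ Wodzicki.MixedComplex.forget) K,
      Wodzicki.IsExcisive 𝔍 (Wodzicki.Precyclic.omega ⋙ Wodzicki.MixedComplex.bar) K] := by
  rw [Wodzicki.isWeaklyContractible_tensorLeft_bar_iff]
  tfae_have 1 → 2 := Wodzicki.isExcisive_hochschild h𝔍
  tfae_have 1 → 3 := Wodzicki.isExcisive_bar h𝔍
  tfae_have 1 → 4 := Wodzicki.isExcisive_omega h𝔍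
  tfae_have 1 → 5 := Wodzicki.isExcisive_omega_bar h𝔍
  tfae_have 2 → 1 := fun h => Wodzicki.isBarAcyclic_of_isExcisive h𝔍 h
    fun ht => ht.cochainAcyclic_of_hochschild
  tfae_have 3 → 1 := fun h => Wodzicki.isBarAcyclic_of_isExcisive h𝔍 h
    fun ht => ht.cochainAcyclic_of_bar
  tfae_have 4 → 1 := fun h => Wodzicki.isBarAcyclic_of_isExcisive h𝔍 h
    fun ht => ht.cochainAcyclic_of_omega
  tfae_have 5 → 1 := fun h => Wodzicki.isBarAcyclic_of_isExcisive h𝔍 h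
    fun ht => ht.cochainAcyclic_of_omega_bar
  tfae_finish
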